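/- Conventions. Everything is smooth; $[\![\cdots]\!]$ is the bundle of covectors spanned by the enclosed 1-forms, $\langle\cdots\rangle_{\rm alg}$ is the algebraic ideal generated by the enclosed forms, and sums over repeated indices run over $1,\dots,4$. An *exterior differential system* (EDS) on a manifold is a homogeneous ideal $\mathcal I\subset\Omega^*$ closed under $\mathrm d$; $I^1$ denotes the bundle spanned by its degree 1 part. A *hyperbolic Monge–Ampère system* is an EDS on a 5-manifold that is locally algebraically generated by a contact form $\theta$, by $\mathrm d\theta$ and by a 2-form $\Phi$ such that at each point the solutions $[\lambda,\mu]$ of $(\lambda\,\mathrm d\theta+\mu\Phi)^2\equiv0 \bmod\theta$ form precisely two distinct points of $\mathbb{RP}^1$. A *rank $2$ integrable extension* $\pi:(N,\mathcal B)\to(M,\mathcal I)$ is a submersion with 2-dimensional fibres such that, near each point of $N$, there is a rank 2 subbundle $\Theta\subset T^*N$ with $\Theta^\perp\cap\ker\pi_*=0$ for which $\mathcal B$ is algebraically generated by $\pi^*\mathcal I$ and the sections of $\Theta$. A *rank 2 Bäcklund transformation* $(N,\mathcal B;\pi,\bar\pi)$ relating hyperbolic Monge–Ampère systems $(M,\mathcal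 I)$, $(\bar M,\bar{\mathcal I})$ consists of two rank 2 integrable extensions $\pi:(N,\mathcal B)\to(M,\mathcal I)$ and $\bar\pi:(N,\mathcal B)\to(\bar M,\bar{\mathcal I})$. It is of *Type $\mathscr A$* if $\pi^*I^1\cap\bar\pi^*\bar I^1=0$ and if, for nonvanishing local sections $\theta$ of $I^1$ and $\bar\theta$ of $\bar I^1$, at each point of $N$ (pullbacks suppressed) $\lambda\,\mathrm d\theta+\mu\,\mathrm d\bar\theta\equiv0 \bmod B^1$ if and only if $\lambda=\mu=0$. Type $\mathscr A$ congruences. A coframing $\boldsymbol\omega=(\omega^0,\bar\omega^0,\gamma,\omega^1,\dots,\omega^4)$ of a 7-manifold satisfies the Type $\mathscr A$ congruences with $\epsilon=\pm1$ and functions $A,B_i,C_0,C_i,D_i$ $(i=1,\dots,4)$, $A>0$, $A^2\neq\epsilon$ everywhere, if $$\mathrm d\omega^0\equiv A\,\omega^1\wedge\omega^2+\omega^3\wedge\omega^4+(B_3\omega^3+B_4\omega^4)\wedge\gamma \mod \omega^0,$$ $$\mathrm d\bar\omega^0\equiv \omega^1\wedge\omega^2+\epsilon A\,\omega^3\wedge\omega^4+(B_1\omega^1+B_2\omega^2)\wedge\gamma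 \mod \bar\omega^0,$$ $$\mathrm d\gamma\equiv C_0\,\omega^0\wedge\bar\omega^0+C_i\,\omega^i\wedge\omega^0+D_i\,\omega^i\wedge\bar\omega^0\mod\gamma.$$ Invariance property. Let $(X_0,\bar X_0,X_\gamma,X_1,\dots,X_4)$ be the frame dual to $(\omega^0,\bar\omega^0,\gamma,\omega^1,\omega^2,\omega^3-B_4\gamma,\omega^4+B_3\gamma)$ and $(Y_0,\bar Y_0,Y_\gamma,Y_1,\dots,Y_4)$ the frame dual to $(\omega^0,\bar\omega^0,\gamma,\omega^1-B_2\gamma,\omega^2+B_1\gamma,\omega^3,\omega^4)$. The property says: if $K$ is $[\![\omega^0,\omega^1,\omega^2]\!]$ or $[\![\omega^0,\omega^3-B_4\gamma,\omega^4+B_3\gamma]\!]$, then $\mathcal L_{\bar X_0}\sigma$ and $\mathcal L_{X_\gamma}\sigma$ are sections of $K$ for every section $\sigma$ of $K$; if $K$ is $[\![\bar\omega^0,\omega^3,\omega^4]\!]$ or $[\![\bar\omega^0,\omega^1-B_2\gamma,\omega^2+B_1\gamma]\!]$, then $\mathcal L_{Y_0}\sigma$ and $\mathcal L_{Y_\gamma}\sigma$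 are sections of $K$ for every section $\sigma$ of $K$. 0-adapted coframings. A coframing $\boldsymbol\omega$ of $N$ is *0-adapted* to a Type $\mathscr A$ rank 2 Bäcklund transformation $(N,\mathcal B;\pi,\bar\pi)$ if $[\![\omega^0]\!]=\pi^*I^1$, $[\![\bar\omega^0]\!]=\bar\pi^*\bar I^1$, $[\![\omega^0,\bar\omega^0,\gamma]\!]=B^1$, the characteristic bundles of $(N,\mathcal B)$, suitably ordered, are $[\![\omega^0,\bar\omega^0,\gamma,\omega^1,\omega^2]\!]$ and $[\![\omega^0,\bar\omega^0,\gamma,\omega^3,\omega^4]\!]$, and $\boldsymbol\omega$ satisfies the Type $\mathscr A$ congruences for some $\epsilon$ and some functions as above. Here, if locally $\mathcal B=\langle\theta^1,\theta^2,\theta^3,\eta^1\wedge\eta^2,\eta^3\wedge\eta^4\rangle_{\rm alg}$ for a coframing $(\theta^1,\theta^2,\theta^3,\eta^1,\dots,\eta^4)$, the characteristic bundles are $[\![\theta^1,\theta^2,\theta^3,\eta^1,\eta^2]\!]$ and $[\![\theta^1,\theta^2,\theta^3,\eta^3,\eta^4]\!]$. **Proposition.** Let $U$ be a 7-manifold with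 a coframing $\boldsymbol\omega$ that satisfies the Type $\mathscr A$ congruences with some $\epsilon$ and functions $A,B_i,C_0,C_i,D_i$, and that has the invariance property. Then the Pfaffian systems $$\mathcal K=\langle\omega^0,\omega^1,\omega^2,\omega^3-B_4\gamma,\omega^4+B_3\gamma\rangle,\qquad \bar{\mathcal K}=\langle\bar\omega^0,\omega^1-B_2\gamma,\omega^2+B_1\gamma,\omega^3,\omega^4\rangle$$ are Frobenius, and each point of $U$ has an open neighbourhood $V$ on which $\boldsymbol\omega|_V$ is 0-adapted to a Type $\mathscr A$ rank 2 Bäcklund transformation $(V,\mathcal B;\pi,\bar\pi)$ relating hyperbolic Monge–Ampère systems $(M,\mathcal I)$ and $(\bar M,\bar{\mathcal I})$, where $M$ and $\bar M$ may be taken to be open subsets of $\mathbb R^5$. Moreover, these can be chosen so that $\pi:V\to M$ and $\bar\pi:V\to\bar M$ are the quotients of $V$ by the leaves of $\mathcal K|_V$ and of $\bar{\mathcal K}|_V$ (surjective submersions with connected fibres, the tangent spaces of the fibres being the annihilators of $\mathcal K$, resp. $\bar{\mathcal K}$), the algebraic ideals on $V$ generated by $\pi^*\mathcal I$ and $\bar\pi^*\bar{\mathcal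 I}$ are $$\langle\omega^0,\ \omega^1\wedge\omega^2,\ (\omega^3-B_4\gamma)\wedge(\omega^4+B_3\gamma)\rangle_{\rm alg}\quad\text{and}\quad \langle\bar\omega^0,\ (\omega^1-B_2\gamma)\wedge(\omega^2+B_1\gamma),\ \omega^3\wedge\omega^4\rangle_{\rm alg},$$ and $\mathcal B=\langle\omega^0,\bar\omega^0,\gamma,\omega^1\wedge\omega^2,\omega^3\wedge\omega^4\rangle_{\rm alg}$. -/

import Mathlib

open scoped Manifold ContDiff TensorProduct

noncomputable section

namespace Backlund

/-! ## Differential forms on manifolds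

All manifolds are smooth manifolds without boundary modelled on `EuclideanSpace ℝ (Fin n)`
(model with corners `𝓡 n`).  Mathlib's `TangentSpace (𝓡 n) x` is by definition the model space. -/

/-- Alternating `k`-covectors on the model space. -/
abbrev Cov (n k : ℕ) : Type := EuclideanSpace ℝ (Fin n) [⋀^Fin k]→L[ℝ] ℝ

/-- The wedge product of alternating covectors, normalized as a sum over shuffles,
so `(a ∧ b) (u, v) = a u * b v - a v * b u` for `k = l = 1`. -/
def wedge {n k l : ℕ} (a : Cov n k) (b : Cov n l) : Cov n (k + l) :=
  { toMultilinearMap := (((LinearMap.mul' ℝ ℝ).compAlternatingMap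
      (a.toAlternatingMap.domCoprod b.toAlternatingMap)).domDomCongr
        finSumFinEquiv).toMultilinearMap
    cont := by
      change Continuous fun v : Fin (k + l) → EuclideanSpace ℝ (Fin n) =>
        LinearMap.mul' ℝ ℝ ((a.toAlternatingMap.domCoprod b.toAlternatingMap)
          (fun i => v (finSumFinEquiv i)))
      simp only [AlternatingMap.domCoprod_apply, _root_.sum_apply, map_sum]
      refine continuous_finsetSum _ fun σ _ => ?_
      induction σ using Quotient.inductionOn' with
      | h σ =>
        have h : Continuous fun v : Fin (k + l) → EuclideanSpace ℝ (Fin n) =>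
            ((Equiv.Perm.sign σ : ℤ) : ℝ) *
              (a (fun i => v (finSumFinEquiv (σ (Sum.inl i)))) *
                b (fun i => v (finSumFinEquiv (σ (Sum.inr i))))) :=
          continuous_const.mul ((a.cont.comp (f := fun v : Fin (k + l) → _ => fun i =>
              v (finSumFinEquiv (σ (Sum.inl i)))) (by fun_prop)).mul
            (b.cont.comp (f := fun v : Fin (k + l) → _ => fun i =>
              v (finSumFinEquiv (σ (Sum.inr i)))) (by fun_prop)))
        convert h using 2 with v
        change LinearMap.mul' ℝ ℝ ((Equiv.Perm.sign σ : ℤ) •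
          (a (fun i => v (finSumFinEquiv (σ (Sum.inl i)))) ⊗ₜ[ℝ]
            b (fun i => v (finSumFinEquiv (σ (Sum.inr i)))))) = _
        rw [map_zsmul, LinearMap.mul'_apply, zsmul_eq_mul]
    map_eq_zero_of_eq' := (((LinearMap.mul' ℝ ℝ).compAlternatingMap
      (a.toAlternatingMap.domCoprod b.toAlternatingMap)).domDomCongr
        finSumFinEquiv).map_eq_zero_of_eq' }

/-- Not necessarily smooth differential `k`-forms on an `n`-manifold `M`. -/
abbrev Form (n k : ℕ) (M : Type*) : Type _ := M → Cov n k

section Forms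

variable {n m k l : ℕ}
  {M : Type*} [TopologicalSpace M] [ChartedSpace (EuclideanSpace ℝ (Fin n)) M]
  {N : Type*} [TopologicalSpace N] [ChartedSpace (EuclideanSpace ℝ (Fin m)) N]

/-- Pullback of a form along a map. -/
def pullback (f : M → N) (β : Form m k N) : Form n k M := fun x =>
  (β (f x)).compContinuousLinearMap (mfderiv (𝓡 n) (𝓡 m) f x)

/-- The expression of a form in the preferred chart at `x₀`, a form on the target of this chart
(an open subset of the model space). -/
def chartRep (x₀ : M) (α : Form n k M) : EuclideanSpace ℝ (Fin n) → Cov n k := fun y =>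
  (α ((extChartAt (𝓡 n) x₀).symm y)).compContinuousLinearMap
    (mfderiv 𝓘(ℝ, EuclideanSpace ℝ (Fin n)) (𝓡 n) (extChartAt (𝓡 n) x₀).symm y)

/-- Smoothness of a form: smoothness of all its expressions in charts. -/
def IsSmooth (α : Form n k M) : Prop :=
  ∀ x₀ : M, ContDiffOn ℝ ∞ (chartRep x₀ α) (extChartAt (𝓡 n) x₀).target

/-- The exterior derivative, computed in the preferred chart at each point. -/
def d (α : Form n k M) : Form n (k + 1) M := fun x =>
  (extDeriv (chartRep x α) (extChartAt (𝓡 n) x x)).compContinuousLinearMap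
    (mfderiv (𝓡 n) 𝓘(ℝ, EuclideanSpace ℝ (Fin n)) (extChartAt (𝓡 n) x) x)

/-- Pointwise wedge product of forms. -/
def fwedge (α : Form n k M) (β : Form n l M) : Form n (k + l) M := fun x => wedge (α x) (β x)

/-- The Lie derivative of a `1`-form, `L_X σ = X ⌟ dσ + d (σ(X))`. -/
def lieDeriv (X : M → EuclideanSpace ℝ (Fin n)) (σ : Form n 1 M) : Form n 1 M := fun x =>
  ContinuousAlternatingMap.curryLeft (n := 1) (d σ x) (X x) +
    ContinuousAlternatingMap.ofSubsingleton ℝ (EuclideanSpace ℝ (Fin n)) ℝ (0 : Fin 1)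
      (mfderiv (𝓡 n) 𝓘(ℝ, ℝ) (fun y => σ y ![X y]) x)

/-- The fibre at `x` of the bundle `⟦κ₁, κ₂, …⟧` generated by a family of `1`-forms. -/
def spanAt {ι : Type*} (κ : ι → Form n 1 M) (x : M) : Submodule ℝ (Cov n 1) :=
  Submodule.span ℝ (Set.range fun i => κ i x)

/-- The `(k+1)`-covectors that are congruent to `0` modulo a space `K` of `1`-covectors, i.e.
those in the algebraic ideal generated by `K`. -/
def zeroMod (K : Submodule ℝ (Cov n 1)) (k : ℕ) : Submodule ℝ (Cov n (1 + k)) :=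
  Submodule.span ℝ {β | ∃ κ ∈ K, ∃ a : Cov n k, β = wedge κ a}

/-- Smooth `1`-forms that are linearly independent at each point. -/
def IsFrame {r : ℕ} (κ : Fin r → Form n 1 M) : Prop :=
  (∀ i, IsSmooth (κ i)) ∧ ∀ x, LinearIndependent ℝ fun i => κ i x

/-- The pullback along `f` of a bundle of `1`-covectors. -/
def pullbackBundle (f : M → N) (χ : N → Submodule ℝ (Cov m 1)) (x : M) :
    Submodule ℝ (Cov n 1) :=
  Submodule.span ℝ
    {b | ∃ a ∈ χ (f x), b = a.compContinuousLinearMap (mfderiv (𝓡 n) (𝓡 m) f x)}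

/-- A Pfaffian system given by a frame is Frobenius if the exterior derivatives of its generators
are congruent to `0` modulo the system. -/
def IsFrobenius {r : ℕ} (κ : Fin r → Form n 1 M) : Prop :=
  IsFrame κ ∧ ∀ i x, d (κ i) x ∈ zeroMod (spanAt κ x) 1

/-- `π : M → N` is the quotient of `M` by the leaves of the Pfaffian system `κ`: a surjective
submersion whose fibres are connected and tangent to the annihilator of `κ`. -/
def IsLeafSpace {r : ℕ} (κ : Fin r → Form n 1 M) (π : M → N) : Prop :=
  ContMDiff (𝓡 n) (𝓡 m) ∞ π ∧ Function.Surjective π ∧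
  (∀ x, Function.Surjective (mfderiv (𝓡 n) (𝓡 m) π x)) ∧
  (∀ y, IsConnected (π ⁻¹' {y})) ∧
  ∀ x (v : TangentSpace (𝓡 n) x), mfderiv (𝓡 n) (𝓡 m) π x v = 0 ↔ ∀ i, κ i x ![v] = 0

/-! ## Exterior differential systems -/

/-- Graded sets of forms. -/
abbrev GradedSet (n : ℕ) (M : Type*) : Type _ := ∀ k, Set (Form n k M)

/-- The graded set consisting of the given `1`-forms and `2`-forms. -/
def gens (S₁ : Set (Form n 1 M)) (S₂ : Set (Form n 2 M)) : GradedSet n M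
  | 1 => S₁
  | 2 => S₂
  | _ => ∅

/-- The (homogeneous elements of the) algebraic ideal `⟨S⟩_alg` of `Ω^*(M)` generated by `S`.
The system `S` is meant to consist of smooth forms. -/
inductive AlgIdeal (S : GradedSet n M) : ∀ k, Form n k M → Prop
  | of {k : ℕ} {α : Form n k M} : α ∈ S k → AlgIdeal S k α
  | zero (k : ℕ) : AlgIdeal S k 0
  | add {k : ℕ} {α β : Form n k M} : AlgIdeal S k α → AlgIdeal S k β → AlgIdeal S k (α + β)
  | wedge {k l : ℕ} {α : Form n k M} {β : Form n l M} :
      AlgIdeal S k α → IsSmooth β → AlgIdeal S (k + l) (fwedge α β)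

end Forms

/-- An exterior differential system on `M`: a homogeneous ideal in `Ω^*(M)` (given by its graded
pieces) that is closed under exterior differentiation. -/
structure EDS (n : ℕ) (M : Type*) [TopologicalSpace M]
    [ChartedSpace (EuclideanSpace ℝ (Fin n)) M] where
  carrier : GradedSet n M
  smooth : ∀ {k : ℕ} {α : Form n k M}, α ∈ carrier k → IsSmooth α
  zero_mem : ∀ k, (0 : Form n k M) ∈ carrier k
  add_mem : ∀ {k : ℕ} {α β : Form n k M}, α ∈ carrier k → β ∈ carrier k → α + β ∈ carrier k
  wedge_mem : ∀ {k l : ℕ} {α : Form n k M} {β : Form n l M},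
    α ∈ carrier k → IsSmooth β → fwedge α β ∈ carrier (k + l)
  d_mem : ∀ {k : ℕ} {α : Form n k M}, α ∈ carrier k → d α ∈ carrier (k + 1)

section Systems

variable {n m k l : ℕ}
  {M : Type*} [TopologicalSpace M] [ChartedSpace (EuclideanSpace ℝ (Fin n)) M]
  {N : Type*} [TopologicalSpace N] [ChartedSpace (EuclideanSpace ℝ (Fin m)) N]

/-- The graded set `f^* I`. -/
def EDS.pull (I : EDS n M) (f : N → M) : GradedSet m N := fun k =>
  {β | ∃ α ∈ I.carrier k, β = pullback f α}

/-- The restriction of the ideal `I` to the open set `W` is the algebraic ideal generated by `S`. -/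
def EDS.IsGeneratedOn (I : EDS n M) (W : TopologicalSpace.Opens M) (S : GradedSet n W) : Prop :=
  ∀ k (α : Form n k W), AlgIdeal (I.pull (Subtype.val : W → M)) k α ↔ AlgIdeal S k α

/-- The fibre at `x` of the bundle `I¹` generated by the degree `1` part of `I`. -/
def EDS.bundle (I : EDS n M) (x : M) : Submodule ℝ (Cov n 1) :=
  Submodule.span ℝ {a | ∃ α ∈ I.carrier 1, a = α x}

/-- A rank `r` integrable extension `π : (N, J) → (M, I)`: a submersion with fibre dimension `r`
such that locally there is a rank `r` bundle `Θ = ⟦ϑ₁, …, ϑ_r⟧` of covectors for which `J` is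
algebraically generated by `π^* I` and the sections of `Θ`, and `Θ^⊥ ∩ ker π_* = 0`.
(As the open sets `W` may be shrunk, `Θ` may be taken to be trivialized by a frame.) -/
def IsIntegrableExtension (r : ℕ) (J : EDS m N) (I : EDS n M) (π : N → M) : Prop :=
  m = n + r ∧ ContMDiff (𝓡 m) (𝓡 n) ∞ π ∧
  (∀ x, Function.Surjective (mfderiv (𝓡 m) (𝓡 n) π x)) ∧
  ∀ p : N, ∃ W : TopologicalSpace.Opens N, p ∈ W ∧ ∃ ϑ : Fin r → Form m 1 W,
    IsFrame ϑ ∧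
    J.IsGeneratedOn W
      (fun k => I.pull (fun x : W => π x) k ∪ gens (Set.range ϑ) ∅ k) ∧
    ∀ (x : W) (v : TangentSpace (𝓡 m) x), (∀ i, ϑ i x ![v] = 0) →
      mfderiv (𝓡 m) (𝓡 n) (fun y : W => π y) x v = 0 → v = 0

end Systems

section MongeAmpere

/-- Hyperbolic Monge-Ampère systems: EDS on `5`-manifolds that are locally algebraically generated
by a contact form `θ`, by `dθ` and by a `2`-form `Φ` such that, at each point, the nonzero
solutions `(a, b)` of `(a dθ + b Φ)² ≡ 0 mod θ` form precisely two distinct points of the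
projective line, i.e. two distinct lines through the origin (spanned by `u` and `v`). -/
def IsHyperbolicMA {M : Type*} [TopologicalSpace M]
    [ChartedSpace (EuclideanSpace ℝ (Fin 5)) M] (I : EDS 5 M) : Prop :=
  ∀ p : M, ∃ W : TopologicalSpace.Opens M, p ∈ W ∧ ∃ (θ : Form 5 1 W) (Φ : Form 5 2 W),
    IsSmooth θ ∧ IsSmooth Φ ∧
    (∀ x, fwedge θ (fwedge (d θ) (d θ)) x ≠ 0) ∧
    I.IsGeneratedOn W (gens {θ} {d θ, Φ}) ∧
    ∀ x, ∃ u v : Fin 2 → ℝ, LinearIndependent ℝ ![u, v] ∧ ∀ c : Fin 2 → ℝ,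
      wedge (c 0 • d θ x + c 1 • Φ x : Cov 5 2) (c 0 • d θ x + c 1 • Φ x : Cov 5 2) ∈
          zeroMod (Submodule.span ℝ {θ x}) 3 ↔
        c ∈ Submodule.span ℝ {u} ∨ c ∈ Submodule.span ℝ {v}

end MongeAmpere

section Transformations

variable
  {N : Type*} [TopologicalSpace N] [ChartedSpace (EuclideanSpace ℝ (Fin 7)) N]
  {M : Type*} [TopologicalSpace M] [ChartedSpace (EuclideanSpace ℝ (Fin 5)) M]
  {Mb : Type*} [TopologicalSpace Mb] [ChartedSpace (EuclideanSpace ℝ (Fin 5)) Mb]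

/-- A rank `2` Bäcklund transformation `(N, 𝓑; π, πb)` relating two hyperbolic Monge-Ampère
systems `(M, I)` and `(Mb, Ib)`. -/
structure IsRankTwoBacklund (𝓑 : EDS 7 N) (I : EDS 5 M) (Ib : EDS 5 Mb)
    (π : N → M) (πb : N → Mb) : Prop where
  left_MA : IsHyperbolicMA I
  right_MA : IsHyperbolicMA Ib
  left_ext : IsIntegrableExtension 2 𝓑 I π
  right_ext : IsIntegrableExtension 2 𝓑 Ib πb

/-- First genericity condition: `π^* I¹ ∩ πb^* Ib¹ = 0`. -/
def FirstGenericity (I : EDS 5 M) (Ib : EDS 5 Mb) (π : N → M) (πb : N → Mb) : Prop :=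
  ∀ p, pullbackBundle (n := 7) π I.bundle p ⊓ pullbackBundle (n := 7) πb Ib.bundle p = ⊥

/-- Second genericity condition: at each point, `a dθ + b dθb ≡ 0 mod 𝓑¹` only if `a = b = 0`,
for all sections `θ` of `I¹`, `θb` of `Ib¹` that do not vanish at the point in question. -/
def SecondGenericity (𝓑 : EDS 7 N) (I : EDS 5 M) (Ib : EDS 5 Mb) (π : N → M) (πb : N → Mb) :
    Prop :=
  ∀ p : N, ∀ θ ∈ I.carrier 1, θ (π p) ≠ 0 → ∀ θb ∈ Ib.carrier 1, θb (πb p) ≠ 0 →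
    ∀ a b : ℝ,
      (a • pullback (n := 7) π (d θ) p + b • pullback (n := 7) πb (d θb) p : Cov 7 2) ∈
        zeroMod (𝓑.bundle p) 1 ↔ a = 0 ∧ b = 0

/-- Rank `2` Bäcklund transformations of Type `𝒜`: both genericity conditions hold. -/
structure IsTypeA (𝓑 : EDS 7 N) (I : EDS 5 M) (Ib : EDS 5 Mb)
    (π : N → M) (πb : N → Mb) : Prop where
  backlund : IsRankTwoBacklund 𝓑 I Ib π πb
  first : FirstGenericity I Ib π πb
  second : SecondGenericity 𝓑 I Ib π πb

/-- `(χ₁, χ₂)` is the pair of characteristic bundles, in one of its two orders, of the hyperbolic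
EDS `𝓑` of class `3`: locally there is a coframing `(θ¹, θ², θ³, η¹, …, η⁴)` with
`𝓑 = ⟨θ¹, θ², θ³, η¹ ∧ η², η³ ∧ η⁴⟩_alg`, `χ₁ = ⟦θ¹, θ², θ³, η¹, η²⟧` and
`χ₂ = ⟦θ¹, θ², θ³, η³, η⁴⟧`. -/
def IsCharacteristicPair (𝓑 : EDS 7 N) (χ₁ χ₂ : N → Submodule ℝ (Cov 7 1)) : Prop :=
  ∀ p : N, ∃ W : TopologicalSpace.Opens N, p ∈ W ∧
    ∃ (θ : Fin 3 → Form 7 1 W) (η₁ η₂ η₃ η₄ : Form 7 1 W),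
      IsFrame ![θ 0, θ 1, θ 2, η₁, η₂, η₃, η₄] ∧
      𝓑.IsGeneratedOn W (gens (Set.range θ) {fwedge η₁ η₂, fwedge η₃ η₄}) ∧
      ∀ x : W,
        pullbackBundle (Subtype.val : W → N) χ₁ x = spanAt ![θ 0, θ 1, θ 2, η₁, η₂] x ∧
        pullbackBundle (Subtype.val : W → N) χ₂ x = spanAt ![θ 0, θ 1, θ 2, η₃, η₄] x

end Transformations

/-! ## Coframings satisfying the Type `𝒜` congruences -/

/-- Seven `1`-forms `(ω⁰, ω̄⁰, γ, ω¹, …, ω⁴)` on a `7`-manifold. -/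
structure Forms7 (N : Type*) where
  w0 : Form 7 1 N
  wb : Form 7 1 N
  γ : Form 7 1 N
  w1 : Form 7 1 N
  w2 : Form 7 1 N
  w3 : Form 7 1 N
  w4 : Form 7 1 N

/-- Functions `A, B_i, C_0, C_i, D_i`, `i = 1, …, 4`. -/
structure Coeffs (N : Type*) where
  A : N → ℝ
  B1 : N → ℝ
  B2 : N → ℝ
  B3 : N → ℝ
  B4 : N → ℝ
  C0 : N → ℝ
  C1 : N → ℝ
  C2 : N → ℝ
  C3 : N → ℝ
  C4 : N → ℝ
  D1 : N → ℝ
  D2 : N → ℝ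
  D3 : N → ℝ
  D4 : N → ℝ

section Coframings

variable {N : Type*} [TopologicalSpace N] [ChartedSpace (EuclideanSpace ℝ (Fin 7)) N]

/-- The forms make up a (smooth) coframing. -/
def Forms7.IsCoframing (Ω : Forms7 N) : Prop :=
  IsFrame ![Ω.w0, Ω.wb, Ω.γ, Ω.w1, Ω.w2, Ω.w3, Ω.w4]

/-- The restriction of seven forms to an open subset. -/
def Forms7.restrict (Ω : Forms7 N) (V : TopologicalSpace.Opens N) : Forms7 V where
  w0 := pullback (Subtype.val : V → N) Ω.w0
  wb := pullback (Subtype.val : V → N) Ω.wb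
  γ := pullback (Subtype.val : V → N) Ω.γ
  w1 := pullback (Subtype.val : V → N) Ω.w1
  w2 := pullback (Subtype.val : V → N) Ω.w2
  w3 := pullback (Subtype.val : V → N) Ω.w3
  w4 := pullback (Subtype.val : V → N) Ω.w4

/-- The functions are smooth. -/
def Coeffs.IsSmooth (c : Coeffs N) : Prop :=
  ∀ i, ContMDiff (𝓡 7) 𝓘(ℝ, ℝ) ∞
    (![c.A, c.B1, c.B2, c.B3, c.B4, c.C0, c.C1, c.C2, c.C3, c.C4, c.D1, c.D2, c.D3, c.D4] i)

/-- The Type `𝒜` congruences: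
`dω⁰ ≡ A ω¹∧ω² + ω³∧ω⁴ + (B₃ ω³ + B₄ ω⁴)∧γ mod ω⁰`,
`dω̄⁰ ≡ ω¹∧ω² + ε A ω³∧ω⁴ + (B₁ ω¹ + B₂ ω²)∧γ mod ω̄⁰`,
`dγ ≡ C₀ ω⁰∧ω̄⁰ + C_i ω^i∧ω⁰ + D_i ω^i∧ω̄⁰ mod γ`,
where `ε = ±1`, `A > 0`, `A² ≠ ε`. -/
structure TypeACongruences (Ω : Forms7 N) (ε : ℝ) (c : Coeffs N) : Prop where
  sign : ε = 1 ∨ ε = -1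
  smooth : c.IsSmooth
  A_pos : ∀ x, 0 < c.A x
  A_sq : ∀ x, c.A x ^ 2 ≠ ε
  d_w0 : ∀ x, d Ω.w0 x -
      (c.A x • wedge (Ω.w1 x) (Ω.w2 x) + wedge (Ω.w3 x) (Ω.w4 x) +
        wedge (c.B3 x • Ω.w3 x + c.B4 x • Ω.w4 x) (Ω.γ x)) ∈
    zeroMod (Submodule.span ℝ {Ω.w0 x}) 1
  d_wb : ∀ x, d Ω.wb x -
      (wedge (Ω.w1 x) (Ω.w2 x) + (ε * c.A x) • wedge (Ω.w3 x) (Ω.w4 x) +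
        wedge (c.B1 x • Ω.w1 x + c.B2 x • Ω.w2 x) (Ω.γ x)) ∈
    zeroMod (Submodule.span ℝ {Ω.wb x}) 1
  d_γ : ∀ x, d Ω.γ x -
      (c.C0 x • wedge (Ω.w0 x) (Ω.wb x) +
        (c.C1 x • wedge (Ω.w1 x) (Ω.w0 x) + c.C2 x • wedge (Ω.w2 x) (Ω.w0 x) +
          c.C3 x • wedge (Ω.w3 x) (Ω.w0 x) + c.C4 x • wedge (Ω.w4 x) (Ω.w0 x)) +
        (c.D1 x • wedge (Ω.w1 x) (Ω.wb x) + c.D2 x • wedge (Ω.w2 x) (Ω.wb x) +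
          c.D3 x • wedge (Ω.w3 x) (Ω.wb x) + c.D4 x • wedge (Ω.w4 x) (Ω.wb x))) ∈
    zeroMod (Submodule.span ℝ {Ω.γ x}) 1

/-- `ω¹ - B₂ γ` -/
def Forms7.w1' (Ω : Forms7 N) (c : Coeffs N) : Form 7 1 N := fun x => Ω.w1 x - c.B2 x • Ω.γ x

/-- `ω² + B₁ γ` -/
def Forms7.w2' (Ω : Forms7 N) (c : Coeffs N) : Form 7 1 N := fun x => Ω.w2 x + c.B1 x • Ω.γ x

/-- `ω³ - B₄ γ` -/
def Forms7.w3' (Ω : Forms7 N) (c : Coeffs N) : Form 7 1 N := fun x => Ω.w3 x - c.B4 x • Ω.γ x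

/-- `ω⁴ + B₃ γ` -/
def Forms7.w4' (Ω : Forms7 N) (c : Coeffs N) : Form 7 1 N := fun x => Ω.w4 x + c.B3 x • Ω.γ x

/-- The Pfaffian system `𝒦 = ⟨ω⁰, ω¹, ω², ω³ - B₄γ, ω⁴ + B₃γ⟩`. -/
def Forms7.systemK (Ω : Forms7 N) (c : Coeffs N) : Fin 5 → Form 7 1 N :=
  ![Ω.w0, Ω.w1, Ω.w2, Ω.w3' c, Ω.w4' c]

/-- The Pfaffian system `𝒦̄ = ⟨ω̄⁰, ω¹ - B₂γ, ω² + B₁γ, ω³, ω⁴⟩`. -/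
def Forms7.systemKb (Ω : Forms7 N) (c : Coeffs N) : Fin 5 → Form 7 1 N :=
  ![Ω.wb, Ω.w1' c, Ω.w2' c, Ω.w3, Ω.w4]

/-- The vector fields `X` are the frame dual to the coframing `κ`. -/
def IsDualFrame (κ : Fin 7 → Form 7 1 N) (X : Fin 7 → N → EuclideanSpace ℝ (Fin 7)) : Prop :=
  ∀ x i j, κ i x ![X j x] = if i = j then 1 else 0

/-- `σ ∈ Γ(K)` implies `L_X σ ∈ Γ(K)`, for the bundle `K` generated by the `1`-forms `κ`. -/
def IsInvariant {r : ℕ} (κ : Fin r → Form 7 1 N) (X : N → EuclideanSpace ℝ (Fin 7)) : Prop :=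
  ∀ σ : Form 7 1 N, IsSmooth σ → (∀ x, σ x ∈ spanAt κ x) →
    IsSmooth (lieDeriv X σ) ∧ ∀ x, lieDeriv X σ x ∈ spanAt κ x

/-- The invariance property.  Here `X = (X₀, X̄₀, X_γ, X₁, …, X₄)` is the frame dual to
`(ω⁰, ω̄⁰, γ, ω¹, ω², ω³ - B₄γ, ω⁴ + B₃γ)`, and `Y = (Y₀, Ȳ₀, Y_γ, Y₁, …, Y₄)` is the frame dual to
`(ω⁰, ω̄⁰, γ, ω¹ - B₂γ, ω² + B₁γ, ω³, ω⁴)`. -/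
def InvarianceProperty (Ω : Forms7 N) (c : Coeffs N) : Prop :=
  (∀ X, IsDualFrame ![Ω.w0, Ω.wb, Ω.γ, Ω.w1, Ω.w2, Ω.w3' c, Ω.w4' c] X →
    (IsInvariant ![Ω.w0, Ω.w1, Ω.w2] (X 1) ∧ IsInvariant ![Ω.w0, Ω.w1, Ω.w2] (X 2)) ∧
    (IsInvariant ![Ω.w0, Ω.w3' c, Ω.w4' c] (X 1) ∧
      IsInvariant ![Ω.w0, Ω.w3' c, Ω.w4' c] (X 2))) ∧
  (∀ Y, IsDualFrame ![Ω.w0, Ω.wb, Ω.γ, Ω.w1' c, Ω.w2' c, Ω.w3, Ω.w4] Y →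
    (IsInvariant ![Ω.wb, Ω.w3, Ω.w4] (Y 0) ∧ IsInvariant ![Ω.wb, Ω.w3, Ω.w4] (Y 2)) ∧
    (IsInvariant ![Ω.wb, Ω.w1' c, Ω.w2' c] (Y 0) ∧
      IsInvariant ![Ω.wb, Ω.w1' c, Ω.w2' c] (Y 2)))

/-- The coframing `Ω` of `N` is `0`-adapted to `(N, 𝓑; π, πb)`, with
`χ₁₀ = ⟦ω⁰, ω̄⁰, γ, ω¹, ω²⟧` and `χ₀₁ = ⟦ω⁰, ω̄⁰, γ, ω³, ω⁴⟧` as the ordered pair of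
characteristic bundles. -/
structure IsZeroAdapted {M : Type*} [TopologicalSpace M]
    [ChartedSpace (EuclideanSpace ℝ (Fin 5)) M] {Mb : Type*} [TopologicalSpace Mb]
    [ChartedSpace (EuclideanSpace ℝ (Fin 5)) Mb] (Ω : Forms7 N)
    (𝓑 : EDS 7 N) (I : EDS 5 M) (Ib : EDS 5 Mb) (π : N → M) (πb : N → Mb) : Prop where
  coframing : Ω.IsCoframing
  span_w0 : ∀ x, Submodule.span ℝ {Ω.w0 x} = pullbackBundle π I.bundle x
  span_wb : ∀ x, Submodule.span ℝ {Ω.wb x} = pullbackBundle πb Ib.bundle x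
  span_B : ∀ x, spanAt ![Ω.w0, Ω.wb, Ω.γ] x = 𝓑.bundle x
  characteristic : IsCharacteristicPair 𝓑 (spanAt ![Ω.w0, Ω.wb, Ω.γ, Ω.w1, Ω.w2])
    (spanAt ![Ω.w0, Ω.wb, Ω.γ, Ω.w3, Ω.w4])
  congruences : ∃ (ε : ℝ) (c : Coeffs N), TypeACongruences Ω ε c

/-- The restriction of functions to an open subset. -/
def Coeffs.restrict (c : Coeffs N) (V : TopologicalSpace.Opens N) : Coeffs V where
  A := fun x => c.A x
  B1 := fun x => c.B1 x
  B2 := fun x => c.B2 x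
  B3 := fun x => c.B3 x
  B4 := fun x => c.B4 x
  C0 := fun x => c.C0 x
  C1 := fun x => c.C1 x
  C2 := fun x => c.C2 x
  C3 := fun x => c.C3 x
  C4 := fun x => c.C4 x
  D1 := fun x => c.D1 x
  D2 := fun x => c.D2 x
  D3 := fun x => c.D3 x
  D4 := fun x => c.D4 x

end Coframings

end Backlund

end

set_option linter.unusedSectionVars false

noncomputable section

namespace Backlund

/-! ## Algebra of the wedge product -/

section AltSum

variable {E : Type*}

/-! The terms with `γ` are absorbed by completing products: `(ω³ - B₄γ)∧(ω⁴ + B₃γ) = ω³∧ω⁴ + (B₃ω³ +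
B₄ω⁴)∧γ`, and similarly for `ω¹, ω²`. Both sides of the transformation thus become instances of one
situation, `IsInvariantCoframing`: a coframing `(θ, α₁, α₂, β₁, β₂, ζ₁, ζ₂)` with `dθ ≡ P α₁∧α₂ + Q
β₁∧β₂ mod θ`, where `P` and `Q` have no zeros and `⟦θ, α₁, α₂⟧`, `⟦θ, β₁, β₂⟧` are invariant along
the common kernel of the first five forms. Invariance means that `dαᵢ(z, v) = 0` when `z` is in this
kernel and `v` is annihilated by `θ, α₁, α₂`; the same holds for `β`. Hence the first five forms are
a Frobenius system (`isFrobenius`), and the ideal `⟨θ, α₁∧α₂, β₁∧β₂⟩` is closed under `d`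
(`d_system_mem`).

This ideal descends to the leaf space. Let `π` be a leaf projection with a section `s`. For `σ`
among `θ, α₁, α₂`, the components of `π^*s^*σ` along the `β` directions satisfy a linear homogeneous
differential equation on curves in the leaves and vanish on the section, so they vanish identically
(`lift_α_dual_β`). Hence `⟦θ, α₁, α₂⟧` descends, so does `⟦θ, β₁, β₂⟧`, and so does their
intersection `⟦θ⟧`. The forms `s^*θ`, `s^*(α₁∧α₂)`, `s^*(β₁∧β₂)` therefore generate a system whose
pullback generates the original ideal (`algIdeal_lift_iff`). It is hyperbolic Monge-Ampère because
`PQ ≠ 0`.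

The system `𝓑` is closed under `d` because `dω⁰` and `d(ω¹∧ω²)` are controlled by the left ideal,
`dω̄⁰` and `d(ω³∧ω⁴)` by the right one, and `dγ` by its own congruence (`d_generators_mem`). It is
an integrable extension of either system by the two remaining forms of the coframing. The second
genericity condition is the invertibility of a `2 × 2` matrix whose determinant is, up to sign and
nonzero factors, `εA² - 1`.

Leaf projections come from the Frobenius theorem (`exists_flat_chart`). Its proof obtains a smooth
family of integral curves from the inverse function theorem in a space of continuous paths and shows
by a Grönwall argument that their variations stay tangent to the system. Both foliations have to be
treated on the same neighbourhood. Every sufficiently small coordinate ball has convex image under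
either flat chart (`eventually_convex_image_ball`), and a convex image is enough for a global smooth
section and connected fibres (`exists_isLeafProjection`). -/

/-- The sum of the values of `f` at the permutations of a tuple, weighted by the signs. -/
def altSum (n : ℕ) (f : (Fin n → E) → ℝ) (v : Fin n → E) : ℝ :=
  ∑ σ : Equiv.Perm (Fin n), ((Equiv.Perm.sign σ : ℤ) : ℝ) * f (v ∘ σ)

lemma altSum_comp_perm {n : ℕ} (f : (Fin n → E) → ℝ) (τ : Equiv.Perm (Fin n)) (v : Fin n → E) :
    altSum n (fun w => f (w ∘ τ)) v = ((Equiv.Perm.sign τ : ℤ) : ℝ) * altSum n f v := by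
  unfold altSum
  rw [Finset.mul_sum]
  conv_rhs => rw [← Equiv.sum_comp (Equiv.mulRight τ)]
  refine Finset.sum_congr rfl fun σ _ => ?_
  have h : ((Equiv.Perm.sign τ : ℤ) : ℝ) * ((Equiv.Perm.sign τ : ℤ) : ℝ) = 1 := by
    rcases Int.units_eq_one_or (Equiv.Perm.sign τ) with h | h <;> simp [h]
  simp only [Equiv.coe_mulRight, Equiv.Perm.sign_mul, Units.val_mul, Int.cast_mul,
    Equiv.Perm.coe_mul, Function.comp_assoc]
  linear_combination (-((Equiv.Perm.sign σ : ℤ) : ℝ) * f (v ∘ σ ∘ τ)) * h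

lemma altSum_const_mul {n : ℕ} (r : ℝ) (f : (Fin n → E) → ℝ) (v : Fin n → E) :
    altSum n (fun w => r * f w) v = r * altSum n f v := by
  unfold altSum
  rw [Finset.mul_sum]
  exact Finset.sum_congr rfl fun σ _ => by ring

lemma altSum_add {n : ℕ} (f g : (Fin n → E) → ℝ) (v : Fin n → E) :
    altSum n (fun w => f w + g w) v = altSum n f v + altSum n g v := by
  unfold altSum
  rw [← Finset.sum_add_distrib]
  exact Finset.sum_congr rfl fun σ _ => by ring

lemma altSum_sum {n : ℕ} {ι : Type*} (s : Finset ι) (f : ι → (Fin n → E) → ℝ) (v : Fin n → E) :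
    altSum n (fun w => ∑ i ∈ s, f i w) v = ∑ i ∈ s, altSum n (f i) v := by
  unfold altSum
  rw [Finset.sum_comm]
  exact Finset.sum_congr rfl fun σ _ => by rw [Finset.mul_sum]

lemma altSum_cast {n m : ℕ} (h : n = m) (f : (Fin n → E) → ℝ) (v : Fin m → E) :
    altSum n f (v ∘ Fin.cast h) = altSum m (fun w => f (w ∘ Fin.cast h)) v := by
  subst h; rfl

/-- An inner alternation over some of the positions is absorbed by the outer one. -/
lemma altSum_altSum {m n : ℕ} (ι : Fin m ↪ Fin n) (g : (Fin n → E) → (Fin m → E) → ℝ)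
    (hg : ∀ w (τ : Equiv.Perm (Fin m)), g (w ∘ τ.viaFintypeEmbedding ι) = g w) (v : Fin n → E) :
    altSum n (fun w => altSum m (g w) (w ∘ ι)) v =
      (m.factorial : ℝ) * altSum n (fun w => g w (w ∘ ι)) v := by
  have h1 : (fun w : Fin n → E => altSum m (g w) (w ∘ ι)) = fun w =>
      ∑ τ : Equiv.Perm (Fin m), ((Equiv.Perm.sign τ : ℤ) : ℝ) *
        g (w ∘ τ.viaFintypeEmbedding ι) ((w ∘ τ.viaFintypeEmbedding ι) ∘ ι) := by
    funext w
    refine Finset.sum_congr rfl fun τ _ => ?_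
    have : (w ∘ ι) ∘ τ = (w ∘ τ.viaFintypeEmbedding ι) ∘ ι := by
      funext i
      simp [Equiv.Perm.viaFintypeEmbedding_apply_image]
    rw [hg, this]
  rw [h1, altSum_sum]
  -- Each `τ` of the inner positions extends by the identity to a permutation of all positions with
  -- the same sign. Reindexing the outer sum by it cancels the inner sign, so all `m!` inner terms
  -- contribute equally.
  have h2 : ∀ τ : Equiv.Perm (Fin m), altSum n (fun w => ((Equiv.Perm.sign τ : ℤ) : ℝ) *
        g (w ∘ τ.viaFintypeEmbedding ι) ((w ∘ τ.viaFintypeEmbedding ι) ∘ ι)) v =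
      altSum n (fun w => g w (w ∘ ι)) v := by
    intro τ
    rw [altSum_const_mul,
      altSum_comp_perm (fun w => g w (w ∘ ι)) (τ.viaFintypeEmbedding ι),
      Equiv.Perm.viaFintypeEmbedding_sign, ← mul_assoc]
    rcases Int.units_eq_one_or (Equiv.Perm.sign τ) with h | h <;> simp [h]
  simp [h2, Fintype.card_perm]

lemma altSum_absorb {m n : ℕ} (ι : Fin m ↪ Fin n) (g : (Fin m → E) → ℝ) (h : (Fin n → E) → ℝ)
    (hh : ∀ w (τ : Equiv.Perm (Fin m)), h (w ∘ τ.viaFintypeEmbedding ι) = h w) (v : Fin n → E) :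
    altSum n (fun w => altSum m g (w ∘ ι) * h w) v =
      (m.factorial : ℝ) * altSum n (fun w => g (w ∘ ι) * h w) v := by
  rw [← altSum_altSum ι (fun w u => g u * h w) fun w τ => by rw [hh]]
  simp only [mul_comm _ (h _), altSum_const_mul]

end AltSum

section Wedge

variable {n k l m : ℕ}

lemma cov_perm (a : Cov n k) (v : Fin k → EuclideanSpace ℝ (Fin n)) (σ : Equiv.Perm (Fin k)) :
    a (v ∘ σ) = ((Equiv.Perm.sign σ : ℤ) : ℝ) * a v := by
  have := a.toAlternatingMap.map_perm v σ
  rw [Units.smul_def, zsmul_eq_mul] at this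
  exact this

lemma altSum_cov (a : Cov n k) (v : Fin k → EuclideanSpace ℝ (Fin n)) :
    altSum k a v = (k.factorial : ℝ) * a v := by
  unfold altSum
  have : ∀ σ : Equiv.Perm (Fin k), ((Equiv.Perm.sign σ : ℤ) : ℝ) * a (v ∘ σ) = a v := by
    intro σ
    rw [cov_perm, ← mul_assoc]
    rcases Int.units_eq_one_or (Equiv.Perm.sign σ) with h | h <;> simp [h]
  simp [this, Fintype.card_perm]

/-- A sum over all permutations meets every shuffle `k! l!` times. This normal form avoids the
quotient by block permutations and makes associativity, commutativity and the Leibniz rule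
consequences of `altSum_absorb`. -/
lemma wedge_apply (a : Cov n k) (b : Cov n l) (v : Fin (k + l) → EuclideanSpace ℝ (Fin n)) :
    wedge a b v = ((k.factorial : ℝ) * l.factorial)⁻¹ *
      altSum (k + l) (fun w => a (w ∘ Fin.castAdd l) * b (w ∘ Fin.natAdd k)) v := by
  have h := congrArg (fun f => LinearMap.mul' ℝ ℝ (f (v ∘ finSumFinEquiv)))
    (MultilinearMap.domCoprod_alternization_eq a.toAlternatingMap b.toAlternatingMap)
  simp only [MultilinearMap.alternatization_apply, map_sum, Fintype.card_fin,
    AlternatingMap.smul_apply] at h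
  have h0 : wedge a b v = LinearMap.mul' ℝ ℝ
    ((a.toAlternatingMap.domCoprod b.toAlternatingMap) (v ∘ finSumFinEquiv)) := rfl
  rw [h0]
  rw [map_nsmul, nsmul_eq_mul] at h
  have hne : ((k.factorial : ℝ) * l.factorial) ≠ 0 := by positivity
  rw [eq_inv_mul_iff_mul_eq₀ hne]
  push_cast at h
  rw [← h, altSum, ← Equiv.sum_comp (finSumFinEquiv (m := k) (n := l)).permCongr]
  refine Finset.sum_congr rfl fun σ _ => ?_
  rw [Equiv.Perm.sign_permCongr, Units.smul_def, map_zsmul, zsmul_eq_mul]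
  congr 1
  simp only [MultilinearMap.domDomCongr_apply, MultilinearMap.domCoprod_apply,
    LinearMap.mul'_apply]
  congr 1
  · refine congrArg a ?_
    funext i; simp
  · refine congrArg b ?_
    funext i; simp

/-- Transport of covectors along an equality of degrees. -/
def castCov (h : k = l) (a : Cov n k) : Cov n l := h ▸ a

lemma castCov_apply (h : k = l) (a : Cov n k) (v : Fin l → EuclideanSpace ℝ (Fin n)) :
    castCov h a v = a (v ∘ Fin.cast h) := by
  subst h; rfl

lemma viaFintypeEmbedding_comp_of_disjoint {p q r : ℕ} {E : Type*} (ι : Fin p ↪ Fin r)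
    (j : Fin q → Fin r) (hd : ∀ x, j x ∉ Set.range ι) (w : Fin r → E) (τ : Equiv.Perm (Fin p)) :
    (w ∘ τ.viaFintypeEmbedding ι) ∘ j = w ∘ j := by
  funext x
  simp [Equiv.Perm.viaFintypeEmbedding_apply_notMem_range _ _ (hd x)]

lemma natAdd_notMem_range (x : Fin l) : Fin.natAdd k x ∉ Set.range (Fin.castAddEmb (n := k) l) := by
  rintro ⟨y, hy⟩
  have := congrArg Fin.val hy
  simp at this
  omega

lemma castAdd_notMem_range (x : Fin k) : Fin.castAdd l x ∉ Set.range (Fin.natAddEmb (m := l) k) := by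
  rintro ⟨y, hy⟩
  have := congrArg Fin.val hy
  simp at this
  omega

/-- Absorbing the inner alternation turns either side into the same multiple of the alternation of
`a ⊗ b ⊗ c` over all arguments; the factorials `(k + l)!` and `(l + m)!` cancel against the
normalizations. -/
lemma wedge_assoc (a : Cov n k) (b : Cov n l) (c : Cov n m) :
    wedge (wedge a b) c = castCov (Nat.add_assoc k l m).symm (wedge a (wedge b c)) := by
  ext v
  rw [castCov_apply, wedge_apply, wedge_apply]
  have h1 : (fun w : Fin (k + l + m) → EuclideanSpace ℝ (Fin n) =>
      wedge a b (w ∘ Fin.castAdd m) * c (w ∘ Fin.natAdd (k + l))) = fun w =>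
      ((k.factorial : ℝ) * l.factorial)⁻¹ *
      (altSum (k + l) (fun w => a (w ∘ Fin.castAdd l) * b (w ∘ Fin.natAdd k))
        (w ∘ Fin.castAddEmb m) * c (w ∘ Fin.natAdd (k + l))) := by
    funext w
    rw [wedge_apply, ← mul_assoc]; rfl
  have h2 : (fun w : Fin (k + (l + m)) → EuclideanSpace ℝ (Fin n) =>
      a (w ∘ Fin.castAdd (l + m)) * wedge b c (w ∘ Fin.natAdd k)) = fun w =>
      ((l.factorial : ℝ) * m.factorial)⁻¹ *
      (altSum (l + m) (fun w => b (w ∘ Fin.castAdd m) * c (w ∘ Fin.natAdd l))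
        (w ∘ Fin.natAddEmb k) * a (w ∘ Fin.castAdd (l + m))) := by
    funext w
    rw [wedge_apply, mul_comm, mul_assoc]; rfl
  rw [h1, h2, altSum_const_mul, altSum_const_mul, altSum_absorb, altSum_absorb, altSum_cast]
  · have h3 : (fun w : Fin (k + l + m) → EuclideanSpace ℝ (Fin n) =>
        b (((w ∘ Fin.cast (Nat.add_assoc k l m).symm) ∘ Fin.natAddEmb k) ∘ Fin.castAdd m) *
          c (((w ∘ Fin.cast (Nat.add_assoc k l m).symm) ∘ Fin.natAddEmb k) ∘ Fin.natAdd l) *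
          a ((w ∘ Fin.cast (Nat.add_assoc k l m).symm) ∘ Fin.castAdd (l + m))) =
        fun w => a ((w ∘ Fin.castAddEmb m) ∘ Fin.castAdd l) *
          b ((w ∘ Fin.castAddEmb m) ∘ Fin.natAdd k) * c (w ∘ Fin.natAdd (k + l)) := by
      funext w
      have e1 : ((w ∘ Fin.cast (Nat.add_assoc k l m).symm) ∘ Fin.natAddEmb k) ∘ Fin.castAdd m =
          (w ∘ Fin.castAddEmb m) ∘ Fin.natAdd k := by
        funext i; simp only [Function.comp_apply]; congr 1
      have e2 : ((w ∘ Fin.cast (Nat.add_assoc k l m).symm) ∘ Fin.natAddEmb k) ∘ Fin.natAdd l =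
          w ∘ Fin.natAdd (k + l) := by
        funext i; simp only [Function.comp_apply]; congr 1; ext; simp [Nat.add_assoc]
      have e3 : (w ∘ Fin.cast (Nat.add_assoc k l m).symm) ∘ Fin.castAdd (l + m) =
          (w ∘ Fin.castAddEmb m) ∘ Fin.castAdd l := by
        funext i; simp only [Function.comp_apply]; congr 1
      rw [e1, e2, e3]; ring
    rw [h3]
    have := (k.factorial_pos).ne'
    have := (l.factorial_pos).ne'
    have := (m.factorial_pos).ne'
    have := ((k + l).factorial_pos).ne'
    have := ((l + m).factorial_pos).ne'
    field_simp
  · intro w τ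
    rw [viaFintypeEmbedding_comp_of_disjoint _ _ castAdd_notMem_range]
  · intro w τ
    rw [viaFintypeEmbedding_comp_of_disjoint _ _ natAdd_notMem_range]

/-- Graded commutativity; the sign is not made explicit. -/
lemma exists_wedge_comm (k l : ℕ) : ∃ s : ℝ, ∀ (a : Cov n k) (b : Cov n l),
    wedge b a = castCov (Nat.add_comm k l) (s • wedge a b) := by
  refine ⟨((Equiv.Perm.sign ((finAddFlip (m := k) (n := l)).trans
    (finCongr (Nat.add_comm l k))) : ℤ) : ℝ), fun a b => ?_⟩
  ext v
  rw [castCov_apply, ContinuousAlternatingMap.smul_apply, wedge_apply, wedge_apply, smul_eq_mul,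
    mul_left_comm, ← altSum_comp_perm, mul_comm (l.factorial : ℝ), altSum_cast]
  congr 2
  funext w
  rw [mul_comm]
  congr 2
  · funext i; simp only [Function.comp_apply]; congr 1; ext; simp
  · funext i; simp only [Function.comp_apply]; congr 1; ext; simp

lemma wedge_add_left (a a' : Cov n k) (b : Cov n l) :
    wedge (a + a') b = wedge a b + wedge a' b := by
  ext v
  simp only [ContinuousAlternatingMap.add_apply, wedge_apply, add_mul, altSum_add, mul_add]

lemma wedge_add_right (a : Cov n k) (b b' : Cov n l) :
    wedge a (b + b') = wedge a b + wedge a b' := by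
  ext v
  simp only [ContinuousAlternatingMap.add_apply, wedge_apply, mul_add, altSum_add]

lemma wedge_smul_left (r : ℝ) (a : Cov n k) (b : Cov n l) :
    wedge (r • a) b = r • wedge a b := by
  ext v
  simp only [ContinuousAlternatingMap.smul_apply, wedge_apply, smul_eq_mul, mul_assoc,
    altSum_const_mul]
  ring

lemma wedge_smul_right (r : ℝ) (a : Cov n k) (b : Cov n l) :
    wedge a (r • b) = r • wedge a b := by
  ext v
  simp only [ContinuousAlternatingMap.smul_apply, wedge_apply, smul_eq_mul, mul_left_comm _ r,
    altSum_const_mul]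

lemma wedge_comp (a : Cov n k) (b : Cov n l)
    (f : EuclideanSpace ℝ (Fin m) →L[ℝ] EuclideanSpace ℝ (Fin n)) :
    (wedge a b).compContinuousLinearMap f =
      wedge (a.compContinuousLinearMap f) (b.compContinuousLinearMap f) := by
  ext v
  simp only [ContinuousAlternatingMap.compContinuousLinearMap_apply, wedge_apply]
  rfl

/-- A wedge product vanishes on a space on which the first factor vanishes. -/
lemma wedge_apply_eq_zero (a : Cov n k) (b : Cov n l)
    (v : Fin (k + l) → EuclideanSpace ℝ (Fin n))
    (h : ∀ f : Fin k → Fin (k + l), a (v ∘ f) = 0) : wedge a b v = 0 := by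
  rw [wedge_apply, altSum]
  simp [Function.comp_assoc, h]

lemma wedge_one_one_apply (a b : Cov n 1) (v : Fin (1 + 1) → EuclideanSpace ℝ (Fin n)) :
    wedge a b v = a ![v 0] * b ![v 1] - a ![v 1] * b ![v 0] := by
  have h2 : ∀ g : (Fin (1 + 1) → EuclideanSpace ℝ (Fin n)) → ℝ,
      altSum (1 + 1) g v = g ![v 0, v 1] - g ![v 1, v 0] := by
    intro g
    rw [altSum, show (Finset.univ : Finset (Equiv.Perm (Fin (1 + 1)))) =
      {1, Equiv.swap 0 1} by decide, Finset.sum_pair (by decide)]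
    have e1 : v ∘ (1 : Equiv.Perm (Fin (1 + 1))) = ![v 0, v 1] := by
      funext i; fin_cases i <;> rfl
    have e2 : v ∘ (Equiv.swap 0 1 : Equiv.Perm (Fin (1 + 1))) = ![v 1, v 0] := by
      funext i; fin_cases i <;> simp
    rw [e1, e2, Equiv.Perm.sign_swap (by decide)]
    simp; ring
  rw [wedge_apply, h2]
  have e : ∀ x y : EuclideanSpace ℝ (Fin n), ![x, y] ∘ Fin.castAdd 1 = ![x] := by
    intro x y; funext i; fin_cases i; rfl
  have e' : ∀ x y : EuclideanSpace ℝ (Fin n), ![x, y] ∘ Fin.natAdd 1 = ![y] := by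
    intro x y; funext i; fin_cases i; rfl
  simp [e, e']

end Wedge

/-! ### Alternation formulas and wedge products in low degree -/

section AlternatizeUncurry

variable {n k l : ℕ}

/-- Since the left side is alternating, its own `altSum` is `(k + 1)!` times itself. Each of its `k
+ 1` summands has the same `altSum`, because moving the `i`-th argument to the front is a cycle of
sign `(-1)^i`, which cancels the sign in the summand. -/
lemma alternatizeUncurryFin_eq_altSum
    (f : EuclideanSpace ℝ (Fin n) →L[ℝ] Cov n k) (v : Fin (k + 1) → EuclideanSpace ℝ (Fin n)) :
    ContinuousAlternatingMap.alternatizeUncurryFin f v =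
      (k.factorial : ℝ)⁻¹ * altSum (k + 1) (fun w => f (w 0) (w ∘ Fin.succ)) v := by
  have h1 := altSum_cov (ContinuousAlternatingMap.alternatizeUncurryFin f) v
  have h2 : (fun w => ContinuousAlternatingMap.alternatizeUncurryFin f w) =
      fun w : Fin (k + 1) → EuclideanSpace ℝ (Fin n) =>
        ∑ i : Fin (k + 1), (-1 : ℝ) ^ (i : ℕ) *
          (fun w => f (w 0) (w ∘ Fin.succ)) (w ∘ i.cycleRange.symm) := by
    funext w
    rw [ContinuousAlternatingMap.alternatizeUncurryFin_apply]
    refine Finset.sum_congr rfl fun i _ => ?_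
    have e1 : (w ∘ i.cycleRange.symm) ∘ Fin.succ = i.removeNth w := by
      funext j
      simp [Fin.removeNth]
    simp only [e1]
    simp
  have h3 : ∀ i : Fin (k + 1), altSum (k + 1) (fun w => (-1 : ℝ) ^ (i : ℕ) *
      (fun w => f (w 0) (w ∘ Fin.succ)) (w ∘ i.cycleRange.symm)) v =
      altSum (k + 1) (fun w => f (w 0) (w ∘ Fin.succ)) v := by
    intro i
    rw [altSum_const_mul, altSum_comp_perm (fun w => f (w 0) (w ∘ Fin.succ)), Equiv.Perm.sign_symm, Fin.sign_cycleRange, ← mul_assoc]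
    push_cast
    rw [← mul_pow]
    simp
  change altSum (k + 1) (fun w => ContinuousAlternatingMap.alternatizeUncurryFin f w) v = _ at h1
  rw [h2, altSum_sum, Finset.sum_congr rfl fun i _ => h3 i, Finset.sum_const, Finset.card_univ,
    Fintype.card_fin, nsmul_eq_mul, Nat.factorial_succ] at h1
  have := (k.factorial_pos).ne'
  push_cast at h1
  have h4 : ((k : ℝ) + 1) ≠ 0 := by positivity
  rw [mul_assoc] at h1
  rw [mul_left_cancel₀ h4 h1]
  field_simp

/-- `θ ∧ β` is the alternatized uncurrying of `x ↦ θ(x) β`. The cast only exchanges `1 + l` and `l +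
1`. -/
lemma wedge_one_apply (θ : Cov n 1) (β : Cov n l) (v : Fin (1 + l) → EuclideanSpace ℝ (Fin n)) :
    wedge θ β v = ∑ i : Fin (l + 1), (-1 : ℝ) ^ (i : ℕ) *
      (θ ![(v ∘ Fin.cast (Nat.add_comm l 1)) i] *
        β (i.removeNth (v ∘ Fin.cast (Nat.add_comm l 1)))) := by
  let f : EuclideanSpace ℝ (Fin n) →L[ℝ] Cov n l :=
    ((ContinuousAlternatingMap.ofSubsingleton ℝ (EuclideanSpace ℝ (Fin n)) ℝ (0 : Fin 1)).symm
      θ).smulRight β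
  have hf : ∀ x w, f x w = θ ![x] * β w := by
    intro x w
    have : θ (fun _ => x) = θ ![x] := by
      congr 1; funext i; fin_cases i; rfl
    simp [f, this]
  have h := alternatizeUncurryFin_eq_altSum f (v ∘ Fin.cast (Nat.add_comm l 1))
  rw [ContinuousAlternatingMap.alternatizeUncurryFin_apply] at h
  rw [wedge_apply]
  simp only [hf, zsmul_eq_mul] at h
  rw [altSum_cast] at h
  simp only [Nat.factorial_one, Nat.cast_one, one_mul]
  have e : (fun w : Fin (1 + l) → EuclideanSpace ℝ (Fin n) =>
      θ (w ∘ Fin.castAdd l) * β (w ∘ Fin.natAdd 1)) = fun w =>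
      θ ![(w ∘ Fin.cast (Nat.add_comm l 1)) 0] *
        β ((w ∘ Fin.cast (Nat.add_comm l 1)) ∘ Fin.succ) := by
    funext w
    congr 1
    · refine congrArg θ ?_
      funext i; fin_cases i; rfl
    · refine congrArg β ?_
      funext i; simp only [Function.comp_apply]; congr 1; ext; simp [Nat.add_comm]
  rw [e, ← h]
  refine Finset.sum_congr rfl fun i _ => ?_
  simp

/-- If `θ` vanishes on all the arguments but the first, then so does the antisymmetrization. -/
lemma wedge_one_apply_of_eq_zero (θ : Cov n 1) (β : Cov n l) (x : EuclideanSpace ℝ (Fin n))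
    (v : Fin l → EuclideanSpace ℝ (Fin n)) (h : ∀ i, θ ![v i] = 0) :
    wedge θ β (Fin.cons x v ∘ Fin.cast (Nat.add_comm 1 l)) = θ ![x] * β v := by
  rw [wedge_one_apply, Fin.sum_univ_succ]
  have e : ((Fin.cons x v : Fin (l + 1) → EuclideanSpace ℝ (Fin n)) ∘
      Fin.cast (Nat.add_comm 1 l)) ∘ Fin.cast (Nat.add_comm l 1) = Fin.cons x v := by
    funext i; rfl
  rw [e]
  simp [h]

/-- Makes multiplication by functions a case of the wedge product, as `k + 0` is `k` by definition.
Ideals are thereby closed under function multiples without a separate constructor. -/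
lemma wedge_zero_form (a : Cov n k) (r : ℝ) :
    wedge a (ContinuousAlternatingMap.constOfIsEmpty ℝ (EuclideanSpace ℝ (Fin n)) (Fin 0) r) =
      r • a := by
  ext v
  rw [wedge_apply]
  have h := altSum_cov a v
  have : (fun w : Fin (k + 0) → EuclideanSpace ℝ (Fin n) => a (w ∘ Fin.castAdd 0) *
      (ContinuousAlternatingMap.constOfIsEmpty ℝ (EuclideanSpace ℝ (Fin n)) (Fin 0) r)
        (w ∘ Fin.natAdd k)) = fun w => r * a w := by
    funext w
    rw [mul_comm]; rfl
  rw [this]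
  change _ * altSum k (fun w => r * a w) v = r * a v
  rw [altSum_const_mul]
  have hk := (k.factorial_pos).ne'
  rw [h]
  simp
  field_simp

/-- The 24 permutations are enumerated by the image of `0` and a permutation of the rest,
repeatedly. The formula serves to square 2-forms. -/
lemma altSum_four {E : Type*} (f : (Fin 4 → E) → ℝ) (x y z t : E) :
    altSum 4 f ![x, y, z, t] =
      f ![x, y, z, t] - f ![x, y, t, z] - f ![x, z, y, t] + f ![x, z, t, y] + f ![x, t, y, z]
      - f ![x, t, z, y] - f ![y, x, z, t] + f ![y, x, t, z] + f ![y, z, x, t] - f ![y, z, t, x]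
      - f ![y, t, x, z] + f ![y, t, z, x] + f ![z, x, y, t] - f ![z, x, t, y] - f ![z, y, x, t]
      + f ![z, y, t, x] + f ![z, t, x, y] - f ![z, t, y, x] - f ![t, x, y, z] + f ![t, x, z, y]
      + f ![t, y, x, z] - f ![t, y, z, x] - f ![t, z, x, y] + f ![t, z, y, x] := by
  have h : ∀ σ : Equiv.Perm (Fin 4), ![x, y, z, t] ∘ σ =
      ![![x, y, z, t] (σ 0), ![x, y, z, t] (σ 1), ![x, y, z, t] (σ 2), ![x, y, z, t] (σ 3)] := by
    intro σ; funext i; fin_cases i <;> rfl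
  unfold altSum
  simp only [h]
  rw [← Equiv.sum_comp (Equiv.Perm.decomposeFin (n := 3)).symm, Fintype.sum_prod_type]
  simp only [← Equiv.sum_comp (Equiv.Perm.decomposeFin (n := 2)).symm, Fintype.sum_prod_type]
  simp only [← Equiv.sum_comp (Equiv.Perm.decomposeFin (n := 1)).symm, Fintype.sum_prod_type]
  simp only [Fin.sum_univ_succ, Equiv.Perm.decomposeFin.symm_sign, Finset.univ_unique, Finset.sum_singleton]
  have h2 : ∀ (p : Fin 4) (e : Equiv.Perm (Fin 3)),
      Equiv.Perm.decomposeFin.symm (p, e) 2 = Equiv.swap 0 p (e 1).succ :=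
    fun p e => Equiv.Perm.decomposeFin_symm_apply_succ e p 1
  have h3 : ∀ (p : Fin 4) (e : Equiv.Perm (Fin 3)),
      Equiv.Perm.decomposeFin.symm (p, e) 3 = Equiv.swap 0 p (e 2).succ :=
    fun p e => Equiv.Perm.decomposeFin_symm_apply_succ e p 2
  have h4 : ∀ (p : Fin 3) (e : Equiv.Perm (Fin 2)),
      Equiv.Perm.decomposeFin.symm (p, e) 2 = Equiv.swap 0 p (e 1).succ :=
    fun p e => Equiv.Perm.decomposeFin_symm_apply_succ e p 1
  simp [Equiv.swap_apply_def, h2, h3, h4]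
  ring

lemma wedge_two_two_apply (a b : Cov n 2) (x y z t : EuclideanSpace ℝ (Fin n)) :
    wedge a b ![x, y, z, t] = a ![x, y] * b ![z, t] - a ![x, z] * b ![y, t]
      + a ![x, t] * b ![y, z] + a ![y, z] * b ![x, t] - a ![y, t] * b ![x, z]
      + a ![z, t] * b ![x, y] := by
  have sw : ∀ (c : Cov n 2) (x y : EuclideanSpace ℝ (Fin n)), c ![y, x] = - c ![x, y] := by
    intro c x y
    have := cov_perm c ![x, y] (Equiv.swap 0 1)
    have e : ![x, y] ∘ (Equiv.swap (0 : Fin 2) 1) = ![y, x] := by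
      funext i; fin_cases i <;> rfl
    rw [e] at this
    rw [this]
    simp
  rw [wedge_apply]
  change _ * altSum 4 _ _ = _
  rw [altSum_four]
  have e : ∀ x y z t : EuclideanSpace ℝ (Fin n), ![x, y, z, t] ∘ Fin.castAdd 2 = ![x, y] := by
    intro x y z t; funext i; fin_cases i <;> rfl
  have e' : ∀ x y z t : EuclideanSpace ℝ (Fin n), ![x, y, z, t] ∘ Fin.natAdd 2 = ![z, t] := by
    intro x y z t; funext i; fin_cases i <;> rfl
  simp only [e, e', sw _ x y, sw _ x z, sw _ x t, sw _ y z, sw _ y t, sw _ z t]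
  norm_num
  ring

/-! ### The wedge product as a continuous bilinear map -/

/-- With finite dimension, linear and bilinear maps out of spaces of covectors are automatically
continuous, as needed for `wedgeL` and `covCoords`. -/
instance : FiniteDimensional ℝ (Cov n k) :=
  Module.Finite.of_injective
    ({ toFun := fun a => a.toMultilinearMap
       map_add' := fun _ _ => rfl
       map_smul' := fun _ _ => rfl } :
      Cov n k →ₗ[ℝ] MultilinearMap ℝ (fun _ : Fin k => EuclideanSpace ℝ (Fin n)) ℝ)
    fun _ _ h => ContinuousAlternatingMap.ext fun v => congrArg (fun f => f v) h

/-- The wedge product as a continuous bilinear map. -/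
def wedgeL (n k l : ℕ) : Cov n k →L[ℝ] Cov n l →L[ℝ] Cov n (k + l) :=
  (LinearMap.mk₂ ℝ (wedge (n := n) (k := k) (l := l)) wedge_add_left wedge_smul_left
    wedge_add_right wedge_smul_right).toContinuousBilinearMap

lemma wedgeL_apply (a : Cov n k) (b : Cov n l) : wedgeL n k l a b = wedge a b := rfl

end AlternatizeUncurry

/-! ### The Leibniz rule on a vector space -/

section Leibniz

variable {n k l : ℕ} {s : Set (EuclideanSpace ℝ (Fin n))} {x : EuclideanSpace ℝ (Fin n)}
  {α : EuclideanSpace ℝ (Fin n) → Cov n k} {β : EuclideanSpace ℝ (Fin n) → Cov n l}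

lemma contDiff_wedge {r : WithTop ℕ∞} :
    ContDiff ℝ r (fun p : Cov n k × Cov n l => wedgeL n k l p.1 p.2) := by fun_prop

lemma contDiffAt_wedge {r : WithTop ℕ∞} (hα : ContDiffAt ℝ r α x) (hβ : ContDiffAt ℝ r β x) :
    ContDiffAt ℝ r (fun y => wedge (α y) (β y)) x :=
  ContDiffAt.comp (g := fun p : Cov n k × Cov n l => wedgeL n k l p.1 p.2)
    (f := fun y => (α y, β y)) x contDiff_wedge.contDiffAt (hα.prodMk hβ)

lemma fderiv_wedge (hα : DifferentiableAt ℝ α x) (hβ : DifferentiableAt ℝ β x)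
    (u : EuclideanSpace ℝ (Fin n)) :
    fderiv ℝ (fun y => wedge (α y) (β y)) x u =
      wedge (fderiv ℝ α x u) (β x) + wedge (α x) (fderiv ℝ β x u) := by
  simp only [← wedgeL_apply]
  rw [(wedgeL n k l).fderiv_of_bilinear hα hβ]
  simp [add_comm]

-- The derivative of the bilinear wedge product has two terms. After all inner alternations are
-- absorbed, the term differentiating `α` matches directly, while the other one needs the direction
-- of differentiation to be moved past the `k` arguments of `α`.
set_option maxHeartbeats 1000000 in
lemma extDeriv_wedge (hα : DifferentiableAt ℝ α x) (hβ : DifferentiableAt ℝ β x) :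
    extDeriv (fun y => wedge (α y) (β y)) x =
      castCov (Nat.add_right_comm k 1 l) (wedge (extDeriv α x) (β x)) +
        (-1 : ℝ) ^ k • wedge (α x) (extDeriv β x) := by
  ext v
  have hk := (k.factorial_pos).ne'
  have hl := (l.factorial_pos).ne'
  have hkl := ((k + l).factorial_pos).ne'
  rw [extDeriv, alternatizeUncurryFin_eq_altSum]
  have h1 : (fun w : Fin (k + l + 1) → EuclideanSpace ℝ (Fin n) =>
      fderiv ℝ (fun y => wedge (α y) (β y)) x (w 0) (w ∘ Fin.succ)) = fun w =>
      ((k.factorial : ℝ) * l.factorial)⁻¹ * (altSum (k + l) (fun u =>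
        fderiv ℝ α x (w 0) (u ∘ Fin.castAdd l) * β x (u ∘ Fin.natAdd k) +
        α x (u ∘ Fin.castAdd l) * fderiv ℝ β x (w 0) (u ∘ Fin.natAdd k)) (w ∘ Fin.succ)) := by
    funext w
    rw [fderiv_wedge hα hβ, ContinuousAlternatingMap.add_apply, wedge_apply, wedge_apply,
      ← mul_add, altSum_add]
  rw [h1, altSum_const_mul]
  have h2 := altSum_altSum (E := EuclideanSpace ℝ (Fin n)) (Fin.succEmb (k + l)) (fun w u =>
        fderiv ℝ α x (w 0) (u ∘ Fin.castAdd l) * β x (u ∘ Fin.natAdd k) +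
        α x (u ∘ Fin.castAdd l) * fderiv ℝ β x (w 0) (u ∘ Fin.natAdd k)) (fun w τ => by
      have : (w ∘ τ.viaFintypeEmbedding (Fin.succEmb (k + l))) 0 = w 0 := by
        simp only [Function.comp_apply]
        rw [Equiv.Perm.viaFintypeEmbedding_apply_notMem_range]
        simp
      rw [this]) v
  simp only [Fin.coe_succEmb] at h2
  rw [h2, altSum_add, ContinuousAlternatingMap.add_apply, castCov_apply,
    ContinuousAlternatingMap.smul_apply, smul_eq_mul, wedge_apply, wedge_apply]
  have h3 : (fun w : Fin (k + 1 + l) → EuclideanSpace ℝ (Fin n) =>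
      extDeriv α x (w ∘ Fin.castAdd l) * β x (w ∘ Fin.natAdd (k + 1))) = fun w =>
      (k.factorial : ℝ)⁻¹ * (altSum (k + 1) (fun w => fderiv ℝ α x (w 0) (w ∘ Fin.succ))
        (w ∘ Fin.castAddEmb l) * β x (w ∘ Fin.natAdd (k + 1))) := by
    funext w
    rw [extDeriv, alternatizeUncurryFin_eq_altSum, mul_assoc]
    rfl
  have h4 : (fun w : Fin (k + (l + 1)) → EuclideanSpace ℝ (Fin n) =>
      α x (w ∘ Fin.castAdd (l + 1)) * extDeriv β x (w ∘ Fin.natAdd k)) = fun w =>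
      (l.factorial : ℝ)⁻¹ * (altSum (l + 1) (fun w => fderiv ℝ β x (w 0) (w ∘ Fin.succ))
        (w ∘ Fin.natAddEmb k) * α x (w ∘ Fin.castAdd (l + 1))) := by
    funext w
    rw [extDeriv, alternatizeUncurryFin_eq_altSum, mul_comm, mul_assoc]
    rfl
  rw [h3, h4, altSum_const_mul, altSum_const_mul, altSum_absorb, altSum_absorb, altSum_cast]
  -- The cycle on the positions `0, …, k` brings the direction of differentiation from position `k`
  -- to the front; its sign is `(-1)^k`.
  · have h5 := altSum_comp_perm (fun w : Fin (k + (l + 1)) → EuclideanSpace ℝ (Fin n) =>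
        fderiv ℝ β x ((w ∘ Fin.natAddEmb k) 0) ((w ∘ Fin.natAddEmb k) ∘ Fin.succ) *
          α x (w ∘ Fin.castAdd (l + 1))) (Fin.natAdd k (0 : Fin (l + 1))).cycleRange v
    rw [Fin.sign_cycleRange] at h5
    simp only [Fin.val_natAdd, Fin.val_zero, add_zero, Units.val_pow_eq_pow_val, Units.val_neg,
      Units.val_one, Int.cast_pow, Int.cast_neg, Int.cast_one] at h5
    have h6 : (fun w : Fin (k + (l + 1)) → EuclideanSpace ℝ (Fin n) =>
        fderiv ℝ β x (((w ∘ (Fin.natAdd k (0 : Fin (l + 1))).cycleRange) ∘ Fin.natAddEmb k) 0)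
          (((w ∘ (Fin.natAdd k (0 : Fin (l + 1))).cycleRange) ∘ Fin.natAddEmb k) ∘ Fin.succ) *
          α x ((w ∘ (Fin.natAdd k (0 : Fin (l + 1))).cycleRange) ∘ Fin.castAdd (l + 1))) =
        fun w => α x ((w ∘ Fin.succ) ∘ Fin.castAdd l) *
          fderiv ℝ β x (w (0 : Fin (k + l + 1))) ((w ∘ Fin.succ) ∘ Fin.natAdd k) := by
      funext w
      rw [mul_comm]
      have e1 : (w ∘ (Fin.natAdd k (0 : Fin (l + 1))).cycleRange) ∘ Fin.castAdd (l + 1) =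
          (w ∘ Fin.succ) ∘ Fin.castAdd l := by
        funext i
        simp only [Function.comp_apply]
        congr 1
        ext
        rw [Fin.coe_cycleRange_of_lt (by rw [Fin.lt_def]; simp)]
        simp
      have e2 : ((w ∘ (Fin.natAdd k (0 : Fin (l + 1))).cycleRange) ∘ Fin.natAddEmb k) 0 =
          w (0 : Fin (k + l + 1)) := by
        simp only [Function.comp_apply]
        congr 1
        exact Fin.cycleRange_self _
      have e3 : ((w ∘ (Fin.natAdd k (0 : Fin (l + 1))).cycleRange) ∘ Fin.natAddEmb k) ∘ Fin.succ =
          (w ∘ Fin.succ) ∘ Fin.natAdd k := by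
        funext i
        simp only [Function.comp_apply]
        congr 1
        refine (Fin.cycleRange_of_gt ?_).trans ?_
        · rw [Fin.lt_def]; simp
        · ext; simp [Nat.add_assoc]
      rw [e1, e2, e3]
    rw [h6] at h5
    replace h5 := h5.trans (Eq.refl _)
    change altSum (k + l + 1) _ v = _ at h5
    rw [h5]
    push_cast [Nat.factorial_succ]
    have e : (fun w : Fin (k + l + 1) → EuclideanSpace ℝ (Fin n) =>
        fderiv ℝ α x (w 0) ((w ∘ Fin.succ) ∘ Fin.castAdd l) *
          β x ((w ∘ Fin.succ) ∘ Fin.natAdd k)) = fun w =>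
        fderiv ℝ α x (((w ∘ Fin.cast (Nat.add_right_comm k 1 l)) ∘ Fin.castAddEmb l) 0)
          (((w ∘ Fin.cast (Nat.add_right_comm k 1 l)) ∘ Fin.castAddEmb l) ∘ Fin.succ) *
          β x ((w ∘ Fin.cast (Nat.add_right_comm k 1 l)) ∘ Fin.natAdd (k + 1)) := by
      funext w
      congr 2
      funext i; simp only [Function.comp_apply]; congr 1; ext; simp; omega
    rw [e]
    have hk1 : (k : ℝ) + 1 ≠ 0 := by positivity
    have hl1 : (l : ℝ) + 1 ≠ 0 := by positivity
    field_simp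
  · intro w τ
    rw [viaFintypeEmbedding_comp_of_disjoint _ _ castAdd_notMem_range]
  · intro w τ
    rw [viaFintypeEmbedding_comp_of_disjoint _ _ natAdd_notMem_range]

end Leibniz

/-! ### Smoothness of families of covectors -/

section CovSmooth

variable {n m k : ℕ} {F : Type*} [NormedAddCommGroup F] [NormedSpace ℝ F] {r : WithTop ℕ∞} {x : F}

lemma contDiffAt_cov_apply {β : F → Cov n k} {u : Fin k → F → EuclideanSpace ℝ (Fin n)}
    (hβ : ContDiffAt ℝ r β x) (hu : ∀ i, ContDiffAt ℝ r (u i) x) :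
    ContDiffAt ℝ r (fun y => β y (fun i => u i y)) x := by
  have h := (ContinuousAlternatingMap.toContinuousMultilinearMapCLM ℝ (𝕜 := ℝ)
    (E := EuclideanSpace ℝ (Fin n)) (F := ℝ) (ι := Fin k)).analyticAt_uncurry_of_multilinear
    (x := (β x, fun i => u i x))
  exact ContDiffAt.comp (f := fun y => (β y, fun i => u i y)) x h.contDiffAt
    (hβ.prodMk (contDiffAt_pi.2 hu))

/-- The values of a covector on the tuples of standard basis vectors. -/
def covCoords (n k : ℕ) : Cov n k →L[ℝ] ((Fin k → Fin n) → ℝ) :=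
  LinearMap.toContinuousLinearMap
    { toFun := fun a J => a fun i => EuclideanSpace.basisFun (Fin n) ℝ (J i)
      map_add' := fun _ _ => rfl
      map_smul' := fun _ _ => rfl }

lemma covCoords_injective : Function.Injective (covCoords n k) := by
  intro a b h
  apply ContinuousAlternatingMap.toAlternatingMap_injective
  refine Module.Basis.ext_alternating (EuclideanSpace.basisFun (Fin n) ℝ).toBasis fun J _ => ?_
  have := congrFun h J
  simpa [covCoords] using this

/-- Finitely many values, those on tuples of basis vectors, determine a covector linearly and
injectively; a linear left inverse of `covCoords` recovers the family from them. -/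
lemma contDiffAt_cov_iff {β : F → Cov n k} :
    ContDiffAt ℝ r β x ↔ ∀ v, ContDiffAt ℝ r (fun y => β y v) x := by
  refine ⟨fun h v => contDiffAt_cov_apply h fun i => contDiffAt_const, fun h => ?_⟩
  obtain ⟨g, hg⟩ := (covCoords n k).toLinearMap.exists_leftInverse_of_injective
    (LinearMap.ker_eq_bot.2 covCoords_injective)
  have e : β = fun y => g.toContinuousLinearMap (covCoords n k (β y)) := by
    funext y
    exact (LinearMap.congr_fun hg (β y)).symm
  rw [e]
  have h1 : ContDiffAt ℝ r (fun y => covCoords n k (β y)) x :=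
    contDiffAt_pi.2 fun J => h _
  exact ContDiffAt.comp (g := g.toContinuousLinearMap) x
    (ContinuousLinearMap.contDiff _).contDiffAt h1

lemma contDiffAt_cov_comp {β : F → Cov m k}
    {L : F → EuclideanSpace ℝ (Fin n) →L[ℝ] EuclideanSpace ℝ (Fin m)}
    (hβ : ContDiffAt ℝ r β x) (hL : ContDiffAt ℝ r L x) :
    ContDiffAt ℝ r (fun y => (β y).compContinuousLinearMap (L y)) x := by
  rw [contDiffAt_cov_iff]
  intro v
  exact contDiffAt_cov_apply (u := fun i y => L y (v i)) hβ fun i => hL.clm_apply contDiffAt_const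

end CovSmooth

/-! ### Forms in charts: pullback, smoothness and exterior derivative -/

section Charts

variable {n m k l : ℕ}
  {M : Type*} [TopologicalSpace M] [ChartedSpace (EuclideanSpace ℝ (Fin n)) M]
  [IsManifold (𝓡 n) ∞ M]
  {N : Type*} [TopologicalSpace N] [ChartedSpace (EuclideanSpace ℝ (Fin m)) N]
  [IsManifold (𝓡 m) ∞ N]

lemma contMDiffAt_extChartAt_symm (x₀ : M) {y : EuclideanSpace ℝ (Fin n)}
    (hy : y ∈ (extChartAt (𝓡 n) x₀).target) :
    ContMDiffAt 𝓘(ℝ, EuclideanSpace ℝ (Fin n)) (𝓡 n) ∞ (extChartAt (𝓡 n) x₀).symm y :=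
  (contMDiffOn_extChartAt_symm x₀).contMDiffAt ((isOpen_extChartAt_target x₀).mem_nhds hy)

lemma contMDiffAt_extChartAt_of_mem (x₀ : M) {x : M} (hx : x ∈ (extChartAt (𝓡 n) x₀).source) :
    ContMDiffAt (𝓡 n) 𝓘(ℝ, EuclideanSpace ℝ (Fin n)) ∞ (extChartAt (𝓡 n) x₀) x :=
  contMDiffAt_extChartAt' (by simpa using hx)

section Tangent

omit [IsManifold (𝓡 n) ∞ M] [IsManifold (𝓡 m) ∞ N]

/-- The derivative of a map between manifolds, as a map between model spaces. -/
def tang (f : M → N) (x : M) : EuclideanSpace ℝ (Fin n) →L[ℝ] EuclideanSpace ℝ (Fin m) :=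
  mfderiv (𝓡 n) (𝓡 m) f x

lemma tang_comp {p : ℕ} {P : Type*} [TopologicalSpace P]
    [ChartedSpace (EuclideanSpace ℝ (Fin p)) P] {g : N → P} {f : M → N} (x : M)
    (hg : ContMDiffAt (𝓡 m) (𝓡 p) ∞ g (f x)) (hf : ContMDiffAt (𝓡 n) (𝓡 m) ∞ f x) :
    tang (n := n) (m := p) (fun y => g (f y)) x =
      (tang (n := m) (m := p) g (f x)).comp (tang (n := n) (m := m) f x) :=
  mfderiv_comp (g := g) x (hg.mdifferentiableAt (by simp)) (hf.mdifferentiableAt (by simp))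

lemma tang_congr {f g : M → N} {x : M} (h : f =ᶠ[nhds x] g) :
    tang (n := n) (m := m) f x = tang g x := h.mfderiv_eq

lemma tang_eq_fderiv (f : EuclideanSpace ℝ (Fin n) → EuclideanSpace ℝ (Fin m))
    (x : EuclideanSpace ℝ (Fin n)) : tang (n := n) (m := m) f x = fderiv ℝ f x :=
  mfderiv_eq_fderiv

lemma tang_id (x : M) : tang (n := n) (m := n) (id : M → M) x = ContinuousLinearMap.id ℝ _ :=
  mfderiv_id

lemma pullback_apply (f : M → N) (β : Form m k N) (x : M)
    (v : Fin k → EuclideanSpace ℝ (Fin n)) :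
    pullback (n := n) f β x v = β (f x) (fun i => tang (n := n) (m := m) f x (v i)) := rfl

lemma chartRep_apply (x₀ : M) (α : Form n k M) (y : EuclideanSpace ℝ (Fin n))
    (v : Fin k → EuclideanSpace ℝ (Fin n)) :
    chartRep x₀ α y v = α ((extChartAt (𝓡 n) x₀).symm y) (fun i =>
      tang (n := n) (m := n) (extChartAt (𝓡 n) x₀).symm y (v i)) := rfl

lemma d_apply (α : Form n k M) (x : M) (v : Fin (k + 1) → EuclideanSpace ℝ (Fin n)) :
    d α x v = extDeriv (chartRep x α) (extChartAt (𝓡 n) x x) (fun i =>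
      tang (n := n) (m := n) (extChartAt (𝓡 n) x) x (v i)) := rfl

end Tangent

/-- The expression of a map in charts is smooth. -/
lemma contDiffAt_chart_comp {f : M → N} (x₀ : M) (y₀ : N) {y : EuclideanSpace ℝ (Fin n)}
    (hy : y ∈ (extChartAt (𝓡 n) x₀).target)
    (hf : ContMDiffAt (𝓡 n) (𝓡 m) ∞ f ((extChartAt (𝓡 n) x₀).symm y))
    (hfy : f ((extChartAt (𝓡 n) x₀).symm y) ∈ (extChartAt (𝓡 m) y₀).source) :
    ContDiffAt ℝ ∞ (fun z => extChartAt (𝓡 m) y₀ (f ((extChartAt (𝓡 n) x₀).symm z))) y := by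
  rw [← contMDiffAt_iff_contDiffAt]
  exact ContMDiffAt.comp (g := extChartAt (𝓡 m) y₀) y (contMDiffAt_extChartAt_of_mem y₀ hfy)
    (ContMDiffAt.comp (g := f) y hf (contMDiffAt_extChartAt_symm x₀ hy))

/-- The expression of a pullback in charts is the pullback of the expression in charts. -/
lemma chartRep_pullback {f : M → N} (β : Form m k N) (x₀ : M) (y₀ : N)
    {y : EuclideanSpace ℝ (Fin n)} (hy : y ∈ (extChartAt (𝓡 n) x₀).target)
    (hf : ContMDiffAt (𝓡 n) (𝓡 m) ∞ f ((extChartAt (𝓡 n) x₀).symm y))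
    (hfy : f ((extChartAt (𝓡 n) x₀).symm y) ∈ (extChartAt (𝓡 m) y₀).source) :
    chartRep x₀ (pullback f β) y =
      (chartRep y₀ β (extChartAt (𝓡 m) y₀ (f ((extChartAt (𝓡 n) x₀).symm y)))).compContinuousLinearMap
        (fderiv ℝ (fun z => extChartAt (𝓡 m) y₀ (f ((extChartAt (𝓡 n) x₀).symm z))) y) := by
  set φ := extChartAt (𝓡 n) x₀ with hφ
  set ψ := extChartAt (𝓡 m) y₀ with hψ
  have hφs := contMDiffAt_extChartAt_symm x₀ hy
  have hF := contDiffAt_chart_comp x₀ y₀ hy hf hfy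
  have hψs := contMDiffAt_extChartAt_symm y₀ (ψ.map_source hfy)
  have e : (fun z => f (φ.symm z)) =ᶠ[nhds y] fun z => ψ.symm (ψ (f (φ.symm z))) := by
    have hc : ContinuousAt (fun z => f (φ.symm z)) y :=
      ContinuousAt.comp (g := f) hf.continuousAt hφs.continuousAt
    filter_upwards [hc.preimage_mem_nhds ((isOpen_extChartAt_source y₀).mem_nhds hfy)] with z hz
    exact (ψ.left_inv hz).symm
  have h1 := tang_comp y hf hφs
  have h2 := tang_comp y hψs (contMDiffAt_iff_contDiffAt.2 hF)
  rw [tang_eq_fderiv] at h2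
  rw [tang_congr e, h2] at h1
  ext v
  rw [ContinuousAlternatingMap.compContinuousLinearMap_apply, chartRep_apply, chartRep_apply,
    pullback_apply, ← hφ, ← hψ, ψ.left_inv hfy]
  refine congrArg (β _) ?_
  funext i
  exact (DFunLike.congr_fun h1 (v i)).symm

omit [IsManifold (𝓡 n) ∞ M] in
lemma isSmooth_iff {α : Form n k M} : IsSmooth α ↔ ∀ x₀ : M, ∀ y ∈ (extChartAt (𝓡 n) x₀).target,
    ContDiffAt ℝ ∞ (chartRep x₀ α) y :=
  forall_congr' fun x₀ => (isOpen_extChartAt_target x₀).contDiffOn_iff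

omit [IsManifold (𝓡 n) ∞ M] in
lemma IsSmooth.contDiffAt {α : Form n k M} (h : IsSmooth α) (x₀ : M) {x : M}
    (hx : x ∈ (extChartAt (𝓡 n) x₀).source) :
    ContDiffAt ℝ ∞ (chartRep x₀ α) (extChartAt (𝓡 n) x₀ x) :=
  isSmooth_iff.1 h x₀ _ ((extChartAt (𝓡 n) x₀).map_source hx)

lemma eventually_chartRep_pullback {f : M → N} (hf : ContMDiff (𝓡 n) (𝓡 m) ∞ f) (β : Form m k N)
    (x₀ : M) (y₀ : N) {y : EuclideanSpace ℝ (Fin n)} (hy : y ∈ (extChartAt (𝓡 n) x₀).target)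
    (hfy : f ((extChartAt (𝓡 n) x₀).symm y) ∈ (extChartAt (𝓡 m) y₀).source) :
    chartRep x₀ (pullback f β) =ᶠ[nhds y] fun z =>
      (chartRep y₀ β (extChartAt (𝓡 m) y₀ (f ((extChartAt (𝓡 n) x₀).symm z)))).compContinuousLinearMap
        (fderiv ℝ (fun z => extChartAt (𝓡 m) y₀ (f ((extChartAt (𝓡 n) x₀).symm z))) z) := by
  have hc : ContinuousAt (fun z => f ((extChartAt (𝓡 n) x₀).symm z)) y :=
    ContinuousAt.comp (g := f) hf.continuous.continuousAt
      (contMDiffAt_extChartAt_symm x₀ hy).continuousAt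
  filter_upwards [hc.preimage_mem_nhds ((isOpen_extChartAt_source y₀).mem_nhds hfy),
    (isOpen_extChartAt_target x₀).mem_nhds hy] with z hz hz'
  exact chartRep_pullback β x₀ y₀ hz' (hf _) hz

lemma IsSmooth.pullback {f : M → N} (hf : ContMDiff (𝓡 n) (𝓡 m) ∞ f) {β : Form m k N}
    (hβ : IsSmooth β) : IsSmooth (pullback (n := n) f β) := by
  rw [isSmooth_iff]
  intro x₀ y hy
  set y₀ := f ((extChartAt (𝓡 n) x₀).symm y) with hy₀
  have hfy : f ((extChartAt (𝓡 n) x₀).symm y) ∈ (extChartAt (𝓡 m) y₀).source :=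
    mem_extChartAt_source y₀
  refine ContDiffAt.congr_of_eventuallyEq ?_ (eventually_chartRep_pullback hf β x₀ y₀ hy hfy)
  have hF := contDiffAt_chart_comp x₀ y₀ hy (hf _) hfy
  refine contDiffAt_cov_comp ?_ (hF.fderiv_right (m := ∞) (by simp))
  exact ContDiffAt.comp (g := chartRep y₀ β) y (hβ.contDiffAt y₀ hfy) hF

omit [IsManifold (𝓡 n) ∞ M] in
lemma pullback_id (α : Form n k M) : pullback (n := n) (id : M → M) α = α := by
  funext x
  ext v
  rw [pullback_apply, tang_id]
  rfl

/-- The exterior derivative can be computed in every chart. -/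
lemma d_pullback_eq {f : M → N} (hf : ContMDiff (𝓡 n) (𝓡 m) ∞ f) {β : Form m k N}
    (hβ : IsSmooth β) (x₀ : M) (y₀ : N) {y : EuclideanSpace ℝ (Fin n)}
    (hy : y ∈ (extChartAt (𝓡 n) x₀).target)
    (hfy : f ((extChartAt (𝓡 n) x₀).symm y) ∈ (extChartAt (𝓡 m) y₀).source) :
    extDeriv (chartRep x₀ (Backlund.pullback f β)) y =
      (extDeriv (chartRep y₀ β)
        (extChartAt (𝓡 m) y₀ (f ((extChartAt (𝓡 n) x₀).symm y)))).compContinuousLinearMap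
        (fderiv ℝ (fun z => extChartAt (𝓡 m) y₀ (f ((extChartAt (𝓡 n) x₀).symm z))) y) := by
  rw [(eventually_chartRep_pullback hf β x₀ y₀ hy hfy).extDeriv_eq]
  exact extDeriv_pullback (r := ∞) (f := fun z => extChartAt (𝓡 m) y₀ (f ((extChartAt (𝓡 n) x₀).symm z)))
    ((hβ.contDiffAt y₀ hfy).differentiableAt (by simp))
    (contDiffAt_chart_comp x₀ y₀ hy (hf _) hfy)
    (by simp [minSmoothness_of_isRCLikeNormedField]; exact WithTop.coe_le_coe.2 le_top)

/-- The definition of `d` uses a different chart at each point. Applying `d_pullback_eq` to the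
identity map, with `x₀` as source chart and the chart at the point itself as target chart, shows
that a fixed chart computes the same derivative. -/
lemma chartRep_d {α : Form n k M} (hα : IsSmooth α) (x₀ : M) {y : EuclideanSpace ℝ (Fin n)}
    (hy : y ∈ (extChartAt (𝓡 n) x₀).target) :
    chartRep x₀ (d α) y = extDeriv (chartRep x₀ α) y := by
  set z := (extChartAt (𝓡 n) x₀).symm y with hz
  have h := d_pullback_eq (f := (id : M → M)) contMDiff_id hα x₀ z hy (mem_extChartAt_source _)
  rw [pullback_id] at h
  rw [h]
  have h1 := tang_comp y (contMDiffAt_extChartAt_of_mem z (mem_extChartAt_source z))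
    (contMDiffAt_extChartAt_symm x₀ hy)
  rw [tang_eq_fderiv] at h1
  ext v
  rw [ContinuousAlternatingMap.compContinuousLinearMap_apply, chartRep_apply, d_apply]
  refine congrArg (extDeriv (chartRep z α) _) ?_
  funext i
  exact (DFunLike.congr_fun h1 (v i)).symm

/-- Covectors at a point are determined by their expression in a chart. -/
lemma eq_of_chartRep_eq {α β : Form n k M} {x₀ x : M} (hx : x ∈ (extChartAt (𝓡 n) x₀).source)
    (h : chartRep x₀ α (extChartAt (𝓡 n) x₀ x) = chartRep x₀ β (extChartAt (𝓡 n) x₀ x)) :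
    α x = β x := by
  set φ := extChartAt (𝓡 n) x₀ with hφ
  have hy := φ.map_source hx
  have h1 := tang_comp x (contMDiffAt_extChartAt_symm x₀ hy) (contMDiffAt_extChartAt_of_mem x₀ hx)
  have e : (fun z => φ.symm (φ z)) =ᶠ[nhds x] id := by
    filter_upwards [(isOpen_extChartAt_source x₀).mem_nhds hx] with z hz
    exact φ.left_inv hz
  rw [tang_congr e, tang_id] at h1
  ext v
  have h2 := DFunLike.congr_fun h (fun i => tang (n := n) (m := n) φ x (v i))
  rw [chartRep_apply, chartRep_apply, ← hφ, φ.left_inv hx] at h2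
  have hv : (fun i => tang (n := n) (m := n) φ.symm (φ x) (tang (n := n) (m := n) φ x (v i))) =
      v := by
    funext i
    exact (DFunLike.congr_fun h1 (v i)).symm
  rwa [hv] at h2

/-- The exterior derivative commutes with pullbacks. -/
lemma d_pullback {f : M → N} (hf : ContMDiff (𝓡 n) (𝓡 m) ∞ f) {β : Form m k N}
    (hβ : IsSmooth β) : d (pullback (n := n) f β) = pullback f (d β) := by
  funext x
  have hx := mem_extChartAt_source (I := 𝓡 n) x
  have hy := (extChartAt (𝓡 n) x).map_source hx
  have hfy : f ((extChartAt (𝓡 n) x).symm (extChartAt (𝓡 n) x x)) ∈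
      (extChartAt (𝓡 m) (f x)).source := by
    rw [(extChartAt (𝓡 n) x).left_inv hx]; exact mem_extChartAt_source _
  apply eq_of_chartRep_eq hx
  rw [chartRep_d (hβ.pullback hf) x hy, d_pullback_eq hf hβ x (f x) hy hfy,
    chartRep_pullback (d β) x (f x) hy (hf _) hfy,
    chartRep_d hβ (f x) ((extChartAt (𝓡 m) (f x)).map_source hfy)]

lemma IsSmooth.d {α : Form n k M} (hα : IsSmooth α) : IsSmooth (d α) := by
  intro x₀
  have : Set.EqOn (chartRep x₀ (Backlund.d α)) (extDeriv (chartRep x₀ α))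
      (extChartAt (𝓡 n) x₀).target := fun y hy => chartRep_d hα x₀ hy
  refine ContDiffOn.congr ?_ this
  have h1 : ContDiffOn ℝ ∞ (fderiv ℝ (chartRep x₀ α)) (extChartAt (𝓡 n) x₀).target :=
    (hα x₀).fderiv_of_isOpen (isOpen_extChartAt_target x₀) (by simp)
  exact (ContinuousAlternatingMap.alternatizeUncurryFinCLM ℝ (EuclideanSpace ℝ (Fin n))
    ℝ).contDiff.comp_contDiffOn h1

end Charts

/-! ### Sums, products and function multiples of forms on manifolds -/

section FormAlgebra

variable {n m k l : ℕ}
  {M : Type*} [TopologicalSpace M] [ChartedSpace (EuclideanSpace ℝ (Fin n)) M]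
  {N : Type*} [TopologicalSpace N] [ChartedSpace (EuclideanSpace ℝ (Fin m)) N]

lemma isSmooth_zero : IsSmooth (0 : Form n k M) := by
  rw [isSmooth_iff]
  intro x₀ y _
  exact contDiffAt_const (c := (0 : Cov n k))

lemma IsSmooth.add {α β : Form n k M} (hα : IsSmooth α) (hβ : IsSmooth β) : IsSmooth (α + β) := by
  rw [isSmooth_iff] at *
  intro x₀ y hy
  exact (hα x₀ y hy).add (hβ x₀ y hy)

lemma chartRep_fwedge (x₀ : M) (α : Form n k M) (β : Form n l M)
    (y : EuclideanSpace ℝ (Fin n)) :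
    chartRep x₀ (fwedge α β) y = wedge (chartRep x₀ α y) (chartRep x₀ β y) :=
  wedge_comp _ _ (tang (n := n) (m := n) (extChartAt (𝓡 n) x₀).symm y)

lemma IsSmooth.fwedge {α : Form n k M} {β : Form n l M} (hα : IsSmooth α) (hβ : IsSmooth β) :
    IsSmooth (fwedge α β) := by
  rw [isSmooth_iff] at *
  intro x₀ y hy
  rw [show chartRep x₀ (Backlund.fwedge α β) = _ from funext (chartRep_fwedge x₀ α β)]
  exact contDiffAt_wedge (hα x₀ y hy) (hβ x₀ y hy)

lemma d_add {α β : Form n k M} (hα : IsSmooth α) (hβ : IsSmooth β) : d (α + β) = d α + d β := by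
  funext x
  have hx := mem_extChartAt_source (I := 𝓡 n) x
  ext v
  rw [d_apply, show chartRep x (α + β) = chartRep x α + chartRep x β from rfl,
    extDeriv_add ((hα.contDiffAt x hx).differentiableAt (by simp))
      ((hβ.contDiffAt x hx).differentiableAt (by simp))]
  rfl

lemma d_zero : d (0 : Form n k M) = 0 := by
  funext x
  ext v
  rw [d_apply, show chartRep x (0 : Form n k M) = fun _ => 0 from rfl]
  simp [extDeriv, ContinuousAlternatingMap.alternatizeUncurryFin_apply]

/-- Transport of forms along an equality of degrees. -/
def castForm (h : k = l) (α : Form n k M) : Form n l M := fun x => castCov h (α x)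

lemma chartRep_castForm (h : k = l) (x₀ : M) (α : Form n k M) (y : EuclideanSpace ℝ (Fin n)) :
    chartRep x₀ (castForm h α) y = castCov h (chartRep x₀ α y) := by
  subst h; rfl

lemma d_fwedge [IsManifold (𝓡 n) ∞ M] {α : Form n k M} {β : Form n l M} (hα : IsSmooth α)
    (hβ : IsSmooth β) :
    d (fwedge α β) = castForm (Nat.add_right_comm k 1 l) (fwedge (d α) β) +
      fun x => (-1 : ℝ) ^ k • fwedge α (d β) x := by
  funext x
  have hx := mem_extChartAt_source (I := 𝓡 n) x
  have hy := (extChartAt (𝓡 n) x).map_source hx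
  apply eq_of_chartRep_eq hx
  rw [chartRep_d (hα.fwedge hβ) x hy,
    show chartRep x (fwedge α β) = _ from funext (chartRep_fwedge x α β),
    extDeriv_wedge ((hα.contDiffAt x hx).differentiableAt (by simp))
      ((hβ.contDiffAt x hx).differentiableAt (by simp)), ← chartRep_d hα x hy,
    ← chartRep_d hβ x hy, ← chartRep_fwedge, ← chartRep_fwedge, ← chartRep_castForm]
  rfl

/-- A function as a `0`-form. -/
def ofFun (n : ℕ) (f : M → ℝ) : Form n 0 M := fun x =>
  ContinuousAlternatingMap.constOfIsEmpty ℝ (EuclideanSpace ℝ (Fin n)) (Fin 0) (f x)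

lemma isSmooth_ofFun [IsManifold (𝓡 n) ∞ M] {f : M → ℝ} (hf : ContMDiff (𝓡 n) 𝓘(ℝ, ℝ) ∞ f) :
    IsSmooth (ofFun n f) := by
  rw [isSmooth_iff]
  intro x₀ y hy
  rw [contDiffAt_cov_iff]
  intro v
  rw [← contMDiffAt_iff_contDiffAt]
  exact ContMDiffAt.comp (g := f) y (hf _) (contMDiffAt_extChartAt_symm x₀ hy)

lemma fwedge_ofFun (α : Form n k M) (f : M → ℝ) : fwedge α (ofFun n f) = fun x => f x • α x :=
  funext fun x => wedge_zero_form (α x) (f x)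

lemma IsSmooth.smul [IsManifold (𝓡 n) ∞ M] {f : M → ℝ} (hf : ContMDiff (𝓡 n) 𝓘(ℝ, ℝ) ∞ f)
    {α : Form n k M} (hα : IsSmooth α) : IsSmooth (fun x => f x • α x) := by
  rw [← fwedge_ofFun]
  exact hα.fwedge (isSmooth_ofFun hf)

lemma pullback_fwedge (f : M → N) (α : Form m k N) (β : Form m l N) :
    pullback (n := n) f (fwedge α β) = fwedge (pullback f α) (pullback f β) :=
  funext fun x => wedge_comp _ _ (tang (n := n) (m := m) f x)

lemma pullback_comp {p : ℕ} {P : Type*} [TopologicalSpace P]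
    [ChartedSpace (EuclideanSpace ℝ (Fin p)) P] {g : N → P} {f : M → N}
    (hg : ContMDiff (𝓡 m) (𝓡 p) ∞ g) (hf : ContMDiff (𝓡 n) (𝓡 m) ∞ f) (α : Form p k P) :
    pullback (n := n) f (pullback (n := m) g α) = pullback (fun x => g (f x)) α := by
  funext x
  ext v
  rw [pullback_apply, pullback_apply, pullback_apply, tang_comp x (hg _) (hf _)]
  rfl

end FormAlgebra

/-! ### Algebraic ideals and the systems that they generate -/

section AlgIdealLemmas

variable {n m k l : ℕ}
  {M : Type*} [TopologicalSpace M] [ChartedSpace (EuclideanSpace ℝ (Fin n)) M]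
  {N : Type*} [TopologicalSpace N] [ChartedSpace (EuclideanSpace ℝ (Fin m)) N]
  {S T : GradedSet n M}

namespace AlgIdeal

lemma isSmooth (hS : ∀ k, ∀ α ∈ S k, IsSmooth α) {α : Form n k M} (h : AlgIdeal S k α) :
    IsSmooth α := by
  induction h with
  | of h => exact hS _ _ h
  | zero k => exact isSmooth_zero
  | add _ _ h₁ h₂ => exact h₁.add h₂
  | wedge _ hβ h => exact h.fwedge hβ

lemma trans (hST : ∀ k, ∀ α ∈ S k, AlgIdeal T k α) {α : Form n k M} (h : AlgIdeal S k α) :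
    AlgIdeal T k α := by
  induction h with
  | of h => exact hST _ _ h
  | zero k => exact .zero k
  | add _ _ h₁ h₂ => exact h₁.add h₂
  | wedge _ hβ h => exact h.wedge hβ

lemma cast (h : k = l) {α : Form n k M} (hα : AlgIdeal S k α) : AlgIdeal S l (castForm h α) := by
  subst h; exact hα

section

variable [IsManifold (𝓡 n) ∞ M]

lemma smul {α : Form n k M} (hα : AlgIdeal S k α) {f : M → ℝ}
    (hf : ContMDiff (𝓡 n) 𝓘(ℝ, ℝ) ∞ f) : AlgIdeal S k (fun x => f x • α x) := by
  rw [← fwedge_ofFun]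
  exact hα.wedge (isSmooth_ofFun hf)

lemma const_smul {α : Form n k M} (hα : AlgIdeal S k α) (r : ℝ) :
    AlgIdeal S k (fun x => r • α x) := hα.smul (f := fun _ => r) contMDiff_const

/-- `AlgIdeal` is closed under multiplication from the right by definition. Graded commutativity up
to an unspecified constant suffices for the other side, since constants are absorbed. -/
lemma wedge_left {α : Form n k M} (hα : AlgIdeal S k α) {β : Form n l M} (hβ : IsSmooth β) :
    AlgIdeal S (l + k) (fwedge β α) := by
  obtain ⟨s, hs⟩ := exists_wedge_comm (n := n) k l
  have : fwedge β α = castForm (Nat.add_comm k l) (fun x => s • fwedge α β x) :=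
    funext fun x => hs (α x) (β x)
  rw [this]
  exact ((hα.wedge hβ).const_smul s).cast _

omit [IsManifold (𝓡 n) ∞ M] in
lemma sum {ι : Type*} (s : Finset ι) {α : ι → Form n k M} (h : ∀ i ∈ s, AlgIdeal S k (α i)) :
    AlgIdeal S k (fun x => ∑ i ∈ s, α i x) := by
  classical
  induction s using Finset.induction_on with
  | empty => simp only [Finset.sum_empty]; exact .zero k
  | insert i s hi ih =>
    simp only [Finset.sum_insert hi]
    exact (h i (Finset.mem_insert_self i s)).add
      (ih fun j hj => h j (Finset.mem_insert_of_mem hj))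

lemma pullback_mem {S : GradedSet m N} (f : M → N) (hf : ContMDiff (𝓡 n) (𝓡 m) ∞ f)
    [IsManifold (𝓡 m) ∞ N]
    (hST : ∀ k, ∀ α ∈ S k, AlgIdeal T k (pullback f α)) {α : Form m k N} (h : AlgIdeal S k α) :
    AlgIdeal T k (pullback f α) := by
  induction h with
  | of h => exact hST _ _ h
  | zero k => exact .zero k
  | add _ _ h₁ h₂ => exact h₁.add h₂
  | wedge _ hβ h =>
    rw [pullback_fwedge]
    exact h.wedge (hβ.pullback hf)

/-- By the Leibniz rule it is enough to know the derivatives of the generators. -/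
lemma d_mem (hS : ∀ k, ∀ α ∈ S k, IsSmooth α) (hd : ∀ k, ∀ α ∈ S k, AlgIdeal S (k + 1) (d α))
    {α : Form n k M} (h : AlgIdeal S k α) : AlgIdeal S (k + 1) (d α) := by
  induction h with
  | of h => exact hd _ _ h
  | zero k => rw [d_zero]; exact .zero _
  | add h₁ h₂ h₁' h₂' => rw [d_add (h₁.isSmooth hS) (h₂.isSmooth hS)]; exact h₁'.add h₂'
  | wedge h hβ h' =>
    rw [d_fwedge (h.isSmooth hS) hβ]
    exact ((h'.wedge hβ).cast _).add ((h.wedge hβ.d).const_smul _)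

end

end AlgIdeal

/-- The exterior differential system generated by smooth forms whose derivatives belong to the
algebraic ideal that they generate. -/
def EDS.ofGens [IsManifold (𝓡 n) ∞ M] (S : GradedSet n M) (hS : ∀ k, ∀ α ∈ S k, IsSmooth α)
    (hd : ∀ k, ∀ α ∈ S k, AlgIdeal S (k + 1) (d α)) : EDS n M where
  carrier k := {α | AlgIdeal S k α}
  smooth h := AlgIdeal.isSmooth hS h
  zero_mem k := .zero k
  add_mem h₁ h₂ := AlgIdeal.add h₁ h₂
  wedge_mem h hβ := AlgIdeal.wedge h hβ
  d_mem h := AlgIdeal.d_mem hS hd h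

lemma forall_gens_iff {S₁ : Set (Form n 1 M)} {S₂ : Set (Form n 2 M)}
    {P : ∀ k, Form n k M → Prop} :
    (∀ k, ∀ α ∈ gens S₁ S₂ k, P k α) ↔ (∀ α ∈ S₁, P 1 α) ∧ ∀ α ∈ S₂, P 2 α := by
  refine ⟨fun h => ⟨fun α hα => h 1 α hα, fun α hα => h 2 α hα⟩, fun h k α hα => ?_⟩
  match k, α, hα with
  | 1, α, hα => exact h.1 α hα
  | 2, α, hα => exact h.2 α hα

end AlgIdealLemmas

/-! ### Coframes, dual frames and components of forms -/

section Coframes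

variable {n k : ℕ}

/-- The map whose components are given covectors. -/
def coframeMap (κ : Fin n → Cov n 1) : EuclideanSpace ℝ (Fin n) →L[ℝ] EuclideanSpace ℝ (Fin n) :=
  ∑ i, ((ContinuousAlternatingMap.ofSubsingleton ℝ (EuclideanSpace ℝ (Fin n)) ℝ (0 : Fin 1)).symm
    (κ i)).smulRight (EuclideanSpace.single i (1 : ℝ))

lemma const_eq_vecOne {E : Type*} (v : E) : (fun _ : Fin 1 => v) = ![v] := by
  funext i; fin_cases i; rfl

lemma coframeMap_apply (κ : Fin n → Cov n 1) (v : EuclideanSpace ℝ (Fin n)) (i : Fin n) :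
    coframeMap κ v i = κ i ![v] := by
  simp [coframeMap, const_eq_vecOne, Finset.sum_apply, Pi.single_apply]

lemma finrank_cov_one : Module.finrank ℝ (Cov n 1) = n := by
  have e : (EuclideanSpace ℝ (Fin n) →L[ℝ] ℝ) ≃ₗ[ℝ] Cov n 1 :=
    (ContinuousAlternatingMap.ofSubsingletonLIE (𝕜 := ℝ) (E := EuclideanSpace ℝ (Fin n)) (F := ℝ)
      (0 : Fin 1)).toLinearEquiv
  rw [← e.finrank_eq, ← (LinearMap.toContinuousLinearMap (𝕜 := ℝ)
    (E := EuclideanSpace ℝ (Fin n)) (F' := ℝ)).finrank_eq, Module.finrank_linearMap]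
  simp

lemma eq_zero_of_forall_coframe {κ : Fin n → Cov n 1} (hκ : LinearIndependent ℝ κ)
    {v : EuclideanSpace ℝ (Fin n)} (h : ∀ i, κ i ![v] = 0) : v = 0 := by
  have hs := hκ.span_eq_top_of_card_eq_finrank' (by rw [finrank_cov_one]; simp)
  have h1 : ∀ a : Cov n 1, a ![v] = 0 := by
    intro a
    have ha : a ∈ Submodule.span ℝ (Set.range κ) := hs ▸ Submodule.mem_top
    induction ha using Submodule.span_induction with
    | mem a ha => obtain ⟨i, rfl⟩ := ha; exact h i
    | zero => rfl
    | add a b _ _ ha hb => rw [ContinuousAlternatingMap.add_apply, ha, hb, add_zero]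
    | smul r a _ ha => rw [ContinuousAlternatingMap.smul_apply, ha, smul_zero]
  ext i
  have := h1 (ContinuousAlternatingMap.ofSubsingleton ℝ (EuclideanSpace ℝ (Fin n)) ℝ (0 : Fin 1)
    (EuclideanSpace.proj i))
  simpa using this

lemma isInvertible_coframeMap {κ : Fin n → Cov n 1} (hκ : LinearIndependent ℝ κ) :
    (coframeMap κ).IsInvertible := by
  have hi : Function.Injective (coframeMap κ).toLinearMap := by
    rw [injective_iff_map_eq_zero]
    intro v hv
    refine eq_zero_of_forall_coframe hκ fun i => ?_
    rw [← coframeMap_apply]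
    have : coframeMap κ v = 0 := hv
    rw [this]; rfl
  refine ⟨(LinearEquiv.ofInjectiveEndo _ hi).toContinuousLinearEquiv, ?_⟩
  ext v
  rfl

/-- A trivial common kernel makes `coframeMap` injective, hence surjective in equal dimensions. Its
preimages of the standard basis pick out the coefficients of a linear relation one at a time. -/
lemma linearIndependent_of_forall_coframe {κ : Fin n → Cov n 1}
    (h : ∀ v, (∀ i, κ i ![v] = 0) → v = 0) : LinearIndependent ℝ κ := by
  have hinj : Function.Injective (coframeMap κ).toLinearMap := by
    rw [injective_iff_map_eq_zero]
    intro v hv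
    refine h v fun i => ?_
    rw [← coframeMap_apply]
    have : coframeMap κ v = 0 := hv
    rw [this]; rfl
  have hsurj := LinearMap.injective_iff_surjective.1 hinj
  rw [Fintype.linearIndependent_iff]
  intro g hg i
  obtain ⟨w, hw⟩ := hsurj (EuclideanSpace.single i (1 : ℝ))
  have h2 := DFunLike.congr_fun hg ![w]
  rw [ContinuousAlternatingMap.sum_apply] at h2
  have h3 : ∀ j, κ j ![w] = if j = i then 1 else 0 := by
    intro j
    rw [← coframeMap_apply]
    have : coframeMap κ w = EuclideanSpace.single i (1 : ℝ) := hw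
    rw [this]
    simp
  simp only [ContinuousAlternatingMap.smul_apply, h3] at h2
  simpa using h2

/-- The frame dual to a coframe. -/
def dualVec (κ : Fin n → Cov n 1) (j : Fin n) : EuclideanSpace ℝ (Fin n) :=
  (coframeMap κ).inverse (EuclideanSpace.single j (1 : ℝ))

lemma coframe_dualVec {κ : Fin n → Cov n 1} (hκ : LinearIndependent ℝ κ) (i j : Fin n) :
    κ i ![dualVec κ j] = if i = j then 1 else 0 := by
  obtain ⟨e, he⟩ := isInvertible_coframeMap hκ
  rw [← coframeMap_apply, dualVec, ← he, ContinuousLinearMap.inverse_equiv]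
  simp

lemma eq_of_forall_coframe {κ : Fin n → Cov n 1} (hκ : LinearIndependent ℝ κ)
    {v w : EuclideanSpace ℝ (Fin n)} (h : ∀ i, κ i ![v] = κ i ![w]) : v = w := by
  obtain ⟨e, he⟩ := isInvertible_coframeMap hκ
  apply e.injective
  ext i
  have h1 : ∀ u, e u = coframeMap κ u := fun u => by rw [← he]; rfl
  rw [h1, h1, coframeMap_apply, coframeMap_apply, h]

lemma cov_one_sum (a : Cov n 1) {ι : Type*} (s : Finset ι) (c : ι → ℝ)
    (v : ι → EuclideanSpace ℝ (Fin n)) : a ![∑ i ∈ s, c i • v i] = ∑ i ∈ s, c i * a ![v i] := by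
  have h1 : ∀ u, (ContinuousAlternatingMap.ofSubsingleton ℝ (EuclideanSpace ℝ (Fin n)) ℝ
      (0 : Fin 1)).symm a u = a ![u] := fun u => congrArg a (const_eq_vecOne u)
  rw [← h1, map_sum]
  refine Finset.sum_congr rfl fun i _ => ?_
  rw [map_smul, h1, smul_eq_mul]

lemma sum_coframe_dualVec {κ : Fin n → Cov n 1} (hκ : LinearIndependent ℝ κ)
    (v : EuclideanSpace ℝ (Fin n)) : ∑ j, κ j ![v] • dualVec κ j = v := by
  refine eq_of_forall_coframe hκ fun i => ?_
  rw [cov_one_sum]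
  simp [coframe_dualVec hκ]

lemma cov_one_eq_sum {κ : Fin n → Cov n 1} (hκ : LinearIndependent ℝ κ) (a : Cov n 1) :
    a = ∑ j, a ![dualVec κ j] • κ j := by
  ext v
  have hv : v = ![v 0] := (const_eq_vecOne (v 0)).symm ▸ funext fun i => by fin_cases i; rfl
  rw [hv]
  conv_lhs => rw [← sum_coframe_dualVec hκ (v 0), cov_one_sum]
  simp [ContinuousAlternatingMap.sum_apply, mul_comm]

lemma cov_two_swap (a : Cov n 2) (x y : EuclideanSpace ℝ (Fin n)) : a ![y, x] = -a ![x, y] := by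
  have := cov_perm a ![x, y] (Equiv.swap 0 1)
  have e : ![x, y] ∘ (Equiv.swap (0 : Fin 2) 1) = ![y, x] := by
    funext i; fin_cases i <;> rfl
  rw [e] at this
  rw [this]
  simp

lemma cov_two_sum_left (a : Cov n 2) {ι : Type*} (s : Finset ι) (c : ι → ℝ)
    (v : ι → EuclideanSpace ℝ (Fin n)) (w : EuclideanSpace ℝ (Fin n)) :
    a ![∑ i ∈ s, c i • v i, w] = ∑ i ∈ s, c i * a ![v i, w] := by
  classical
  have h1 : ∀ u, (a.toMultilinearMap.toLinearMap ![0, w] 0) u = a ![u, w] := by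
    intro u
    refine congrArg a ?_
    funext i; fin_cases i <;> simp
  rw [← h1, map_sum]
  refine Finset.sum_congr rfl fun i _ => ?_
  rw [map_smul, h1, smul_eq_mul]

lemma cov_two_sum_right (a : Cov n 2) {ι : Type*} (s : Finset ι) (c : ι → ℝ)
    (v : ι → EuclideanSpace ℝ (Fin n)) (w : EuclideanSpace ℝ (Fin n)) :
    a ![w, ∑ i ∈ s, c i • v i] = ∑ i ∈ s, c i * a ![w, v i] := by
  rw [cov_two_swap, cov_two_sum_left, ← Finset.sum_neg_distrib]
  refine Finset.sum_congr rfl fun i _ => ?_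
  rw [cov_two_swap a w]; ring

lemma cov_two_eq_sum {κ : Fin n → Cov n 1} (hκ : LinearIndependent ℝ κ) (a : Cov n 2) :
    a = ∑ i, ∑ j, (2⁻¹ * a ![dualVec κ i, dualVec κ j]) • wedge (κ i) (κ j) := by
  ext v
  have hv : v = ![v 0, v 1] := by funext i; fin_cases i <;> rfl
  have h1 : a v = ∑ i, ∑ j, κ i ![v 0] * (κ j ![v 1] * a ![dualVec κ i, dualVec κ j]) := by
    conv_lhs => rw [hv, ← sum_coframe_dualVec hκ (v 0), ← sum_coframe_dualVec hκ (v 1),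
      cov_two_sum_left]
    refine Finset.sum_congr rfl fun i _ => ?_
    rw [cov_two_sum_right, Finset.mul_sum]
  have h2 : a v = ∑ i, ∑ j, -(κ i ![v 1] * (κ j ![v 0] * a ![dualVec κ i, dualVec κ j])) := by
    rw [h1, Finset.sum_comm]
    refine Finset.sum_congr rfl fun i _ => Finset.sum_congr rfl fun j _ => ?_
    rw [cov_two_swap a (dualVec κ i)]; ring
  -- The sum runs over all ordered pairs, so every product occurs twice. Averaging the expansion
  -- with its antisymmetric counterpart produces the wedge products.
  have h3 : a v = 2⁻¹ * (a v + a v) := by ring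
  rw [h3]
  nth_rewrite 1 [h1]
  rw [h2, ← Finset.sum_add_distrib, Finset.mul_sum, ContinuousAlternatingMap.sum_apply]
  refine Finset.sum_congr rfl fun i _ => ?_
  rw [← Finset.sum_add_distrib, Finset.mul_sum, ContinuousAlternatingMap.sum_apply]
  refine Finset.sum_congr rfl fun j _ => ?_
  rw [ContinuousAlternatingMap.smul_apply, wedge_one_one_apply, smul_eq_mul]
  ring

variable {M : Type*} [TopologicalSpace M] [ChartedSpace (EuclideanSpace ℝ (Fin n)) M]
  [IsManifold (𝓡 n) ∞ M]

lemma linearIndependent_chartRep {κ : Fin n → Form n 1 M} (hκ : IsFrame κ) (x₀ : M)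
    {y : EuclideanSpace ℝ (Fin n)} (hy : y ∈ (extChartAt (𝓡 n) x₀).target) :
    LinearIndependent ℝ (fun a => chartRep x₀ (κ a) y) := by
  rw [Fintype.linearIndependent_iff]
  intro g hg
  refine Fintype.linearIndependent_iff.1 (hκ.2 ((extChartAt (𝓡 n) x₀).symm y)) g ?_
  have h := eq_of_chartRep_eq (α := fun x => ∑ i, g i • κ i x) (β := 0)
    ((extChartAt (𝓡 n) x₀).map_target hy) (by
      rw [(extChartAt (𝓡 n) x₀).right_inv hy]
      refine Eq.trans ?_ hg
      ext v
      simp only [chartRep_apply, ContinuousAlternatingMap.sum_apply,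
        ContinuousAlternatingMap.smul_apply])
  exact h

lemma dualVec_chartRep {κ : Fin n → Form n 1 M} (hκ : IsFrame κ) (x₀ : M)
    {y : EuclideanSpace ℝ (Fin n)} (hy : y ∈ (extChartAt (𝓡 n) x₀).target) (j : Fin n) :
    tang (n := n) (m := n) (extChartAt (𝓡 n) x₀).symm y
      (dualVec (fun a => chartRep x₀ (κ a) y) j) =
      dualVec (fun a => κ a ((extChartAt (𝓡 n) x₀).symm y)) j := by
  have h := hκ.2 ((extChartAt (𝓡 n) x₀).symm y)
  refine eq_of_forall_coframe h fun i => ?_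
  rw [coframe_dualVec h, ← coframe_dualVec (linearIndependent_chartRep hκ x₀ hy) i j,
    chartRep_apply]
  congr 1
  funext a; fin_cases a; rfl

lemma contDiffAt_coframeMap {F : Type*} [NormedAddCommGroup F] [NormedSpace ℝ F]
    {κ : Fin n → F → Cov n 1} {y : F} (hκ : ∀ i, ContDiffAt ℝ ∞ (κ i) y) :
    ContDiffAt ℝ ∞ (fun z => coframeMap (fun i => κ i z)) y := by
  let L : (Fin n → Cov n 1) →ₗ[ℝ] (EuclideanSpace ℝ (Fin n) →L[ℝ] EuclideanSpace ℝ (Fin n)) :=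
    { toFun := coframeMap
      map_add' := fun a b => by
        ext v i
        simp only [coframeMap_apply, add_apply, PiLp.add_apply, Pi.add_apply,
          ContinuousAlternatingMap.add_apply]
      map_smul' := fun r a => by
        ext v i
        simp only [coframeMap_apply, smul_apply, PiLp.smul_apply,
          Pi.smul_apply, ContinuousAlternatingMap.smul_apply, RingHom.id_apply] }
  exact ContDiffAt.comp (g := L.toContinuousLinearMap) y
    (ContinuousLinearMap.contDiff _).contDiffAt (contDiffAt_pi.2 hκ)

/-- Inversion of operators is smooth at invertible ones. This gives smooth dual frames, and through
them smooth coefficients in every expansion in a coframing. -/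
lemma contDiffAt_inverse_coframeMap {F : Type*} [NormedAddCommGroup F] [NormedSpace ℝ F]
    {κ : Fin n → F → Cov n 1} {y : F} (hκ : ∀ i, ContDiffAt ℝ ∞ (κ i) y)
    (hli : LinearIndependent ℝ fun i => κ i y) :
    ContDiffAt ℝ ∞ (fun z => (coframeMap (fun i => κ i z)).inverse) y := by
  obtain ⟨e, he⟩ := isInvertible_coframeMap hli
  refine ContDiffAt.comp (g := ContinuousLinearMap.inverse) y ?_ (contDiffAt_coframeMap hκ)
  rw [← he]
  exact contDiffAt_map_inverse e

lemma contDiffAt_dualVec {F : Type*} [NormedAddCommGroup F] [NormedSpace ℝ F]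
    {κ : Fin n → F → Cov n 1} {y : F} (hκ : ∀ i, ContDiffAt ℝ ∞ (κ i) y)
    (hli : LinearIndependent ℝ fun i => κ i y) (j : Fin n) :
    ContDiffAt ℝ ∞ (fun z => dualVec (fun i => κ i z) j) y :=
  (contDiffAt_inverse_coframeMap hκ hli).clm_apply contDiffAt_const

/-- The components of a smooth form with respect to a coframing are smooth. -/
lemma contMDiff_frame_component {κ : Fin n → Form n 1 M} (hκ : IsFrame κ) {β : Form n k M}
    (hβ : IsSmooth β) (J : Fin k → Fin n) :
    ContMDiff (𝓡 n) 𝓘(ℝ, ℝ) ∞ (fun x => β x (fun i => dualVec (fun a => κ a x) (J i))) := by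
  intro x₀
  have hx := mem_extChartAt_source (I := 𝓡 n) x₀
  set φ := extChartAt (𝓡 n) x₀ with hφ
  have hy := φ.map_source hx
  have h1 : ContDiffAt ℝ ∞ (fun y => chartRep x₀ β y
      (fun i => dualVec (fun a => chartRep x₀ (κ a) y) (J i))) (φ x₀) :=
    contDiffAt_cov_apply (u := fun i y => dualVec (fun a => chartRep x₀ (κ a) y) (J i))
      (hβ.contDiffAt x₀ hx) fun i => contDiffAt_dualVec (fun a => (hκ.1 a).contDiffAt x₀ hx)
        (linearIndependent_chartRep hκ x₀ hy) (J i)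
  have h2 := ContMDiffAt.comp (g := fun y => chartRep x₀ β y
      (fun i => dualVec (fun a => chartRep x₀ (κ a) y) (J i))) (f := φ) x₀
    (contMDiffAt_iff_contDiffAt.2 h1) (contMDiffAt_extChartAt_of_mem x₀ hx)
  refine h2.congr_of_eventuallyEq ?_
  filter_upwards [(isOpen_extChartAt_source x₀).mem_nhds hx] with x hx'
  have h3 := φ.map_source hx'
  rw [Function.comp_apply, chartRep_apply]
  simp only [dualVec_chartRep hκ x₀ h3]
  rw [← hφ, φ.left_inv hx']

/-- A smooth `1`-form belongs to an ideal if the coframe elements along which it has nonzero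
components do. -/
lemma AlgIdeal.of_components_one {S : GradedSet n M} {κ : Fin n → Form n 1 M} (hκ : IsFrame κ)
    {β : Form n 1 M} (hβ : IsSmooth β)
    (h : ∀ i, AlgIdeal S 1 (κ i) ∨ ∀ x, β x ![dualVec (fun a => κ a x) i] = 0) :
    AlgIdeal S 1 β := by
  have e : β = fun x => ∑ j, β x ![dualVec (fun a => κ a x) j] • κ j x :=
    funext fun x => cov_one_eq_sum (hκ.2 x) (β x)
  rw [e]
  refine AlgIdeal.sum _ fun j _ => ?_
  rcases h j with h | h
  · refine h.smul ((contMDiff_frame_component hκ hβ fun _ => j).congr fun x => ?_)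
    rw [const_eq_vecOne]
  · simp only [h, zero_smul]
    exact .zero 1

/-- A smooth `2`-form belongs to an ideal if the products of coframe elements along which it has
nonzero components do. -/
lemma AlgIdeal.of_components_two {S : GradedSet n M} {κ : Fin n → Form n 1 M} (hκ : IsFrame κ)
    {β : Form n 2 M} (hβ : IsSmooth β)
    (h : ∀ i j, i < j → AlgIdeal S 2 (fwedge (κ i) (κ j)) ∨
      ∀ x, β x ![dualVec (fun a => κ a x) i, dualVec (fun a => κ a x) j] = 0) :
    AlgIdeal S 2 β := by
  have e : β = fun x => ∑ i, ∑ j, (2⁻¹ * β x ![dualVec (fun a => κ a x) i,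
      dualVec (fun a => κ a x) j]) • Backlund.wedge (κ i x) (κ j x) :=
    funext fun x => cov_two_eq_sum (hκ.2 x) (β x)
  have hs : ∀ i j, ContMDiff (𝓡 n) 𝓘(ℝ, ℝ) ∞ (fun x => 2⁻¹ * β x ![dualVec (fun a => κ a x) i,
      dualVec (fun a => κ a x) j]) := by
    intro i j
    refine contMDiff_const.mul ((contMDiff_frame_component hκ hβ ![i, j]).congr fun x => ?_)
    congr 1
    funext a; fin_cases a <;> rfl
  rw [e]
  refine AlgIdeal.sum _ fun i _ => AlgIdeal.sum _ fun j _ => ?_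
  rcases lt_trichotomy i j with hij | rfl | hij
  · rcases h i j hij with h | h
    · exact h.smul (hs i j)
    · simp only [h, mul_zero, zero_smul]
      exact .zero 2
  · have : (fun x => (2⁻¹ * β x ![dualVec (fun a => κ a x) i, dualVec (fun a => κ a x) i]) •
        Backlund.wedge (κ i x) (κ i x)) = (0 : Form n 2 M) := by
      funext x
      ext v
      rw [ContinuousAlternatingMap.smul_apply, wedge_one_one_apply, mul_comm (κ i x ![v 0]),
        sub_self, smul_zero]
      rfl
    rw [this]
    exact .zero 2
  · rcases h j i hij with h | h
    · have := (h.smul (hs i j)).const_smul (-1)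
      convert this using 1
      funext x
      ext v
      simp only [ContinuousAlternatingMap.smul_apply, wedge_one_one_apply, smul_eq_mul, fwedge]
      ring
    · have h' : ∀ x, β x ![dualVec (fun a => κ a x) i, dualVec (fun a => κ a x) j] = 0 := by
        intro x
        rw [cov_two_swap, h, neg_zero]
      simp only [h', mul_zero, zero_smul]
      exact .zero 2

end Coframes

/-! ### Differentials of functions and of function multiples -/

section Calculus

variable {n : ℕ} {M : Type*} [TopologicalSpace M] [ChartedSpace (EuclideanSpace ℝ (Fin n)) M]
  [IsManifold (𝓡 n) ∞ M]

lemma d_ofFun_apply {f : M → ℝ} (hf : ContMDiff (𝓡 n) 𝓘(ℝ, ℝ) ∞ f) (x : M)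
    (v : EuclideanSpace ℝ (Fin n)) :
    d (ofFun n f) x ![v] = mfderiv (𝓡 n) 𝓘(ℝ, ℝ) f x v := by
  have hx := mem_extChartAt_source (I := 𝓡 n) x
  set φ := extChartAt (𝓡 n) x with hφ
  have hy := φ.map_source hx
  have hF : ContDiffAt ℝ ∞ (fun y => f (φ.symm y)) (φ x) := by
    rw [← contMDiffAt_iff_contDiffAt]
    exact ContMDiffAt.comp (g := f) _ (hf _) (contMDiffAt_extChartAt_symm x hy)
  have e : f =ᶠ[nhds x] (fun y => f (φ.symm y)) ∘ φ := by
    filter_upwards [(isOpen_extChartAt_source x).mem_nhds hx] with z hz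
    exact congrArg f (φ.left_inv hz).symm
  rw [e.mfderiv_eq, mfderiv_comp (I' := 𝓘(ℝ, EuclideanSpace ℝ (Fin n))) x
    ((contMDiffAt_iff_contDiffAt.2 hF).mdifferentiableAt (by simp))
    ((contMDiffAt_extChartAt_of_mem x hx).mdifferentiableAt (by simp)), mfderiv_eq_fderiv, d_apply]
  have h1 : chartRep x (ofFun n f) = fun y => ContinuousAlternatingMap.constOfIsEmpty ℝ
      (EuclideanSpace ℝ (Fin n)) (Fin 0) (f (φ.symm y)) := by
    funext y
    ext w
    rfl
  rw [h1, extDeriv_constOfIsEmpty]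
  rfl

/-- The Leibniz rule for the product of a function and a `1`-form. -/
lemma d_smul_apply {f : M → ℝ} (hf : ContMDiff (𝓡 n) 𝓘(ℝ, ℝ) ∞ f) {α : Form n 1 M}
    (hα : IsSmooth α) (x : M) (u v : EuclideanSpace ℝ (Fin n)) :
    d (fun x => f x • α x) x ![u, v] =
      d (ofFun n f) x ![u] * α x ![v] - d (ofFun n f) x ![v] * α x ![u] +
        f x * d α x ![u, v] := by
  rw [← fwedge_ofFun, d_fwedge hα (isSmooth_ofFun hf)]
  have h1 : ∀ w : Fin 2 → EuclideanSpace ℝ (Fin n), fwedge α (d (ofFun n f)) x w =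
      α x ![w 0] * d (ofFun n f) x ![w 1] - α x ![w 1] * d (ofFun n f) x ![w 0] :=
    fun w => wedge_one_one_apply (α x) (d (ofFun n f) x) w
  have h2 : castForm (Nat.add_right_comm 1 1 0) (fwedge (d α) (ofFun n f)) x =
      f x • d α x := wedge_zero_form (d α x) (f x)
  rw [Pi.add_apply, h2, ContinuousAlternatingMap.add_apply]
  erw [ContinuousAlternatingMap.smul_apply, ContinuousAlternatingMap.smul_apply, h1]
  simp only [smul_eq_mul, Matrix.cons_val_zero, Matrix.cons_val_one]
  ring

end Calculus

/-! ### Evaluation of forms that vanish modulo a system -/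

section ZeroMod

variable {n m : ℕ}

/-- Congruences enter the later arguments in this form: as equalities on vectors annihilated by the
modulus. -/
lemma eval_zeroMod_one {K : Submodule ℝ (Cov n 1)} {β : Cov n 2} (hβ : β ∈ zeroMod K 1)
    {u v : EuclideanSpace ℝ (Fin n)} (hu : ∀ a ∈ K, a ![u] = 0) (hv : ∀ a ∈ K, a ![v] = 0) :
    β ![u, v] = 0 := by
  have hβ' : β ∈ Submodule.span ℝ {β : Cov n 2 | ∃ κ ∈ K, ∃ a : Cov n 1, β = wedge κ a} := hβ
  induction hβ' using Submodule.span_induction with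
  | mem β h =>
    obtain ⟨κ, hκ, a, rfl⟩ := h
    erw [wedge_one_one_apply]
    simp [hu κ hκ, hv κ hκ]
  | zero => rfl
  | add a b ha hb h₁ h₂ => rw [ContinuousAlternatingMap.add_apply, h₁ ha, h₂ hb, add_zero]
  | smul r a ha h => rw [ContinuousAlternatingMap.smul_apply, h ha, smul_zero]

lemma eval_span_eq_zero {s : Set (Cov n 1)} {u : EuclideanSpace ℝ (Fin n)}
    (h : ∀ a ∈ s, a ![u] = 0) : ∀ a ∈ Submodule.span ℝ s, a ![u] = 0 := by
  intro a ha
  induction ha using Submodule.span_induction with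
  | mem a ha => exact h a ha
  | zero => rfl
  | add a b _ _ h₁ h₂ => rw [ContinuousAlternatingMap.add_apply, h₁, h₂, add_zero]
  | smul r a _ h => rw [ContinuousAlternatingMap.smul_apply, h, smul_zero]

lemma eval_spanAt_eq_zero {M ι : Type*} {κ : ι → Form n 1 M} {x : M}
    {u : EuclideanSpace ℝ (Fin n)} (h : ∀ i, κ i x ![u] = 0) :
    ∀ a ∈ spanAt κ x, a ![u] = 0 :=
  eval_span_eq_zero (by rintro _ ⟨i, rfl⟩; exact h i)

lemma zeroMod_comp {K : Submodule ℝ (Cov m 1)} {K' : Submodule ℝ (Cov n 1)} {k : ℕ}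
    (T : EuclideanSpace ℝ (Fin n) →L[ℝ] EuclideanSpace ℝ (Fin m))
    (hK : ∀ a ∈ K, a.compContinuousLinearMap T ∈ K') {β : Cov m (1 + k)} (hβ : β ∈ zeroMod K k) :
    β.compContinuousLinearMap T ∈ zeroMod K' k := by
  unfold zeroMod at hβ
  induction hβ using Submodule.span_induction with
  | mem β h =>
    obtain ⟨κ, hκ, a, rfl⟩ := h
    rw [wedge_comp]
    exact Submodule.subset_span ⟨_, hK κ hκ, _, rfl⟩
  | zero => exact (zeroMod K' k).zero_mem
  | add a b _ _ h₁ h₂ => exact (zeroMod K' k).add_mem h₁ h₂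
  | smul r a _ h => exact (zeroMod K' k).smul_mem r h

end ZeroMod

/-! ### Ideals under products, pullback and restriction -/

section AlgIdealMore

variable {n m k l : ℕ}
  {M : Type*} [TopologicalSpace M] [ChartedSpace (EuclideanSpace ℝ (Fin n)) M]
  {N : Type*} [TopologicalSpace N] [ChartedSpace (EuclideanSpace ℝ (Fin m)) N]
  {S T : GradedSet n M}

omit [TopologicalSpace M] [ChartedSpace (EuclideanSpace ℝ (Fin n)) M] in
lemma castCov_castCov (h : k = l) (h' : l = k) (a : Cov n k) : castCov h' (castCov h a) = a := by
  subst h; rfl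

/-- If the products of a form with the generators of an ideal belong to another ideal, then so do
its products with all elements of the first ideal. -/
lemma AlgIdeal.mul_mem {α : Form n l M}
    (h : ∀ k, ∀ β ∈ S k, AlgIdeal T (l + k) (Backlund.fwedge α β)) {β : Form n k M}
    (hβ : AlgIdeal S k β) : AlgIdeal T (l + k) (Backlund.fwedge α β) := by
  induction hβ with
  | of hβ => exact h _ _ hβ
  | zero k =>
    have : Backlund.fwedge α (0 : Form n k M) = 0 := by
      funext x
      have := wedge_smul_right (0 : ℝ) (α x) (0 : Cov n k)
      rw [zero_smul, zero_smul] at this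
      exact this
    rw [this]
    exact .zero _
  | add _ _ h₁ h₂ =>
    rename_i k β₁ β₂ _ _
    have : Backlund.fwedge α (β₁ + β₂) = Backlund.fwedge α β₁ + Backlund.fwedge α β₂ :=
      funext fun x => wedge_add_right _ _ _
    rw [this]
    exact h₁.add h₂
  | wedge _ hγ h' =>
    rename_i k p β γ _
    have : Backlund.fwedge α (Backlund.fwedge β γ) =
        castForm (Nat.add_assoc l k p) (Backlund.fwedge (Backlund.fwedge α β) γ) := by
      funext x
      have := wedge_assoc (α x) (β x) (γ x)
      simp only [castForm, Backlund.fwedge]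
      rw [this, castCov_castCov]
    rw [this]
    exact (h'.wedge hγ).cast _

/-- Elements of positive degree of an ideal vanish on multiples of a vector that is annihilated by
the `1`-forms among the generators. -/
lemma AlgIdeal.apply_const_eq_zero {S₁ : Set (Form n 1 M)} {S₂ : Set (Form n 2 M)}
    {α : Form n k M} (h : AlgIdeal (gens S₁ S₂) k α) {x : M} {u : EuclideanSpace ℝ (Fin n)}
    (hu : ∀ σ ∈ S₁, σ x ![u] = 0) : α x (fun _ => u) = 0 := by
  induction h with
  | of h =>
    rename_i k α
    match k, α, h with
    | 1, α, h => rw [const_eq_vecOne]; exact hu α h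
    | 2, α, h => exact (α x).map_eq_zero_of_eq _ (i := 0) (j := 1) rfl (by decide)
  | zero k => rfl
  | add _ _ h₁ h₂ => rw [Pi.add_apply, ContinuousAlternatingMap.add_apply, h₁, h₂, add_zero]
  | wedge _ _ h => exact wedge_apply_eq_zero _ _ _ fun f => h

/-- The graded set of the pullbacks of the elements of a graded set. -/
def pullSet (f : M → N) (S : GradedSet m N) : GradedSet n M := fun k =>
  {β | ∃ α ∈ S k, β = pullback f α}

lemma pullSet_gens (f : M → N) (S₁ : Set (Form m 1 N)) (S₂ : Set (Form m 2 N)) :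
    pullSet (n := n) f (gens S₁ S₂) = gens (pullback f '' S₁) (pullback f '' S₂) := by
  funext k
  match k with
  | 0 => ext β; simp [pullSet, gens]
  | 1 => ext β; simp [pullSet, gens, eq_comm]
  | 2 => ext β; simp [pullSet, gens, eq_comm]
  | k + 3 => ext β; simp [pullSet, gens]

variable [IsManifold (𝓡 n) ∞ M] [IsManifold (𝓡 m) ∞ N]

lemma AlgIdeal.pullSet_mono {f : M → N} (hf : ContMDiff (𝓡 n) (𝓡 m) ∞ f) {S T : GradedSet m N}
    (h : ∀ k, ∀ α ∈ S k, AlgIdeal T k α) {k : ℕ} {α : Form n k M}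
    (hα : AlgIdeal (pullSet f S) k α) : AlgIdeal (pullSet f T) k α := by
  refine hα.trans ?_
  rintro k _ ⟨β, hβ, rfl⟩
  exact AlgIdeal.pullback_mem (T := pullSet f T) f hf (fun k γ hγ => .of ⟨γ, hγ, rfl⟩) (h k β hβ)

lemma algIdeal_pull_ofGens {f : M → N} (hf : ContMDiff (𝓡 n) (𝓡 m) ∞ f) {S : GradedSet m N}
    (hS : ∀ k, ∀ α ∈ S k, IsSmooth α) (hd : ∀ k, ∀ α ∈ S k, AlgIdeal S (k + 1) (d α))
    (k : ℕ) (α : Form n k M) :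
    AlgIdeal ((EDS.ofGens S hS hd).pull f) k α ↔ AlgIdeal (pullSet f S) k α :=
  ⟨fun h => h.pullSet_mono hf (S := fun k => {α | AlgIdeal S k α}) fun _ _ h => h,
    fun h => h.trans (by rintro _ _ ⟨β, hβ, rfl⟩; exact .of ⟨β, .of hβ, rfl⟩)⟩

/-- The restriction of a map to an open subset. -/
lemma tang_subtype_val_bijective (V : TopologicalSpace.Opens M) (x : V) :
    Function.Bijective (tang (n := n) (m := n) (Subtype.val : V → M) x) := by
  classical
  -- A left inverse of the inclusion, extended by a constant outside `V`. It need not be smooth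
  -- everywhere; near `x` it is the identity, which is enough for the chain rule.
  let g : M → V := fun y => if hy : y ∈ V then ⟨y, hy⟩ else x
  have hg : ContMDiffAt (𝓡 n) (𝓡 n) ∞ g x := by
    rw [← ContMDiffAt.subtypeVal_comp_iff]
    refine ContMDiffAt.congr_of_eventuallyEq contMDiffAt_id ?_
    filter_upwards [V.isOpen.mem_nhds x.2] with y hy
    have : g y = ⟨y, hy⟩ := dif_pos hy
    rw [Function.comp_apply, this]
    rfl
  have h1 := tang_comp (n := n) (m := n) (p := n) (g := g) (f := (Subtype.val : V → M)) x hg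
    (contMDiff_subtype_val x)
  have h2 : (fun y : V => g y) = id := funext fun y => dif_pos y.2
  rw [h2, tang_id] at h1
  have hinj : Function.Injective (tang (n := n) (m := n) (Subtype.val : V → M) x).toLinearMap :=
    fun u v huv => by
      have h3 : ∀ w, tang (n := n) (m := n) g x (tang (n := n) (m := n) (Subtype.val : V → M) x w) =
        w := fun w => (DFunLike.congr_fun h1 w).symm
      rw [← h3 u, ← h3 v]
      exact congrArg _ huv
  exact ⟨hinj, LinearMap.injective_iff_surjective.1 hinj⟩

lemma IsFrame.pullback {r : ℕ} {κ : Fin r → Form m 1 N} (hκ : IsFrame κ) {f : M → N}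
    (hf : ContMDiff (𝓡 n) (𝓡 m) ∞ f)
    (hf' : ∀ x, Function.Surjective (tang (n := n) (m := m) f x)) :
    IsFrame (fun i => Backlund.pullback (n := n) f (κ i)) := by
  refine ⟨fun i => (hκ.1 i).pullback hf, fun x => ?_⟩
  rw [Fintype.linearIndependent_iff]
  intro g hg
  refine Fintype.linearIndependent_iff.1 (hκ.2 (f x)) g ?_
  ext v
  have h1 : ∀ i, ∃ w, tang (n := n) (m := m) f x w = v i := fun i => hf' x (v i)
  choose w hw using h1
  have := DFunLike.congr_fun hg w
  simp only [ContinuousAlternatingMap.sum_apply, ContinuousAlternatingMap.smul_apply,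
    pullback_apply, hw] at this ⊢
  exact this

end AlgIdealMore

/-! ### Invariant coframings and their differential ideals -/

section HalfStructures

variable {N : Type*} [TopologicalSpace N] [ChartedSpace (EuclideanSpace ℝ (Fin 7)) N]
  {N' : Type*} [TopologicalSpace N'] [ChartedSpace (EuclideanSpace ℝ (Fin 7)) N']

/-- A coframing `(θ, α₁, α₂, β₁, β₂, ζ₁, ζ₂)` with `dθ ≡ P α₁∧α₂ + Q β₁∧β₂ mod θ`, such that the
bundles `⟦θ, α₁, α₂⟧` and `⟦θ, β₁, β₂⟧` are invariant along the annihilator of the first five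
forms. -/
structure IsInvariantCoframing (κ : Fin 7 → Form 7 1 N) (P Q : N → ℝ) : Prop where
  frame : IsFrame κ
  d_θ : ∀ x u v, κ 0 x ![u] = 0 → κ 0 x ![v] = 0 → d (κ 0) x ![u, v] =
    P x * wedge (κ 1 x) (κ 2 x) ![u, v] + Q x * wedge (κ 3 x) (κ 4 x) ![u, v]
  P_ne : ∀ x, P x ≠ 0
  Q_ne : ∀ x, Q x ≠ 0
  d_α : ∀ x z v, (∀ i : Fin 7, i < 5 → κ i x ![z] = 0) →
    κ 0 x ![v] = 0 → κ 1 x ![v] = 0 → κ 2 x ![v] = 0 →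
    d (κ 1) x ![z, v] = 0 ∧ d (κ 2) x ![z, v] = 0
  d_β : ∀ x z v, (∀ i : Fin 7, i < 5 → κ i x ![z] = 0) →
    κ 0 x ![v] = 0 → κ 3 x ![v] = 0 → κ 4 x ![v] = 0 →
    d (κ 3) x ![z, v] = 0 ∧ d (κ 4) x ![z, v] = 0

/-- The permutation that exchanges the roles of the `αᵢ` and the `βᵢ`. -/
def swapIndex : Equiv.Perm (Fin 7) where
  toFun := ![0, 3, 4, 1, 2, 5, 6]
  invFun := ![0, 3, 4, 1, 2, 5, 6]
  left_inv := by decide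
  right_inv := by decide

namespace IsInvariantCoframing

variable {κ : Fin 7 → Form 7 1 N} {P Q : N → ℝ}

/-- The hypotheses are symmetric in `α` and `β`, so each descent or closure statement has to be
proved for only one of the two pairs. -/
lemma swap (h : IsInvariantCoframing κ P Q) :
    IsInvariantCoframing (fun i => κ (swapIndex i)) Q P where
  frame := ⟨fun i => h.frame.1 _, fun x => (h.frame.2 x).comp _ swapIndex.injective⟩
  d_θ x u v hu hv := (h.d_θ x u v hu hv).trans (add_comm _ _)
  P_ne := h.Q_ne
  Q_ne := h.P_ne
  d_α x z v hz := h.d_β x z v fun i hi => by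
    have := hz (swapIndex i) (by revert i; decide)
    rwa [show swapIndex (swapIndex i) = i from swapIndex.left_inv i] at this
  d_β x z v hz := h.d_α x z v fun i hi => by
    have := hz (swapIndex i) (by revert i; decide)
    rwa [show swapIndex (swapIndex i) = i from swapIndex.left_inv i] at this

/-- The frame dual to the coframing. -/
abbrev dual (κ : Fin 7 → Form 7 1 N) (x : N) (j : Fin 7) : EuclideanSpace ℝ (Fin 7) :=
  dualVec (fun a => κ a x) j

lemma apply_dual (h : IsInvariantCoframing κ P Q) (x : N) (i j : Fin 7) :
    κ i x ![dual κ x j] = if i = j then 1 else 0 := coframe_dualVec (h.frame.2 x) i j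

lemma apply_dual_of_ne (h : IsInvariantCoframing κ P Q) (x : N) {i j : Fin 7} (hij : i ≠ j) :
    κ i x ![dual κ x j] = 0 := by rw [h.apply_dual, if_neg hij]

/-- For `θ` both products in the structure equation vanish on such vectors; for the other forms this
is invariance, since a vertical `v` is annihilated by `θ` and by both pairs. -/
lemma d_vertical (h : IsInvariantCoframing κ P Q) (x : N) {z v : EuclideanSpace ℝ (Fin 7)}
    (hz : ∀ i : Fin 7, i < 5 → κ i x ![z] = 0) (hv : ∀ i : Fin 7, i < 5 → κ i x ![v] = 0)
    {i : Fin 7} (hi : i < 5) : d (κ i) x ![z, v] = 0 := by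
  fin_cases i
  · refine (h.d_θ x z v (hz 0 (by decide)) (hv 0 (by decide))).trans ?_
    rw [wedge_one_one_apply, wedge_one_one_apply]
    simp [hz 1 (by decide), hz 2 (by decide), hz 3 (by decide), hz 4 (by decide)]
  · exact (h.d_α x z v hz (hv 0 (by decide)) (hv 1 (by decide)) (hv 2 (by decide))).1
  · exact (h.d_α x z v hz (hv 0 (by decide)) (hv 1 (by decide)) (hv 2 (by decide))).2
  · exact (h.d_β x z v hz (hv 0 (by decide)) (hv 3 (by decide)) (hv 4 (by decide))).1
  · exact (h.d_β x z v hz (hv 0 (by decide)) (hv 3 (by decide)) (hv 4 (by decide))).2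
  · exact absurd hi (by decide)
  · exact absurd hi (by decide)

/-- In the expansion of `dκᵢ` every product with a factor of index below 5 lies in the system. The
rest involves only the last two forms, and its coefficients are values on vertical vectors. -/
lemma isFrobenius (h : IsInvariantCoframing κ P Q) :
    IsFrobenius ![κ 0, κ 1, κ 2, κ 3, κ 4] := by
  have e : ![κ 0, κ 1, κ 2, κ 3, κ 4] = fun i : Fin 5 => κ (Fin.castLE (by decide) i) := by
    funext i; fin_cases i <;> rfl
  rw [e]
  refine ⟨⟨fun i => h.frame.1 _, fun x => (h.frame.2 x).comp _ (Fin.castLE_injective _)⟩,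
    fun i x => ?_⟩
  set K := spanAt (fun i : Fin 5 => κ (Fin.castLE (by decide) i)) x with hK
  have hmem : ∀ i : Fin 7, i < 5 → κ i x ∈ K := by
    intro i hi
    exact Submodule.subset_span ⟨⟨i, hi⟩, rfl⟩
  have e := cov_two_eq_sum (h.frame.2 x) (d (κ (Fin.castLE (by decide) i)) x)
  rw [e]
  refine Submodule.sum_mem (zeroMod K 1) fun a _ => Submodule.sum_mem (zeroMod K 1) fun b _ => ?_
  by_cases ha : a < 5
  · exact (zeroMod K 1).smul_mem _ (Submodule.subset_span ⟨_, hmem a ha, _, rfl⟩)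
  by_cases hb : b < 5
  · have e1 : wedge (κ a x) (κ b x) = (-1 : ℝ) • wedge (κ b x) (κ a x) := by
      ext v
      rw [ContinuousAlternatingMap.smul_apply, wedge_one_one_apply, wedge_one_one_apply,
        smul_eq_mul]
      ring
    rw [e1]
    exact (zeroMod K 1).smul_mem _ ((zeroMod K 1).smul_mem _
      (Submodule.subset_span ⟨_, hmem b hb, _, rfl⟩))
  · have hv : ∀ c : Fin 7, ¬ c < 5 → ∀ i : Fin 7, i < 5 → κ i x ![dual κ x c] = 0 :=
      fun c hc i hi => h.apply_dual_of_ne x (by rintro rfl; exact hc hi)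
    have := h.d_vertical x (hv a ha) (hv b hb) (i := Fin.castLE (by decide) i)
      (by fin_cases i <;> decide)
    rw [this, mul_zero, zero_smul]
    exact (zeroMod K 1).zero_mem

/-- The generators of the system associated with an invariant coframing. -/
def system {n : ℕ} {N : Type*} (κ : Fin 7 → Form n 1 N) : GradedSet n N :=
  gens {κ 0} {fwedge (κ 1) (κ 2), fwedge (κ 3) (κ 4)}

lemma system_swap {n : ℕ} {N : Type*} (κ : Fin 7 → Form n 1 N) :
    system (fun i => κ (swapIndex i)) = system κ := by
  unfold system
  rw [Set.pair_comm (fwedge (κ 1) (κ 2))]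
  rfl

lemma pullSet_system {n m : ℕ} {M : Type*} [TopologicalSpace M]
    [ChartedSpace (EuclideanSpace ℝ (Fin n)) M] {N : Type*} [TopologicalSpace N]
    [ChartedSpace (EuclideanSpace ℝ (Fin m)) N] (κ : Fin 7 → Form m 1 N) (f : M → N) :
    pullSet (n := n) f (system κ) = system (fun i => Backlund.pullback (n := n) f (κ i)) := by
  unfold system
  rw [pullSet_gens, Set.image_singleton, Set.image_pair, pullback_fwedge, pullback_fwedge]

lemma mem_θ : AlgIdeal (system κ) 1 (κ 0) := .of (k := 1) rfl

lemma mem_αα : AlgIdeal (system κ) 2 (fwedge (κ 1) (κ 2)) := .of (k := 2) (.inl rfl)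

lemma mem_ββ : AlgIdeal (system κ) 2 (fwedge (κ 3) (κ 4)) := .of (k := 2) (.inr rfl)

lemma isSmooth_system (h : IsInvariantCoframing κ P Q) :
    ∀ k, ∀ α ∈ system κ k, IsSmooth α := by
  refine forall_gens_iff (P := fun k α => IsSmooth α).2 ⟨?_, ?_⟩
  · rintro _ rfl; exact h.frame.1 0
  · rintro _ (rfl | rfl)
    · exact (h.frame.1 1).fwedge (h.frame.1 2)
    · exact (h.frame.1 3).fwedge (h.frame.1 4)

variable [IsManifold (𝓡 7) ∞ N]

lemma d_θ_mem (h : IsInvariantCoframing κ P Q) : AlgIdeal (system κ) 2 (d (κ 0)) := by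
  refine AlgIdeal.of_components_two h.frame (h.frame.1 0).d fun i j hij => ?_
  by_cases hi : i = 0
  · subst hi; exact .inl (mem_θ.wedge (h.frame.1 j))
  by_cases h1 : i = 1 ∧ j = 2
  · obtain ⟨rfl, rfl⟩ := h1; exact .inl mem_αα
  by_cases h2 : i = 3 ∧ j = 4
  · obtain ⟨rfl, rfl⟩ := h2; exact .inl mem_ββ
  refine .inr fun x => ?_
  have hj : j ≠ 0 := by rintro rfl; exact absurd hij (by simp)
  rw [h.d_θ x _ _ (h.apply_dual_of_ne x (Ne.symm hi)) (h.apply_dual_of_ne x (Ne.symm hj)),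
    wedge_one_one_apply, wedge_one_one_apply]
  simp only [Matrix.cons_val_zero, Matrix.cons_val_one, h.apply_dual]
  split_ifs <;> first | (exfalso; omega) | simp

/-- Modulo `θ, α₁, α₂` the possible products are `β₁∧β₂` and those containing a `ζ`; invariance
removes the latter. -/
lemma d_α_mem (h : IsInvariantCoframing κ P Q) {i : Fin 7} (hi : i = 1 ∨ i = 2) :
    AlgIdeal (gens {κ 0, κ 1, κ 2} {fwedge (κ 3) (κ 4)}) 2 (d (κ i)) := by
  refine AlgIdeal.of_components_two h.frame (h.frame.1 i).d fun a b hab => ?_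
  by_cases ha : a = 0 ∨ a = 1 ∨ a = 2
  · refine .inl (AlgIdeal.wedge (.of (k := 1) ?_) (h.frame.1 b))
    rcases ha with rfl | rfl | rfl
    exacts [.inl rfl, .inr (.inl rfl), .inr (.inr rfl)]
  by_cases h2 : a = 3 ∧ b = 4
  · obtain ⟨rfl, rfl⟩ := h2; exact .inl (.of (k := 2) rfl)
  refine .inr fun x => ?_
  have hb : (5 : Fin 7) ≤ b := by omega
  push Not at ha
  have hv : ∀ c : Fin 7, (5 : Fin 7) ≤ c → ∀ i : Fin 7, i < 5 → κ i x ![dual κ x c] = 0 :=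
    fun c hc i hi => h.apply_dual_of_ne x (by rintro rfl; exact absurd hi (not_lt.2 hc))
  rw [cov_two_swap]
  have := h.d_α x (dual κ x b) (dual κ x a) (hv b hb) (h.apply_dual_of_ne x ha.1.symm)
    (h.apply_dual_of_ne x ha.2.1.symm) (h.apply_dual_of_ne x ha.2.2.symm)
  rcases hi with rfl | rfl
  · rw [this.1, neg_zero]
  · rw [this.2, neg_zero]

/-- Multiplication by `αᵢ` sends `⟨θ, α₁, α₂, β₁∧β₂⟩` into the ideal with `α₁∧α₂` in place of the
single `αⱼ`. Closure of `α₁∧α₂` under `d` follows from this by the Leibniz rule. -/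
lemma wedge_α_mem (h : IsInvariantCoframing κ P Q) {i j : Fin 7} (hi : i = 1 ∨ i = 2)
    (hj : j = 1 ∨ j = 2) : AlgIdeal (system κ) 3 (fwedge (κ i) (d (κ j))) := by
  refine AlgIdeal.mul_mem (l := 1) (T := system κ) ?_ (h.d_α_mem hj)
  refine forall_gens_iff (P := fun k β => AlgIdeal (system κ) (1 + k) (fwedge (κ i) β)).2 ⟨?_, ?_⟩
  · have key : ∀ a : Fin 7, (a = 0 ∨ a = 1 ∨ a = 2) →
        AlgIdeal (system κ) 2 (fwedge (κ i) (κ a)) := by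
      intro a ha
      refine AlgIdeal.of_components_two h.frame ((h.frame.1 i).fwedge (h.frame.1 a))
        fun b c hbc => ?_
      by_cases hb : b = 0
      · subst hb; exact .inl (mem_θ.wedge (h.frame.1 c))
      by_cases h1 : b = 1 ∧ c = 2
      · obtain ⟨rfl, rfl⟩ := h1; exact .inl mem_αα
      refine .inr fun x => ?_
      refine (wedge_one_one_apply _ _ _).trans ?_
      simp only [Matrix.cons_val_zero, Matrix.cons_val_one, h.apply_dual]
      have hc : c ≠ 0 ∧ c ≠ 1 ∧ c ≠ 2 := by omega
      rcases hi with rfl | rfl <;> rcases ha with rfl | rfl | rfl <;>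
        simp [hc.1.symm, hc.2.1.symm, hc.2.2.symm, Ne.symm hb]
    rintro _ (rfl | rfl | rfl)
    exacts [key 0 (.inl rfl), key 1 (.inr (.inl rfl)), key 2 (.inr (.inr rfl))]
  · rintro _ rfl
    exact mem_ββ.wedge_left (h.frame.1 i)

lemma d_αα_mem (h : IsInvariantCoframing κ P Q) :
    AlgIdeal (system κ) 3 (d (fwedge (κ 1) (κ 2))) := by
  rw [d_fwedge (h.frame.1 1) (h.frame.1 2)]
  refine AlgIdeal.add (k := 3) ?_ ((h.wedge_α_mem (.inl rfl) (.inr rfl)).const_smul _)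
  obtain ⟨s, hs⟩ := exists_wedge_comm (n := 7) 1 2
  have e : fwedge (d (κ 1)) (κ 2) = castForm (Nat.add_comm 1 2)
      (fun x => s • fwedge (κ 2) (d (κ 1)) x) := funext fun x => hs (κ 2 x) (d (κ 1) x)
  have e' : castForm (Nat.add_right_comm 1 1 1) (fwedge (d (κ 1)) (κ 2)) =
      fun x => s • fwedge (κ 2) (d (κ 1)) x := by rw [e]; rfl
  rw [e']
  exact (h.wedge_α_mem (.inr rfl) (.inl rfl)).const_smul s

lemma d_system_mem (h : IsInvariantCoframing κ P Q) :
    ∀ k, ∀ α ∈ system κ k, AlgIdeal (system κ) (k + 1) (d α) := by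
  refine forall_gens_iff (P := fun k α => AlgIdeal (system κ) (k + 1) (d α)).2 ⟨?_, ?_⟩
  · rintro _ rfl; exact h.d_θ_mem
  · rintro _ (rfl | rfl)
    · exact h.d_αα_mem
    · have := h.swap.d_αα_mem
      rw [system_swap] at this
      exact this

/-- Invariant coframings can be pulled back along maps with injective derivative. -/
lemma pullback (h : IsInvariantCoframing κ P Q) [IsManifold (𝓡 7) ∞ N'] {f : N' → N}
    (hf : ContMDiff (𝓡 7) (𝓡 7) ∞ f)
    (hf' : ∀ x, Function.Bijective (tang (n := 7) (m := 7) f x)) :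
    IsInvariantCoframing (fun i => Backlund.pullback (n := 7) f (κ i)) (fun x => P (f x))
      (fun x => Q (f x)) := by
  have e : ∀ (x : N') (i : Fin 7) u, Backlund.pullback (n := 7) f (κ i) x ![u] =
      κ i (f x) ![tang (n := 7) (m := 7) f x u] := by
    intro x i u
    rw [pullback_apply]
    congr 1
    funext a; fin_cases a; rfl
  have e2 : ∀ (x : N') (i : Fin 7) u v, d (Backlund.pullback (n := 7) f (κ i)) x ![u, v] =
      d (κ i) (f x) ![tang (n := 7) (m := 7) f x u, tang (n := 7) (m := 7) f x v] := by
    intro x i u v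
    rw [d_pullback hf (h.frame.1 i), pullback_apply]
    congr 1
    funext a; fin_cases a <;> rfl
  refine ⟨h.frame.pullback hf fun x => (hf' x).2, ?_, fun x => h.P_ne _, fun x => h.Q_ne _,
    ?_, ?_⟩
  · intro x u v hu hv
    rw [e] at hu hv
    rw [e2, h.d_θ _ _ _ hu hv, wedge_one_one_apply, wedge_one_one_apply, wedge_one_one_apply,
      wedge_one_one_apply]
    simp [e]
  · intro x z v hz h0 h1 h2
    simp only [e] at hz h0 h1 h2
    rw [e2, e2]
    exact h.d_α _ _ _ hz h0 h1 h2
  · intro x z v hz h0 h1 h2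
    simp only [e] at hz h0 h1 h2
    rw [e2, e2]
    exact h.d_β _ _ _ hz h0 h1 h2

end IsInvariantCoframing

end HalfStructures

/-! ### Finite sums of forms, and uniqueness for linear equations -/

section Sums

variable {n k : ℕ} {M : Type*} [TopologicalSpace M] [ChartedSpace (EuclideanSpace ℝ (Fin n)) M]

lemma isSmooth_sum {ι : Type*} (s : Finset ι) {α : ι → Form n k M} (h : ∀ i, IsSmooth (α i)) :
    IsSmooth (fun x => ∑ i ∈ s, α i x) := by
  classical
  induction s using Finset.induction_on with
  | empty => simp only [Finset.sum_empty]; exact isSmooth_zero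
  | insert i s hi ih => simp only [Finset.sum_insert hi]; exact (h i).add ih

lemma d_sum {ι : Type*} (s : Finset ι) {α : ι → Form n k M} (h : ∀ i, IsSmooth (α i)) :
    d (fun x => ∑ i ∈ s, α i x) = fun x => ∑ i ∈ s, d (α i) x := by
  classical
  induction s using Finset.induction_on with
  | empty => simp only [Finset.sum_empty]; exact d_zero
  | insert i s hi ih =>
    simp only [Finset.sum_insert hi]
    have := d_add (h i) (isSmooth_sum s h)
    rw [ih] at this
    exact this

end Sums

/-- A linear homogeneous system of ordinary differential equations has only the trivial solution
with trivial initial values. -/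
lemma eq_zero_of_linear_ode {ι : Type*} [Fintype ι] {g : ι → ℝ → ℝ} {a : ι → ι → ℝ → ℝ}
    (ha : ∀ i j, Continuous (a i j))
    (hg : ∀ i t, HasDerivAt (g i) (∑ j, a i j t * g j t) t) (h0 : ∀ i, g i 0 = 0) (i : ι) :
    g i 1 = 0 := by
  classical
  have hC : ∀ p : ι × ι, ∃ C : ℝ, 0 ≤ C ∧ ∀ t ∈ Set.Icc (0 : ℝ) 1, |a p.1 p.2 t| ≤ C := by
    intro p
    obtain ⟨C, hC⟩ := (isCompact_Icc (a := (0 : ℝ)) (b := 1)).exists_bound_of_continuousOn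
      (ha p.1 p.2).continuousOn
    exact ⟨max C 0, le_max_right _ _, fun t ht => (hC t ht).trans (le_max_left _ _)⟩
  choose C hC0 hC using hC
  set K := ∑ p, C p with hK
  have hG : ∀ t, HasDerivAt (fun t => fun i => g i t) (fun i => ∑ j, a i j t * g j t) t :=
    fun t => hasDerivAt_pi.2 fun i => hg i t
  -- Grönwall in the sup norm. The sum of the bounds of all matrix entries dominates the sum over
  -- any single row.
  have := eq_zero_of_abs_deriv_le_mul_abs_self_of_eq_zero_right (K := K)
    (f := fun t => fun i => g i t) (a := 0) (b := 1)
    (continuous_iff_continuousAt.2 fun t => (hG t).continuousAt).continuousOn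
    (fun t _ => (hG t).hasDerivWithinAt) (funext h0) (by
      intro t ht
      refine (pi_norm_le_iff_of_nonneg (mul_nonneg (Finset.sum_nonneg fun p _ => hC0 p)
        (norm_nonneg _))).2 fun i => ?_
      calc ‖∑ j, a i j t * g j t‖ ≤ ∑ j, ‖a i j t * g j t‖ := norm_sum_le _ _
        _ ≤ ∑ j, C (i, j) * ‖fun i => g i t‖ := by
          refine Finset.sum_le_sum fun j _ => ?_
          rw [norm_mul]
          exact mul_le_mul (hC (i, j) t (Set.Ico_subset_Icc_self ht))
            (norm_le_pi_norm (fun i => g i t) j) (norm_nonneg _) (hC0 _)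
        _ = (∑ j, C (i, j)) * ‖fun i => g i t‖ := (Finset.sum_mul _ _ _).symm
        _ ≤ K * ‖fun i => g i t‖ := by
          refine mul_le_mul_of_nonneg_right ?_ (norm_nonneg _)
          rw [hK, Fintype.sum_prod_type]
          exact Finset.single_le_sum (f := fun i => ∑ j, C (i, j))
            (fun i _ => Finset.sum_nonneg fun j _ => hC0 _) (Finset.mem_univ i)) 1 (by simp)
  exact congrFun this i

/-! ### Leaf projections and the descent of the invariant bundles -/

section Leaves

variable {N : Type*} [TopologicalSpace N] [ChartedSpace (EuclideanSpace ℝ (Fin 7)) N]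
  {M : Type*} [TopologicalSpace M] [ChartedSpace (EuclideanSpace ℝ (Fin 5)) M]

/-- A submersion with a global section whose fibres are tangent to the annihilator of the first
five forms of a coframing, such that the points of each fibre can be joined with the section by a
smooth curve in the fibre. -/
structure IsLeafProjection (κ : Fin 7 → Form 7 1 N) (π : N → M) (s : M → N) : Prop where
  smooth : ContMDiff (𝓡 7) (𝓡 5) ∞ π
  smooth_section : ContMDiff (𝓡 5) (𝓡 7) ∞ s
  proj_section : ∀ y, π (s y) = y
  ker : ∀ x v, tang (n := 7) (m := 5) π x v = 0 ↔ ∀ i : Fin 7, i < 5 → κ i x ![v] = 0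
  path : ∀ x, ∃ c : EuclideanSpace ℝ (Fin 1) → N, ContMDiff (𝓡 1) (𝓡 7) ∞ c ∧
    c 0 = s (π x) ∧ c (EuclideanSpace.single 0 1) = x ∧ ∀ t, π (c t) = π x

lemma pullback_apply_one {n m : ℕ} {M : Type*} [TopologicalSpace M]
    [ChartedSpace (EuclideanSpace ℝ (Fin n)) M] {N : Type*} [TopologicalSpace N]
    [ChartedSpace (EuclideanSpace ℝ (Fin m)) N] (f : M → N) (β : Form m 1 N) (x : M)
    (v : EuclideanSpace ℝ (Fin n)) :
    pullback (n := n) f β x ![v] = β (f x) ![tang (n := n) (m := m) f x v] := by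
  rw [pullback_apply]
  congr 1
  funext i; fin_cases i; rfl

lemma pullback_apply_two {n m : ℕ} {M : Type*} [TopologicalSpace M]
    [ChartedSpace (EuclideanSpace ℝ (Fin n)) M] {N : Type*} [TopologicalSpace N]
    [ChartedSpace (EuclideanSpace ℝ (Fin m)) N] (f : M → N) (β : Form m 2 N) (x : M)
    (u v : EuclideanSpace ℝ (Fin n)) :
    pullback (n := n) f β x ![u, v] =
      β (f x) ![tang (n := n) (m := m) f x u, tang (n := n) (m := m) f x v] := by
  rw [pullback_apply]
  congr 1
  funext i; fin_cases i <;> rfl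

namespace IsLeafProjection

open IsInvariantCoframing (dual)

variable {κ : Fin 7 → Form 7 1 N} {P Q : N → ℝ} {π : N → M} {s : M → N}

lemma swap (h : IsLeafProjection κ π s) : IsLeafProjection (fun i => κ (swapIndex i)) π s where
  smooth := h.smooth
  smooth_section := h.smooth_section
  proj_section := h.proj_section
  path := h.path
  ker x v := by
    rw [h.ker]
    refine ⟨fun H i hi => H _ (by revert i; decide), fun H i hi => ?_⟩
    have := H (swapIndex i) (by revert i; decide)
    rwa [show swapIndex (swapIndex i) = i from swapIndex.left_inv i] at this

lemma dual_swap (hκ : IsInvariantCoframing κ P Q) (x : N) (j : Fin 7) :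
    dual (fun i => κ (swapIndex i)) x j = dual κ x (swapIndex j) := by
  refine eq_of_forall_coframe (hκ.swap.frame.2 x) fun i => ?_
  rw [hκ.swap.apply_dual, hκ.apply_dual]
  simp

/-- The forms on the leaf space that are induced by the section. -/
def desc (κ : Fin 7 → Form 7 1 N) (s : M → N) (i : Fin 7) : Form 5 1 M :=
  pullback (n := 5) s (κ i)

variable [IsManifold (𝓡 7) ∞ N] [IsManifold (𝓡 5) ∞ M]

lemma tang_proj_section (h : IsLeafProjection κ π s) (y : M) (w : EuclideanSpace ℝ (Fin 5)) :
    tang (n := 7) (m := 5) π (s y) (tang (n := 5) (m := 7) s y w) = w := by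
  have h1 := tang_comp (n := 5) (m := 7) (p := 5) y (h.smooth (s y)) (h.smooth_section y)
  rw [show (fun y => π (s y)) = id from funext h.proj_section, tang_id] at h1
  exact (DFunLike.congr_fun h1 w).symm

lemma isSmooth_desc (h : IsLeafProjection κ π s) (hκ : IsInvariantCoframing κ P Q) (i : Fin 7) :
    IsSmooth (desc κ s i) := (hκ.frame.1 i).pullback h.smooth_section

/-- The pullbacks of the forms on the leaf space. -/
def lift (κ : Fin 7 → Form 7 1 N) (π : N → M) (s : M → N) (i : Fin 7) : Form 7 1 N :=
  pullback (n := 7) π (desc κ s i)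

lemma isSmooth_lift (h : IsLeafProjection κ π s) (hκ : IsInvariantCoframing κ P Q) (i : Fin 7) :
    IsSmooth (lift κ π s i) := (h.isSmooth_desc hκ i).pullback h.smooth

omit [IsManifold (𝓡 7) ∞ N] [IsManifold (𝓡 5) ∞ M] in
lemma lift_vertical (h : IsLeafProjection κ π s) {x : N} {z : EuclideanSpace ℝ (Fin 7)}
    (hz : ∀ i : Fin 7, i < 5 → κ i x ![z] = 0) (i : Fin 7) : lift κ π s i x ![z] = 0 := by
  rw [lift, pullback_apply_one, (h.ker x z).2 hz]
  exact (desc κ s i (π x)).map_coord_zero 0 rfl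

/-- Exterior differentiation commutes with pullback, so the derivative also comes from the leaf
space, where `z` projects to zero. -/
lemma d_lift_vertical (h : IsLeafProjection κ π s) (hκ : IsInvariantCoframing κ P Q) {x : N}
    {z : EuclideanSpace ℝ (Fin 7)} (hz : ∀ i : Fin 7, i < 5 → κ i x ![z] = 0) (i : Fin 7)
    (v : EuclideanSpace ℝ (Fin 7)) : d (lift κ π s i) x ![z, v] = 0 := by
  rw [lift, d_pullback h.smooth (h.isSmooth_desc hκ i), pullback_apply_two, (h.ker x z).2 hz]
  exact (d (desc κ s i) (π x)).map_coord_zero 0 rfl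

/-- At a point of the section the composite of the derivatives of `π` and `s` changes `v` only by a
vertical vector, and vertical vectors are annihilated by the first five forms. This provides the
initial values on every leaf. -/
lemma lift_section (h : IsLeafProjection κ π s) (y : M) {i : Fin 7} (hi : i < 5) :
    lift κ π s i (s y) = κ i (s y) := by
  ext v
  obtain ⟨v, rfl⟩ : ∃ w, v = ![w] := ⟨v 0, by funext a; fin_cases a; rfl⟩
  rw [lift, pullback_apply_one, desc, pullback_apply_one, h.proj_section]
  have h1 := (h.ker (s y) (tang (n := 5) (m := 7) s y (tang (n := 7) (m := 5) π (s y) v) - v)).1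
    (by rw [map_sub, h.tang_proj_section, sub_self]) i hi
  have h2 := cov_one_sum (κ i (s y)) Finset.univ (![1, -1] : Fin 2 → ℝ)
    ![tang (n := 5) (m := 7) s y (tang (n := 7) (m := 5) π (s y) v), v]
  simp only [Fin.sum_univ_two, Matrix.cons_val_zero, Matrix.cons_val_one, one_smul, neg_smul,
    ← sub_eq_add_neg, h1, one_mul, neg_mul] at h2
  linarith

lemma dual_vertical (hκ : IsInvariantCoframing κ P Q) (x : N) {c : Fin 7} (hc : 5 ≤ c) :
    ∀ i : Fin 7, i < 5 → κ i x ![dual κ x c] = 0 :=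
  fun i hi => hκ.apply_dual_of_ne x (by rintro rfl; exact absurd hi (not_lt.2 hc))

lemma lift_eq_sum (h : IsLeafProjection κ π s) (hκ : IsInvariantCoframing κ P Q) (i : Fin 7) :
    lift κ π s i = fun x => ∑ j : Fin 5, lift κ π s i x ![dual κ x (Fin.castLE (by decide) j)] •
      κ (Fin.castLE (by decide) j) x := by
  funext x
  have e := cov_one_eq_sum (hκ.frame.2 x) (lift κ π s i x)
  conv_lhs => rw [e]
  rw [Fin.sum_univ_castSucc, Fin.sum_univ_castSucc,
    h.lift_vertical (dual_vertical hκ x (c := Fin.last 6) (by decide)),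
    h.lift_vertical (dual_vertical hκ x (c := (Fin.last 5).castSucc) (by decide)), zero_smul,
    zero_smul, add_zero, add_zero]
  rfl

lemma contMDiff_lift_component (h : IsLeafProjection κ π s) (hκ : IsInvariantCoframing κ P Q)
    (i j : Fin 7) : ContMDiff (𝓡 7) 𝓘(ℝ, ℝ) ∞ (fun x => lift κ π s i x ![dual κ x j]) :=
  (contMDiff_frame_component hκ.frame (h.isSmooth_lift hκ i) fun _ => j).congr fun x => by
    rw [const_eq_vecOne]

/-- The derivatives of the components of the lifted forms along the fibres. -/
lemma d_lift_component (h : IsLeafProjection κ π s) (hκ : IsInvariantCoframing κ P Q) {x : N}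
    {z : EuclideanSpace ℝ (Fin 7)} (hz : ∀ i : Fin 7, i < 5 → κ i x ![z] = 0) (i : Fin 7)
    (b : Fin 5) :
    d (ofFun 7 fun x => lift κ π s i x ![dual κ x (Fin.castLE (by decide) b)]) x ![z] =
      -∑ j : Fin 5, lift κ π s i x ![dual κ x (Fin.castLE (by decide) j)] *
        d (κ (Fin.castLE (by decide) j)) x ![z, dual κ x (Fin.castLE (by decide) b)] := by
  -- With the lifted form written as `∑ fⱼ κⱼ` and `e_b` for the dual vector, the vanishing of its
  -- derivative on `(z, e_b)` reads `z(f_b) + ∑ fⱼ dκⱼ(z, e_b) = 0`; terms with `κⱼ(z)` drop out.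
  have h0 := h.d_lift_vertical hκ hz i (dual κ x (Fin.castLE (by decide) b))
  rw [h.lift_eq_sum hκ i, d_sum _ fun j => (hκ.frame.1 _).smul (h.contMDiff_lift_component hκ i _),
    ContinuousAlternatingMap.sum_apply] at h0
  have h1 : ∀ j : Fin 5, d (fun x => lift κ π s i x ![dual κ x (Fin.castLE (by decide) j)] •
      κ (Fin.castLE (by decide) j) x) x ![z, dual κ x (Fin.castLE (by decide) b)] =
      (if j = b then d (ofFun 7 fun x =>
        lift κ π s i x ![dual κ x (Fin.castLE (by decide) j)]) x ![z] else 0) +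
      lift κ π s i x ![dual κ x (Fin.castLE (by decide) j)] *
        d (κ (Fin.castLE (by decide) j)) x ![z, dual κ x (Fin.castLE (by decide) b)] := by
    intro j
    rw [d_smul_apply (h.contMDiff_lift_component hκ i _) (hκ.frame.1 _), hκ.apply_dual,
      hz _ (by revert j; decide), mul_zero, sub_zero]
    by_cases hj : j = b
    · rw [if_pos (by rw [hj]), if_pos hj, mul_one]
    · rw [if_neg (fun e => hj (Fin.castLE_injective _ e)), if_neg hj, mul_zero]
  rw [Finset.sum_congr rfl fun j _ => h1 j, Finset.sum_add_distrib, Finset.sum_ite_eq',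
    if_pos (Finset.mem_univ _)] at h0
  linarith

end IsLeafProjection

end Leaves

lemma IsSmooth.contDiff {n k : ℕ} {α : Form n k (EuclideanSpace ℝ (Fin n))} (hα : IsSmooth α) :
    ContDiff ℝ ∞ α := by
  have hid : ∀ y : EuclideanSpace ℝ (Fin n), extChartAt (𝓡 n) y = PartialEquiv.refl _ :=
    fun y => extChartAt_model_space_eq_id _ y
  rw [contDiff_iff_contDiffAt]
  intro y
  have h := isSmooth_iff.1 hα y y (by rw [hid]; exact Set.mem_univ y)
  refine h.congr_of_eventuallyEq (Filter.Eventually.of_forall fun z => ?_)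
  ext v
  rw [chartRep_apply, hid]
  have e : ∀ w, tang (n := n) (m := n) (PartialEquiv.refl (EuclideanSpace ℝ (Fin n))).symm z w =
      w := fun w => DFunLike.congr_fun (tang_id (n := n) z) w
  simp only [e]
  rfl

section Leaves

variable {N : Type*} [TopologicalSpace N] [ChartedSpace (EuclideanSpace ℝ (Fin 7)) N]
  {M : Type*} [TopologicalSpace M] [ChartedSpace (EuclideanSpace ℝ (Fin 5)) M]
  [IsManifold (𝓡 7) ∞ N] [IsManifold (𝓡 5) ∞ M]

/-- The derivative of a function along a curve. -/
lemma hasDerivAt_comp_curve {f : N → ℝ} (hf : ContMDiff (𝓡 7) 𝓘(ℝ, ℝ) ∞ f)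
    {c : EuclideanSpace ℝ (Fin 1) → N} (hc : ContMDiff (𝓡 1) (𝓡 7) ∞ c)
    (e : EuclideanSpace ℝ (Fin 1)) (t : ℝ) :
    HasDerivAt (fun t : ℝ => f (c (t • e)))
      (d (ofFun 7 f) (c (t • e)) ![tang (n := 1) (m := 7) c (t • e) e]) t := by
  have hF : ContMDiff (𝓡 1) 𝓘(ℝ, ℝ) ∞ (fun y => f (c y)) := hf.comp hc
  have h1 : pullback (n := 1) c (d (ofFun 7 f)) = d (ofFun 1 fun y => f (c y)) := by
    rw [← d_pullback hc (isSmooth_ofFun hf)]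
    congr 1
  have h2 : d (ofFun 7 f) (c (t • e)) ![tang (n := 1) (m := 7) c (t • e) e] =
      fderiv ℝ (fun y => f (c y)) (t • e) e := by
    rw [← mfderiv_eq_fderiv]
    refine Eq.trans ?_ (d_ofFun_apply hF (t • e) e)
    rw [← h1, pullback_apply_one]
  rw [h2]
  have h3 : HasFDerivAt (fun y => f (c y)) (fderiv ℝ (fun y => f (c y)) (t • e)) (t • e) :=
    ((contMDiff_iff_contDiff.1 hF).differentiable (by simp) _).hasFDerivAt
  have h4 : HasDerivAt (fun t : ℝ => t • e) e t := by
    simpa using (hasDerivAt_id t).smul_const e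
  exact h3.comp_hasDerivAt t h4

namespace IsLeafProjection

open IsInvariantCoframing (dual)

variable {κ : Fin 7 → Form 7 1 N} {P Q : N → ℝ} {π : N → M} {s : M → N}

lemma curve_vertical (h : IsLeafProjection κ π s) {c : EuclideanSpace ℝ (Fin 1) → N}
    (hc : ContMDiff (𝓡 1) (𝓡 7) ∞ c) {y : M} (hy : ∀ t, π (c t) = y)
    (t e : EuclideanSpace ℝ (Fin 1)) (i : Fin 7) (hi : i < 5) :
    κ i (c t) ![tang (n := 1) (m := 7) c t e] = 0 := by
  refine (h.ker _ _).1 ?_ i hi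
  have h1 := tang_comp (n := 1) (m := 7) (p := 5) t (h.smooth (c t)) (hc t)
  rw [show (fun t => π (c t)) = fun _ => y from funext hy] at h1
  have h2 : tang (n := 1) (m := 5) (fun _ : EuclideanSpace ℝ (Fin 1) => y) t = 0 := mfderiv_const
  rw [h2] at h1
  exact (DFunLike.congr_fun h1 e).symm

/-- The bundle `⟦θ, α₁, α₂⟧` descends to the leaf space. -/
lemma lift_α_dual_β (h : IsLeafProjection κ π s) (hκ : IsInvariantCoframing κ P Q) (x : N)
    {i : Fin 7} (hi : i = 0 ∨ i = 1 ∨ i = 2) {b : Fin 7} (hb : b = 3 ∨ b = 4) :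
    lift κ π s i x ![dual κ x b] = 0 := by
  obtain ⟨c, hc, hc0, hc1, hcπ⟩ := h.path x
  set e : EuclideanSpace ℝ (Fin 1) := EuclideanSpace.single 0 1 with he
  set z : ℝ → EuclideanSpace ℝ (Fin 7) := fun t => tang (n := 1) (m := 7) c (t • e) e with hz
  have hzv : ∀ t, ∀ i : Fin 7, i < 5 → κ i (c (t • e)) ![z t] = 0 :=
    fun t i hi => h.curve_vertical hc hcπ _ _ i hi
  let idx : Fin 2 → Fin 5 := ![3, 4]
  let J : Fin 5 → Fin 7 := Fin.castLE (by decide)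
  let a : Fin 5 → Fin 5 → ℝ → ℝ := fun j b t =>
    d (κ (J j)) (c (t • e)) ![z t, dual κ (c (t • e)) (J b)]
  have hce : Continuous fun t : ℝ => c (t • e) := hc.continuous.comp (by fun_prop)
  have ha : ∀ j b, Continuous (a j b) := by
    intro j b
    -- The components of the velocity are read off from the pullback of the coframing to the line.
    -- This avoids any continuity statement for `z` itself, whose values lie in varying tangent
    -- spaces.
    have hζ : ∀ k : Fin 7, Continuous fun t : ℝ => κ k (c (t • e)) ![z t] := by
      intro k
      have h1 := ((hκ.frame.1 k).pullback hc).contDiff.continuous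
      have h2 : Continuous fun t : ℝ => pullback (n := 1) c (κ k) (t • e) ![e] := by
        have h3 : Continuous fun t : ℝ => pullback (n := 1) c (κ k) (t • e) :=
          h1.comp (by fun_prop)
        exact continuous_iff_continuousAt.2 fun t =>
          ((ContinuousAlternatingMap.apply ℝ (EuclideanSpace ℝ (Fin 1)) ℝ ![e]).continuous.comp
            h3).continuousAt
      refine h2.congr fun t => ?_
      rw [pullback_apply_one]
    have h4 : a j b = fun t => ∑ k, κ k (c (t • e)) ![z t] *
        d (κ (J j)) (c (t • e)) ![dual κ (c (t • e)) k, dual κ (c (t • e)) (J b)] := by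
      funext t
      rw [← cov_two_sum_left, sum_coframe_dualVec (hκ.frame.2 _)]
    rw [h4]
    refine continuous_finsetSum _ fun k _ => (hζ k).mul ?_
    have h5 := (contMDiff_frame_component hκ.frame (hκ.frame.1 (J j)).d ![k, J b]).continuous
    refine (h5.comp hce).congr fun t => ?_
    refine congrArg (d (κ (J j)) (c (t • e))) ?_
    funext a; fin_cases a <;> rfl
  -- Here invariance is used: the derivatives of `θ, α₁, α₂` do not couple into the equations for
  -- the `β` components, which therefore form a closed homogeneous system of size 2.
  have h00 : ∀ t b, (b = 3 ∨ b = 4) → a 0 b t = 0 ∧ a 1 b t = 0 ∧ a 2 b t = 0 := by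
    intro t b hb
    have hne : ∀ k : Fin 7, (k = 0 ∨ k = 1 ∨ k = 2) →
        κ k (c (t • e)) ![dual κ (c (t • e)) (J b)] = 0 := by
      intro k hk
      refine hκ.apply_dual_of_ne _ ?_
      rcases hk with rfl | rfl | rfl <;> rcases hb with rfl | rfl <;> decide
    refine ⟨?_, hκ.d_α _ _ _ (hzv t) (hne 0 (by simp)) (hne 1 (by simp)) (hne 2 (by simp))⟩
    refine (hκ.d_θ _ _ _ (hzv t 0 (by decide)) (hne 0 (by simp))).trans ?_
    rw [wedge_one_one_apply, wedge_one_one_apply]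
    simp [hzv t 1 (by decide), hzv t 2 (by decide), hzv t 3 (by decide), hzv t 4 (by decide),
      hne 1, hne 2]
  have hode := eq_zero_of_linear_ode
    (g := fun k t => lift κ π s i (c (t • e)) ![dual κ (c (t • e)) (J (idx k))])
    (a := fun k k' t => -a (idx k') (idx k) t) (fun k k' => (ha _ _).neg) (fun k t => by
      have h1 := hasDerivAt_comp_curve (h.contMDiff_lift_component hκ i (J (idx k))) hc e t
      rw [h.d_lift_component hκ (hzv t) i (idx k)] at h1
      convert h1 using 1
      have h2 := h00 t (idx k) (by fin_cases k; exacts [.inl rfl, .inr rfl])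
      change _ = -∑ j : Fin 5, lift κ π s i (c (t • e)) ![dual κ (c (t • e)) (J j)] *
        a j (idx k) t
      rw [Fin.sum_univ_five, h2.1, h2.2.1, h2.2.2, Fin.sum_univ_two]
      simp only [idx, Matrix.cons_val_zero, Matrix.cons_val_one]
      ring) (fun k => by
      -- At time 0 the curve is on the section, where the lifted form equals `κ i`, and that form
      -- has no `β` component.
      have hi5 : i < 5 := by rcases hi with rfl | rfl | rfl <;> decide
      simp only [zero_smul]
      rw [hc0, h.lift_section _ hi5]
      refine hκ.apply_dual_of_ne _ ?_
      rcases hi with rfl | rfl | rfl <;> fin_cases k <;> decide)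
  rcases hb with rfl | rfl
  · have := hode 0
    simp only [one_smul, hc1] at this
    exact this
  · have := hode 1
    simp only [one_smul, hc1] at this
    exact this

lemma lift_swap (i : Fin 7) :
    lift (fun i => κ (swapIndex i)) π s i = lift κ π s (swapIndex i) := rfl

lemma lift_β_dual_α (h : IsLeafProjection κ π s) (hκ : IsInvariantCoframing κ P Q) (x : N)
    {i : Fin 7} (hi : i = 0 ∨ i = 3 ∨ i = 4) {b : Fin 7} (hb : b = 1 ∨ b = 2) :
    lift κ π s i x ![dual κ x b] = 0 := by
  have := h.swap.lift_α_dual_β hκ.swap x (i := swapIndex i) (b := swapIndex b)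
    (by rcases hi with rfl | rfl | rfl <;> decide) (by rcases hb with rfl | rfl <;> decide)
  rw [dual_swap hκ, lift_swap, show swapIndex (swapIndex i) = i from swapIndex.left_inv i,
    show swapIndex (swapIndex b) = b from swapIndex.left_inv b] at this
  exact this

lemma lift_dual_vertical (h : IsLeafProjection κ π s) (hκ : IsInvariantCoframing κ P Q) (x : N)
    (i : Fin 7) {b : Fin 7} (hb : 5 ≤ b) : lift κ π s i x ![dual κ x b] = 0 :=
  h.lift_vertical (dual_vertical hκ x hb) i

/-- The lift of `θ` lies in `⟦θ, α₁, α₂⟧` and also in `⟦θ, β₁, β₂⟧`, hence in their intersection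
`⟦θ⟧`. -/
lemma lift_zero_dual (h : IsLeafProjection κ π s) (hκ : IsInvariantCoframing κ P Q) (x : N)
    {b : Fin 7} (hb : b ≠ 0) : lift κ π s 0 x ![dual κ x b] = 0 := by
  by_cases h1 : b = 1 ∨ b = 2
  · exact h.lift_β_dual_α hκ x (.inl rfl) h1
  by_cases h2 : b = 3 ∨ b = 4
  · exact h.lift_α_dual_β hκ x (.inl rfl) h2
  · exact h.lift_dual_vertical hκ x 0 (by omega)

lemma lift_α_dual (h : IsLeafProjection κ π s) (hκ : IsInvariantCoframing κ P Q) (x : N)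
    {i b : Fin 7} (hi : i = 1 ∨ i = 2) (hb : 3 ≤ b) : lift κ π s i x ![dual κ x b] = 0 := by
  by_cases h2 : b = 3 ∨ b = 4
  · exact h.lift_α_dual_β hκ x (.inr hi) h2
  · exact h.lift_dual_vertical hκ x i (by omega)

/-- Values of the lifted forms in terms of their components. -/
lemma lift_apply (h : IsLeafProjection κ π s) (hκ : IsInvariantCoframing κ P Q) (x : N)
    (i : Fin 7) (v : EuclideanSpace ℝ (Fin 7)) :
    lift κ π s i x ![v] = ∑ j, lift κ π s i x ![dual κ x j] * κ j x ![v] := by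
  conv_lhs => rw [cov_one_eq_sum (hκ.frame.2 x) (lift κ π s i x)]
  rw [ContinuousAlternatingMap.sum_apply]
  rfl

lemma lift_zero_apply (h : IsLeafProjection κ π s) (hκ : IsInvariantCoframing κ P Q) (x : N)
    (v : EuclideanSpace ℝ (Fin 7)) :
    lift κ π s 0 x ![v] = lift κ π s 0 x ![dual κ x 0] * κ 0 x ![v] := by
  rw [h.lift_apply hκ, Finset.sum_eq_single 0]
  · intro j _ hj
    rw [h.lift_zero_dual hκ x hj, zero_mul]
  · simp

/-- A relation on the leaf space, pulled back by `π` to a point of the section, becomes the same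
relation among the original forms by `lift_section`. -/
lemma linearIndependent_desc (h : IsLeafProjection κ π s) (hκ : IsInvariantCoframing κ P Q)
    (y : M) : LinearIndependent ℝ (fun i : Fin 5 => desc κ s (Fin.castLE (by decide) i) y) := by
  rw [Fintype.linearIndependent_iff]
  intro g hg
  have h5 : ∀ i : Fin 5, (Fin.castLE (by decide) i : Fin 7) < 5 := by decide
  refine Fintype.linearIndependent_iff.1 ((hκ.frame.2 (s y)).comp _
    (Fin.castLE_injective (by decide : 5 ≤ 7))) g ?_
  ext v
  have h1 := DFunLike.congr_fun hg fun i => tang (n := 7) (m := 5) π (s y) (v i)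
  rw [ContinuousAlternatingMap.sum_apply] at h1 ⊢
  refine Eq.trans (Finset.sum_congr rfl fun i _ => ?_) h1
  have h2 : (κ (Fin.castLE (by decide) i) (s y)) v = lift κ π s (Fin.castLE (by decide) i) (s y) v :=
    by rw [h.lift_section y (h5 i)]
  rw [ContinuousAlternatingMap.smul_apply, ContinuousAlternatingMap.smul_apply]
  rw [Function.comp_apply, h2, lift, pullback_apply, h.proj_section]

lemma desc_frame (h : IsLeafProjection κ π s) (hκ : IsInvariantCoframing κ P Q) :
    IsFrame (fun i : Fin 5 => desc κ s (Fin.castLE (by decide) i)) :=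
  ⟨fun i => h.isSmooth_desc hκ _, h.linearIndependent_desc hκ⟩

/-- The lifted forms make up a coframing, together with the last two forms of the original one. -/
def liftFrame (κ : Fin 7 → Form 7 1 N) (π : N → M) (s : M → N) (i : Fin 7) : Form 7 1 N :=
  if i < 5 then lift κ π s i else κ i

/-- A vector annihilated by the lifts projects to zero, because the descended forms are a coframe
downstairs. It is then vertical, and the last two forms detect it. -/
lemma liftFrame_frame (h : IsLeafProjection κ π s) (hκ : IsInvariantCoframing κ P Q) :
    IsFrame (liftFrame κ π s) := by
  refine ⟨fun i => ?_, fun x => ?_⟩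
  · unfold liftFrame
    split_ifs
    · exact h.isSmooth_lift hκ i
    · exact hκ.frame.1 i
  · refine linearIndependent_of_forall_coframe fun v hv' => ?_
    have h1 : tang (n := 7) (m := 5) π x v = 0 := by
      refine eq_zero_of_forall_coframe (h.linearIndependent_desc hκ (π x)) fun i => ?_
      have := hv' (Fin.castLE (by decide) i)
      rw [liftFrame, if_pos (show (Fin.castLE (by decide) i : Fin 7) < 5 from by
        clear this; revert i; decide), lift, pullback_apply_one] at this
      exact this
    refine eq_zero_of_forall_coframe (hκ.frame.2 x) fun i => ?_
    by_cases hi : i < 5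
    · exact (h.ker x v).1 h1 i hi
    · have := hv' i
      rwa [liftFrame, if_neg hi] at this

/-- A preimage of `w` is the vector whose components in the frame dual to `liftFrame` are the values
of the descended forms on `w`, with the last two components zero. -/
lemma surjective_tang (h : IsLeafProjection κ π s) (hκ : IsInvariantCoframing κ P Q) (x : N) :
    Function.Surjective (tang (n := 7) (m := 5) π x) := by
  intro w
  refine ⟨∑ j, (if j < 5 then desc κ s j (π x) ![w] else 0) •
    dualVec (fun a => liftFrame κ π s a x) j, ?_⟩
  refine eq_of_forall_coframe (h.linearIndependent_desc hκ (π x)) fun i => ?_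
  rw [← pullback_apply_one]
  have hi : (Fin.castLE (by decide) i : Fin 7) < 5 := by revert i; decide
  have e : pullback (n := 7) π (desc κ s (Fin.castLE (by decide) i)) =
      liftFrame κ π s (Fin.castLE (by decide) i) := (if_pos hi).symm
  rw [e, cov_one_sum]
  simp only [coframe_dualVec ((h.liftFrame_frame hκ).2 x)]
  simp [hi]

end IsLeafProjection

end Leaves

/-! ### Pointwise algebra of contact forms and characteristic points -/

section Contact

variable {η : Fin 5 → Cov 5 1}

/-- A `4`-covector on a `5`-dimensional space that vanishes on the annihilator of the first
element of a coframe is a multiple of that element. -/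
lemma mem_zeroMod_of_apply_dual_eq_zero (hη : LinearIndependent ℝ η) {β : Cov 5 4}
    (hβ : β (fun i : Fin 4 => dualVec η i.succ) = 0) :
    β ∈ zeroMod (Submodule.span ℝ {η 0}) 3 := by
  -- The cofactor is the contraction of `β` with the vector dual to `η 0`. The difference `β - η 0 ∧
  -- γ` vanishes on basis tuples containing this vector by construction, and on the only other
  -- tuple, up to order, by hypothesis.
  set γ : Cov 5 3 := ContinuousAlternatingMap.curryLeft (n := 3) β (dualVec η 0) with hγ
  have key : β = wedge (η 0) γ := by
    rw [← sub_eq_zero]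
    set β' : Cov 5 4 := β - wedge (η 0) γ with hβ'
    have hker : ∀ i : Fin 5, i ≠ 0 → η 0 ![dualVec η i] = 0 := fun i hi => by
      rw [coframe_dualVec hη, if_neg hi.symm]
    have h0 : ∀ J : Fin 4 → Fin 5, J 0 = 0 → Function.Injective J →
        β' (fun i => dualVec η (J i)) = 0 := by
      intro J hJ0 hJ
      have h1 := wedge_one_apply_of_eq_zero (η 0) γ (dualVec η 0)
        (fun i : Fin 3 => dualVec η (J i.succ)) fun i => hker _ fun e =>
          absurd (hJ (e.trans hJ0.symm)) (Fin.succ_ne_zero i)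
      have e : (fun i => dualVec η (J i)) =
          Fin.cons (dualVec η 0) (fun i : Fin 3 => dualVec η (J i.succ)) := by
        funext i
        refine Fin.cases ?_ (fun i => ?_) i
        · rw [hJ0]; rfl
        · rfl
      rw [hβ', ContinuousAlternatingMap.sub_apply, e]
      have h2 : wedge (η 0) γ (Fin.cons (dualVec η 0) (fun i : Fin 3 => dualVec η (J i.succ))) =
          η 0 ![dualVec η 0] * γ (fun i : Fin 3 => dualVec η (J i.succ)) := h1
      erw [h2]
      rw [coframe_dualVec hη, if_pos rfl, one_mul]
      exact sub_self _
    have hb : ∃ b : Module.Basis (Fin 5) ℝ (EuclideanSpace ℝ (Fin 5)), ∀ i, b i = dualVec η i := by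
      have hli : LinearIndependent ℝ (dualVec η) := by
        rw [Fintype.linearIndependent_iff]
        intro g hg i
        have h1 := cov_one_sum (η i) Finset.univ g (dualVec η)
        rw [hg] at h1
        simp only [coframe_dualVec hη] at h1
        have h2 : η i ![0] = 0 := (η i).map_coord_zero 0 rfl
        rw [h2] at h1
        simpa using h1.symm
      exact ⟨basisOfLinearIndependentOfCardEqFinrank hli (by simp), fun i => by simp⟩
    obtain ⟨b, hb⟩ := hb
    apply ContinuousAlternatingMap.toAlternatingMap_injective
    refine Module.Basis.ext_alternating b fun J hJ => ?_
    simp only [hb]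
    change β' (fun i => dualVec η (J i)) = 0
    by_cases hz : ∃ i, J i = 0
    · obtain ⟨i, hi⟩ := hz
      have h1 := h0 (J ∘ Equiv.swap 0 i) (by simp [hi]) (hJ.comp (Equiv.injective _))
      have h2 := cov_perm β' (fun i => dualVec η (J i)) (Equiv.swap 0 i)
      have h3 : (fun i => dualVec η (J i)) ∘ (Equiv.swap 0 i) =
        fun a => dualVec η ((J ∘ Equiv.swap 0 i) a) := rfl
      rw [h3, h1] at h2
      rcases Int.units_eq_one_or (Equiv.Perm.sign (Equiv.swap 0 i)) with h4 | h4 <;>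
        simpa [h4] using h2.symm
    · push Not at hz
      have h1 : ∀ i, ∃ k : Fin 4, k.succ = J i := fun i => Fin.exists_succ_eq.2 (hz i)
      choose σ hσ using h1
      have hσi : Function.Injective σ := fun a c hac => hJ (by rw [← hσ, ← hσ, hac])
      have h2 := cov_perm β' (fun i : Fin 4 => dualVec η i.succ)
        (Equiv.ofBijective σ (Finite.injective_iff_bijective.1 hσi))
      have h3 : (fun i : Fin 4 => dualVec η i.succ) ∘
          (Equiv.ofBijective σ (Finite.injective_iff_bijective.1 hσi)) =
          fun i => dualVec η (J i) := by
        funext i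
        simp [hσ]
      rw [h3] at h2
      rw [h2, hβ', ContinuousAlternatingMap.sub_apply, hβ]
      have h4 : wedge (η 0) γ (fun i : Fin 4 => dualVec η i.succ) = 0 :=
        wedge_apply_eq_zero (η 0) γ (fun i : Fin 4 => dualVec η i.succ) fun f => by
          rw [← hker (f 0).succ (Fin.succ_ne_zero _)]
          congr 1
          funext a; fin_cases a; rfl
      erw [h4]
      simp
  rw [key]
  exact Submodule.subset_span ⟨η 0, Submodule.mem_span_singleton_self _, γ, rfl⟩

/-- Elements of the ideal generated by a covector vanish on its annihilator. -/
lemma eval_zeroMod_eq_zero {n k : ℕ} {a : Cov n 1} {β : Cov n (1 + k)}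
    (hβ : β ∈ zeroMod (Submodule.span ℝ {a}) k) {v : Fin (1 + k) → EuclideanSpace ℝ (Fin n)}
    (hv : ∀ i, a ![v i] = 0) : β v = 0 := by
  unfold zeroMod at hβ
  induction hβ using Submodule.span_induction with
  | mem β h =>
    obtain ⟨κ, hκ, γ, rfl⟩ := h
    refine wedge_apply_eq_zero _ _ _ fun f => ?_
    have e : v ∘ f = ![v (f 0)] := by funext i; fin_cases i; rfl
    rw [e]
    exact eval_span_eq_zero (s := {a}) (by rintro _ rfl; exact hv _) κ hκ
  | zero => rfl
  | add a b _ _ h₁ h₂ => rw [ContinuousAlternatingMap.add_apply, h₁, h₂, add_zero]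
  | smul r a _ h => rw [ContinuousAlternatingMap.smul_apply, h, smul_zero]

/-- Among the six pairings of four dual vectors only `(12)(34)` and `(34)(12)` survive, each with
value `pq`. -/
lemma wedge_self_apply_dual (hη : LinearIndependent ℝ η) {δ : Cov 5 2} {p q : ℝ}
    (hδ : ∀ u v, η 0 ![u] = 0 → η 0 ![v] = 0 → δ ![u, v] =
      p * wedge (η 1) (η 2) ![u, v] + q * wedge (η 3) (η 4) ![u, v]) :
    wedge δ δ (fun i : Fin 4 => dualVec η i.succ) = 2 * (p * q) := by
  have hker : ∀ i : Fin 5, i ≠ 0 → η 0 ![dualVec η i] = 0 := fun i hi => by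
    rw [coframe_dualVec hη, if_neg hi.symm]
  have e : (fun i : Fin 4 => dualVec η i.succ) =
      ![dualVec η 1, dualVec η 2, dualVec η 3, dualVec η 4] := by
    funext i; fin_cases i <;> rfl
  have h2 : ∀ i j : Fin 5, i ≠ 0 → j ≠ 0 → δ ![dualVec η i, dualVec η j] =
      p * ((if (1 : Fin 5) = i then 1 else 0) * (if (2 : Fin 5) = j then 1 else 0) -
        (if (1 : Fin 5) = j then 1 else 0) * (if (2 : Fin 5) = i then 1 else 0)) +
      q * ((if (3 : Fin 5) = i then 1 else 0) * (if (4 : Fin 5) = j then 1 else 0) -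
        (if (3 : Fin 5) = j then 1 else 0) * (if (4 : Fin 5) = i then 1 else 0)) := by
    intro i j hi hj
    rw [hδ _ _ (hker i hi) (hker j hj), wedge_one_one_apply, wedge_one_one_apply]
    simp only [Matrix.cons_val_zero, Matrix.cons_val_one, coframe_dualVec hη]
  rw [e]
  refine (wedge_two_two_apply δ δ _ _ _ _).trans ?_
  rw [h2 1 2, h2 3 4, h2 1 3, h2 2 4, h2 1 4, h2 2 3]
  · simp
    ring
  all_goals decide

lemma wedge_contact_ne_zero (hη : LinearIndependent ℝ η) {δ : Cov 5 2} {p q : ℝ} (hp : p ≠ 0)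
    (hq : q ≠ 0) (hδ : ∀ u v, η 0 ![u] = 0 → η 0 ![v] = 0 → δ ![u, v] =
      p * wedge (η 1) (η 2) ![u, v] + q * wedge (η 3) (η 4) ![u, v]) :
    wedge (η 0) (wedge δ δ) ≠ 0 := by
  intro h
  have h1 := wedge_one_apply_of_eq_zero (η 0) (wedge δ δ) (dualVec η 0)
    (fun i : Fin 4 => dualVec η i.succ) fun i => by
      rw [coframe_dualVec hη, if_neg (Fin.succ_ne_zero i).symm]
  rw [h, coframe_dualVec hη, if_pos rfl, one_mul, wedge_self_apply_dual hη hδ] at h1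
  have : (0 : ℝ) = 2 * (p * q) := h1
  exact mul_ne_zero two_ne_zero (mul_ne_zero hp hq) this.symm

/-- The square of `c₀ δ + c₁ η₁∧η₂` is `2 (c₀ p + c₁) c₀ q` times `η₁∧η₂∧η₃∧η₄` modulo `η₀`. As `q ≠
0`, it vanishes on the lines `c₀ = 0` and `c₁ = -p c₀`, which explains the two spanning vectors. -/
lemma exists_characteristic_lines (hη : LinearIndependent ℝ η) {δ : Cov 5 2} {p q : ℝ}
    (hq : q ≠ 0) (hδ : ∀ u v, η 0 ![u] = 0 → η 0 ![v] = 0 → δ ![u, v] =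
      p * wedge (η 1) (η 2) ![u, v] + q * wedge (η 3) (η 4) ![u, v]) :
    ∃ u v : Fin 2 → ℝ, LinearIndependent ℝ ![u, v] ∧ ∀ c : Fin 2 → ℝ,
      wedge (c 0 • δ + c 1 • wedge (η 1) (η 2) : Cov 5 2)
          (c 0 • δ + c 1 • wedge (η 1) (η 2) : Cov 5 2) ∈
          zeroMod (Submodule.span ℝ {η 0}) 3 ↔
        c ∈ Submodule.span ℝ {u} ∨ c ∈ Submodule.span ℝ {v} := by
  refine ⟨![0, 1], ![1, -p], ?_, fun c => ?_⟩
  · rw [LinearIndependent.pair_iff]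
    intro s t hst
    have h0 := congrFun hst 0
    have h1 := congrFun hst 1
    simp at h0 h1
    subst h0
    simpa using h1
  have hδ' : ∀ u v, η 0 ![u] = 0 → η 0 ![v] = 0 →
      (c 0 • δ + c 1 • wedge (η 1) (η 2) : Cov 5 2) ![u, v] =
      (c 0 * p + c 1) * wedge (η 1) (η 2) ![u, v] + (c 0 * q) * wedge (η 3) (η 4) ![u, v] := by
    intro u v hu hv
    rw [ContinuousAlternatingMap.add_apply, ContinuousAlternatingMap.smul_apply, hδ u v hu hv]
    erw [ContinuousAlternatingMap.smul_apply]
    simp only [smul_eq_mul]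
    ring
  have hval := wedge_self_apply_dual hη hδ'
  have h1 : wedge (c 0 • δ + c 1 • wedge (η 1) (η 2) : Cov 5 2)
      (c 0 • δ + c 1 • wedge (η 1) (η 2) : Cov 5 2) ∈ zeroMod (Submodule.span ℝ {η 0}) 3 ↔
      2 * ((c 0 * p + c 1) * (c 0 * q)) = 0 := by
    rw [← hval]
    refine ⟨fun h => eval_zeroMod_eq_zero (k := 3) h fun i => ?_,
      fun h => mem_zeroMod_of_apply_dual_eq_zero hη h⟩
    exact (coframe_dualVec hη _ _).trans (if_neg (Fin.succ_ne_zero _).symm)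
  rw [h1, Submodule.mem_span_singleton, Submodule.mem_span_singleton]
  constructor
  · intro h
    have h2 : (c 0 * p + c 1) * (c 0 * q) = 0 := by linarith
    rcases mul_eq_zero.1 h2 with h3 | h3
    · refine .inr ⟨c 0, ?_⟩
      funext i
      fin_cases i
      · simp
      · simp; linarith
    · have h4 : c 0 = 0 := (mul_eq_zero.1 h3).resolve_right hq
      refine .inl ⟨c 1, ?_⟩
      funext i
      fin_cases i
      · simp [h4]
      · simp
  · rintro (⟨a, rfl⟩ | ⟨a, rfl⟩) <;> simp

end Contact

/-! ### A coframing criterion for hyperbolic Monge-Ampère systems -/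

section MongeAmpereSystems

variable {M : Type*} [TopologicalSpace M] [ChartedSpace (EuclideanSpace ℝ (Fin 5)) M]
  [IsManifold (𝓡 5) ∞ M]

/-- A criterion for hyperbolic Monge-Ampère systems in terms of a coframing. -/
lemma isHyperbolicMA_of_frame {η : Fin 5 → Form 5 1 M} (hη : IsFrame η) {P Q : M → ℝ}
    (hP : ∀ y, P y ≠ 0) (hQ : ∀ y, Q y ≠ 0)
    (hd : ∀ y u v, η 0 y ![u] = 0 → η 0 y ![v] = 0 → d (η 0) y ![u, v] =
      P y * wedge (η 1 y) (η 2 y) ![u, v] + Q y * wedge (η 3 y) (η 4 y) ![u, v])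
    (I : EDS 5 M) (hI : ∀ k (α : Form 5 k M), α ∈ I.carrier k ↔
      AlgIdeal (gens {η 0} {fwedge (η 1) (η 2), fwedge (η 3) (η 4)}) k α) :
    IsHyperbolicMA I := by
  intro p
  -- The generators are global, so the whole manifold serves as the neighbourhood. As an open subset
  -- it is a type of its own, and all data are transported along its inclusion.
  have hv : ContMDiff (𝓡 5) (𝓡 5) ∞ (Subtype.val : (⊤ : TopologicalSpace.Opens M) → M) :=
    contMDiff_subtype_val
  have hv' := fun x => tang_subtype_val_bijective (n := 5) (⊤ : TopologicalSpace.Opens M) x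
  set η' : Fin 5 → Form 5 1 (⊤ : TopologicalSpace.Opens M) := fun i =>
    pullback (n := 5) Subtype.val (η i) with hη'
  have hfr : IsFrame η' := hη.pullback hv fun x => (hv' x).2
  have hd' : ∀ y u v, η' 0 y ![u] = 0 → η' 0 y ![v] = 0 → d (η' 0) y ![u, v] =
      P y * wedge (η' 1 y) (η' 2 y) ![u, v] + Q y * wedge (η' 3 y) (η' 4 y) ![u, v] := by
    intro y u v hu hv0
    simp only [hη', pullback_apply_one] at hu hv0
    simp only [hη']
    rw [d_pullback hv (hη.1 0), pullback_apply_two, hd _ _ _ hu hv0, wedge_one_one_apply,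
      wedge_one_one_apply, wedge_one_one_apply, wedge_one_one_apply]
    simp [pullback_apply_one]
  refine ⟨⊤, trivial, η' 0, fwedge (η' 1) (η' 2), hfr.1 0, (hfr.1 1).fwedge (hfr.1 2),
    fun x => wedge_contact_ne_zero (hfr.2 x) (hP x) (hQ x) (hd' x), ?_,
    fun x => exists_characteristic_lines (hfr.2 x) (hQ x) (hd' x)⟩
  have hker : ∀ (x : (⊤ : TopologicalSpace.Opens M)) (i : Fin 5), i ≠ 0 →
      η' 0 x ![dualVec (fun a => η' a x) i] = 0 := fun x i hi => by
    rw [coframe_dualVec (hfr.2 x), if_neg hi.symm]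
  -- Smoothness of `P` and `Q` is not assumed; they are components of the smooth form `d (η 0)` in
  -- the coframing.
  have hP' : ContMDiff (𝓡 5) 𝓘(ℝ, ℝ) ∞
      (fun x : (⊤ : TopologicalSpace.Opens M) => P x) := by
    refine (contMDiff_frame_component hfr (hfr.1 0).d ![1, 2]).congr fun x => ?_
    have := hd' x _ _ (hker x 1 (by decide)) (hker x 2 (by decide))
    rw [wedge_one_one_apply, wedge_one_one_apply] at this
    simp only [Matrix.cons_val_zero, Matrix.cons_val_one, coframe_dualVec (hfr.2 x)] at this
    simp at this
    rw [← this]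
    congr 1
    funext a; fin_cases a <;> rfl
  have hQ' : ContMDiff (𝓡 5) 𝓘(ℝ, ℝ) ∞
      (fun x : (⊤ : TopologicalSpace.Opens M) => Q x) := by
    refine (contMDiff_frame_component hfr (hfr.1 0).d ![3, 4]).congr fun x => ?_
    have := hd' x _ _ (hker x 3 (by decide)) (hker x 4 (by decide))
    rw [wedge_one_one_apply, wedge_one_one_apply] at this
    simp only [Matrix.cons_val_zero, Matrix.cons_val_one, coframe_dualVec (hfr.2 x)] at this
    simp at this
    rw [← this]
    congr 1
    funext a; fin_cases a <;> rfl
  -- `dθ - P η₁∧η₂ - Q η₃∧η₄` is a multiple of `θ`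
  have hrest : AlgIdeal (gens {η' 0} ∅) 2 (d (η' 0) + ((fun x : (⊤ : TopologicalSpace.Opens M) =>
      (-1 : ℝ) • ((P x) • fwedge (η' 1) (η' 2) x)) +
      fun x : (⊤ : TopologicalSpace.Opens M) => (-1 : ℝ) • ((Q x) • fwedge (η' 3) (η' 4) x))) := by
    have hs : ∀ {f : M → ℝ} {β : Form 5 2 (⊤ : TopologicalSpace.Opens M)},
        ContMDiff (𝓡 5) 𝓘(ℝ, ℝ) ∞ (fun x : (⊤ : TopologicalSpace.Opens M) => f x) →
        IsSmooth β → IsSmooth (fun x : (⊤ : TopologicalSpace.Opens M) => (-1 : ℝ) • ((f x) • β x)) :=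
      fun hf hβ =>
      IsSmooth.smul (f := fun _ => -1) contMDiff_const (hβ.smul hf)
    refine AlgIdeal.of_components_two hfr ((hfr.1 0).d.add ((hs hP' ((hfr.1 1).fwedge
      (hfr.1 2))).add (hs hQ' ((hfr.1 3).fwedge (hfr.1 4))))) fun i j hij => ?_
    by_cases hi : i = 0
    · subst hi
      exact .inl (AlgIdeal.wedge (.of (k := 1) rfl) (hfr.1 j))
    · refine .inr fun x => ?_
      have hj : j ≠ 0 := by rintro rfl; exact absurd hij (by simp)
      have := hd' x _ _ (hker x i hi) (hker x j hj)
      simp only [Pi.add_apply, ContinuousAlternatingMap.add_apply,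
        ContinuousAlternatingMap.smul_apply, this, fwedge, smul_eq_mul]
      ring
  intro k α
  have e1 : AlgIdeal (I.pull (Subtype.val : (⊤ : TopologicalSpace.Opens M) → M)) k α ↔
      AlgIdeal (gens {η' 0} {fwedge (η' 1) (η' 2), fwedge (η' 3) (η' 4)}) k α := by
    have e2 : gens {η' 0} {fwedge (η' 1) (η' 2), fwedge (η' 3) (η' 4)} =
        pullSet (n := 5) (Subtype.val : (⊤ : TopologicalSpace.Opens M) → M)
          (gens {η 0} {fwedge (η 1) (η 2), fwedge (η 3) (η 4)}) := by
      rw [pullSet_gens, Set.image_singleton, Set.image_pair, pullback_fwedge, pullback_fwedge]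
    rw [e2]
    constructor
    · exact fun h => h.pullSet_mono hv (S := I.carrier) fun k β hβ => (hI k β).1 hβ
    · intro h
      refine h.trans ?_
      rintro k _ ⟨β, hβ, rfl⟩
      exact .of ⟨β, (hI k β).2 (.of hβ), rfl⟩
  rw [e1]
  set T : GradedSet 5 (⊤ : TopologicalSpace.Opens M) :=
    gens {η' 0} {fwedge (η' 1) (η' 2), fwedge (η' 3) (η' 4)} with hT
  set T' : GradedSet 5 (⊤ : TopologicalSpace.Opens M) :=
    gens {η' 0} {d (η' 0), fwedge (η' 1) (η' 2)} with hT'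
  have ha : AlgIdeal T 1 (η' 0) := .of (k := 1) rfl
  have hb : AlgIdeal T 2 (fwedge (η' 1) (η' 2)) := .of (k := 2) (.inl rfl)
  have hc : AlgIdeal T 2 (fwedge (η' 3) (η' 4)) := .of (k := 2) (.inr rfl)
  have ha' : AlgIdeal T' 1 (η' 0) := .of (k := 1) rfl
  have hb' : AlgIdeal T' 2 (d (η' 0)) := .of (k := 2) (.inl rfl)
  have hc' : AlgIdeal T' 2 (fwedge (η' 1) (η' 2)) := .of (k := 2) (.inr rfl)
  have hrT : ∀ S : GradedSet 5 (⊤ : TopologicalSpace.Opens M), AlgIdeal S 1 (η' 0) →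
      ∀ k, ∀ β ∈ gens {η' 0} (∅ : Set (Form 5 2 (⊤ : TopologicalSpace.Opens M))) k,
        AlgIdeal S k β := fun S hS =>
    forall_gens_iff (P := fun k β => AlgIdeal S k β).2 ⟨by rintro _ rfl; exact hS, by simp⟩
  constructor
  · refine fun h => h.trans (forall_gens_iff (P := fun k β => AlgIdeal T' k β).2 ⟨?_, ?_⟩)
    · rintro _ rfl; exact ha'
    · rintro _ (rfl | rfl)
      · exact hc'
      -- Since `Q` has no zeros, the structure equation can be solved for `η₃∧η₄`. This lets `dθ`
      -- replace the second product among the generators.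
      · have h1 := (((hrest.trans (hrT T' ha')).const_smul (-1)).add (hb'.add
          ((hc'.smul hP').const_smul (-1)))).smul (f := fun x => (Q x)⁻¹)
          (hQ'.inv₀ fun x => hQ x)
        convert h1 using 1
        funext x
        simp only [Pi.add_apply, smul_add, smul_smul]
        match_scalars <;> field_simp [hQ x] <;> ring
  · refine fun h => h.trans (forall_gens_iff (P := fun k β => AlgIdeal T k β).2 ⟨?_, ?_⟩)
    · rintro _ rfl; exact ha
    · rintro _ (rfl | rfl)
      · have h1 := (hrest.trans (hrT T ha)).add ((hb.smul hP').add (hc.smul hQ'))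
        convert h1 using 1
        funext x
        simp only [Pi.add_apply]
        module
      · exact hb

end MongeAmpereSystems

/-! ### The Monge-Ampère system on the leaf space -/

section LeafSystems

variable {N : Type*} [TopologicalSpace N] [ChartedSpace (EuclideanSpace ℝ (Fin 7)) N]
  {M : Type*} [TopologicalSpace M] [ChartedSpace (EuclideanSpace ℝ (Fin 5)) M]
  [IsManifold (𝓡 7) ∞ N] [IsManifold (𝓡 5) ∞ M]

namespace IsLeafProjection

open IsInvariantCoframing (dual system mem_θ mem_αα mem_ββ system_swap pullSet_system)

variable {κ : Fin 7 → Form 7 1 N} {P Q : N → ℝ} {π : N → M} {s : M → N}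

lemma lift_zero_mem (h : IsLeafProjection κ π s) (hκ : IsInvariantCoframing κ P Q) :
    AlgIdeal (system κ) 1 (lift κ π s 0) := by
  refine AlgIdeal.of_components_one hκ.frame (h.isSmooth_lift hκ 0) fun i => ?_
  by_cases hi : i = 0
  · subst hi; exact .inl mem_θ
  · exact .inr fun x => h.lift_zero_dual hκ x hi

lemma lift_αα_mem (h : IsLeafProjection κ π s) (hκ : IsInvariantCoframing κ P Q) :
    AlgIdeal (system κ) 2 (fwedge (lift κ π s 1) (lift κ π s 2)) := by
  refine AlgIdeal.of_components_two hκ.frame ((h.isSmooth_lift hκ 1).fwedge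
    (h.isSmooth_lift hκ 2)) fun i j hij => ?_
  by_cases hi : i = 0
  · subst hi; exact .inl (mem_θ.wedge (hκ.frame.1 j))
  by_cases h1 : i = 1 ∧ j = 2
  · obtain ⟨rfl, rfl⟩ := h1; exact .inl mem_αα
  refine .inr fun x => (wedge_one_one_apply _ _ _).trans ?_
  have hj : 3 ≤ j := by omega
  simp only [Matrix.cons_val_zero, Matrix.cons_val_one]
  rw [h.lift_α_dual hκ x (.inl rfl) hj, h.lift_α_dual hκ x (.inr rfl) hj]
  ring

lemma liftFrame_lt {i : Fin 7} (hi : i < 5) : liftFrame κ π s i = lift κ π s i := if_pos hi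

lemma lift_zero_dual_ne_zero (h : IsLeafProjection κ π s) (hκ : IsInvariantCoframing κ P Q)
    (x : N) : lift κ π s 0 x ![dual κ x 0] ≠ 0 := by
  intro h0
  have h1 := coframe_dualVec ((h.liftFrame_frame hκ).2 x) 0 0
  rw [liftFrame_lt (by decide), h.lift_zero_apply hκ, h0, zero_mul] at h1
  simp at h1

lemma θ_eq_zero_of_lift (h : IsLeafProjection κ π s) (hκ : IsInvariantCoframing κ P Q) {x : N}
    {v : EuclideanSpace ℝ (Fin 7)} (hv : lift κ π s 0 x ![v] = 0) : κ 0 x ![v] = 0 := by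
  rw [h.lift_zero_apply hκ] at hv
  exact (mul_eq_zero.1 hv).resolve_left (h.lift_zero_dual_ne_zero hκ x)

/-- Let `w` be the `α` part of `v`. All forms of `liftFrame` vanish on `w`: the lifts of `θ, α₁, α₂`
because they vanish on `v` and see only its `θ` and `α` parts, the lifts of `β₁, β₂` because they
have no `α` components, and the last two forms trivially. Hence `w = 0`. -/
lemma α_eq_zero_of_lift (h : IsLeafProjection κ π s) (hκ : IsInvariantCoframing κ P Q) {x : N}
    {v : EuclideanSpace ℝ (Fin 7)}
    (hv : ∀ i : Fin 7, (i = 0 ∨ i = 1 ∨ i = 2) → lift κ π s i x ![v] = 0) :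
    κ 1 x ![v] = 0 ∧ κ 2 x ![v] = 0 := by
  have h0 := h.θ_eq_zero_of_lift hκ (hv 0 (.inl rfl))
  set c : Fin 2 → ℝ := ![κ 1 x ![v], κ 2 x ![v]] with hc
  set e : Fin 2 → EuclideanSpace ℝ (Fin 7) := ![dual κ x 1, dual κ x 2] with he
  have hw : ∑ i, c i • e i = 0 := by
    refine eq_zero_of_forall_coframe ((h.liftFrame_frame hκ).2 x) fun i => ?_
    rw [cov_one_sum, Fin.sum_univ_two]
    simp only [hc, he, Matrix.cons_val_zero, Matrix.cons_val_one]
    by_cases hi : i = 0 ∨ i = 1 ∨ i = 2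
    · rw [liftFrame_lt (by omega)]
      have h1 := hv i hi
      rw [h.lift_apply hκ, Fin.sum_univ_seven, h0] at h1
      have h3 : ∀ b : Fin 7, 3 ≤ b → lift κ π s i x ![dual κ x b] = 0 := by
        intro b hb
        rcases hi with rfl | hi
        · exact h.lift_zero_dual hκ x (by omega)
        · exact h.lift_α_dual hκ x hi hb
      rw [h3 3 (by decide), h3 4 (by decide), h3 5 (by decide), h3 6 (by decide)] at h1
      linarith
    by_cases hi' : i = 3 ∨ i = 4
    · rw [liftFrame_lt (by omega), h.lift_β_dual_α hκ x (.inr hi') (.inl rfl),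
        h.lift_β_dual_α hκ x (.inr hi') (.inr rfl)]
      ring
    · rw [liftFrame, if_neg (by omega), hκ.apply_dual_of_ne x (by omega),
        hκ.apply_dual_of_ne x (by omega)]
      ring
  have h1 := cov_one_sum (κ 1 x) Finset.univ c e
  have h2 := cov_one_sum (κ 2 x) Finset.univ c e
  rw [hw, (κ 1 x).map_coord_zero 0 rfl, Fin.sum_univ_two] at h1
  rw [hw, (κ 2 x).map_coord_zero 0 rfl, Fin.sum_univ_two] at h2
  simp only [hc, he, Matrix.cons_val_zero, Matrix.cons_val_one, hκ.apply_dual] at h1 h2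
  simp at h1 h2
  exact ⟨h1.symm, h2.symm⟩

lemma θ_mem_lift (h : IsLeafProjection κ π s) (hκ : IsInvariantCoframing κ P Q) :
    AlgIdeal (system (lift κ π s)) 1 (κ 0) := by
  have hfr := h.liftFrame_frame hκ
  refine AlgIdeal.of_components_one hfr (hκ.frame.1 0) fun i => ?_
  by_cases hi : i = 0
  · subst hi; exact .inl mem_θ
  · refine .inr fun x => h.θ_eq_zero_of_lift hκ ?_
    rw [← liftFrame_lt (κ := κ) (π := π) (s := s) (i := 0) (by decide),
      coframe_dualVec (hfr.2 x), if_neg (Ne.symm hi)]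

lemma αα_mem_lift (h : IsLeafProjection κ π s) (hκ : IsInvariantCoframing κ P Q) :
    AlgIdeal (system (lift κ π s)) 2 (fwedge (κ 1) (κ 2)) := by
  have hfr := h.liftFrame_frame hκ
  refine AlgIdeal.of_components_two hfr ((hκ.frame.1 1).fwedge (hκ.frame.1 2)) fun i j hij => ?_
  by_cases hi : i = 0
  · subst hi; exact .inl (mem_θ.wedge (hfr.1 j))
  by_cases h1 : i = 1 ∧ j = 2
  · obtain ⟨rfl, rfl⟩ := h1; exact .inl mem_αα
  refine .inr fun x => (wedge_one_one_apply _ _ _).trans ?_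
  have hj : 3 ≤ j := by omega
  have h2 := h.α_eq_zero_of_lift hκ (x := x) (v := dualVec (fun a => liftFrame κ π s a x) j)
    fun i hi => by
      rw [← liftFrame_lt (κ := κ) (π := π) (s := s) (i := i) (by omega),
        coframe_dualVec (hfr.2 x), if_neg (by omega)]
  simp only [Matrix.cons_val_zero, Matrix.cons_val_one]
  rw [h2.1, h2.2]
  ring

/-- The lifted forms generate the same ideal as the original ones. -/
lemma algIdeal_lift_iff (h : IsLeafProjection κ π s) (hκ : IsInvariantCoframing κ P Q) (k : ℕ)
    (α : Form 7 k N) : AlgIdeal (system (lift κ π s)) k α ↔ AlgIdeal (system κ) k α := by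
  have e : system (lift (fun i => κ (swapIndex i)) π s) = system (lift κ π s) :=
    system_swap (lift κ π s)
  constructor
  · refine fun H => H.trans (forall_gens_iff (P := fun k β => AlgIdeal (system κ) k β).2 ⟨?_, ?_⟩)
    · rintro _ rfl; exact h.lift_zero_mem hκ
    · rintro _ (rfl | rfl)
      · exact h.lift_αα_mem hκ
      · have := h.swap.lift_αα_mem hκ.swap
        rw [system_swap] at this
        exact this
  · refine fun H => H.trans
      (forall_gens_iff (P := fun k β => AlgIdeal (system (lift κ π s)) k β).2 ⟨?_, ?_⟩)
    · rintro _ rfl; exact h.θ_mem_lift hκ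
    · rintro _ (rfl | rfl)
      · exact h.αα_mem_lift hκ
      · have := h.swap.αα_mem_lift hκ.swap
        rw [e] at this
        exact this

lemma isSmooth_system_desc (h : IsLeafProjection κ π s) (hκ : IsInvariantCoframing κ P Q) :
    ∀ k, ∀ α ∈ system (desc κ s) k, IsSmooth α := by
  refine forall_gens_iff (P := fun k α => IsSmooth α).2 ⟨?_, ?_⟩
  · rintro _ rfl; exact h.isSmooth_desc hκ 0
  · rintro _ (rfl | rfl)
    · exact (h.isSmooth_desc hκ 1).fwedge (h.isSmooth_desc hκ 2)
    · exact (h.isSmooth_desc hκ 3).fwedge (h.isSmooth_desc hκ 4)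

/-- The descended generators are pullbacks along the section, so closure under `d` is inherited from
the ideal on `N`. -/
lemma d_system_desc_mem (h : IsLeafProjection κ π s) (hκ : IsInvariantCoframing κ P Q) :
    ∀ k, ∀ α ∈ system (desc κ s) k, AlgIdeal (system (desc κ s)) (k + 1) (d α) := by
  have e : system (desc κ s) = pullSet (n := 5) s (system κ) := (pullSet_system κ s).symm
  rw [e]
  rintro k _ ⟨β, hβ, rfl⟩
  rw [d_pullback h.smooth_section (hκ.isSmooth_system k β hβ)]
  exact AlgIdeal.pullback_mem (T := pullSet (n := 5) s (system κ)) s h.smooth_section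
    (fun k γ hγ => .of ⟨γ, hγ, rfl⟩) (hκ.d_system_mem k β hβ)

/-- The exterior differential system on the leaf space. -/
def leafEDS (h : IsLeafProjection κ π s) (hκ : IsInvariantCoframing κ P Q) : EDS 5 M :=
  EDS.ofGens (system (desc κ s)) (h.isSmooth_system_desc hκ) (h.d_system_desc_mem hκ)

lemma algIdeal_pull_leafEDS_iff (h : IsLeafProjection κ π s) (hκ : IsInvariantCoframing κ P Q)
    (k : ℕ) (α : Form 7 k N) :
    AlgIdeal ((h.leafEDS hκ).pull π) k α ↔ AlgIdeal (system κ) k α := by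
  rw [leafEDS, algIdeal_pull_ofGens h.smooth, ← h.algIdeal_lift_iff hκ, pullSet_system]
  rfl

/-- Pulling the structure equation of `θ` back along the section gives that of the descended form,
with coefficients `P ∘ s` and `Q ∘ s`. -/
lemma isHyperbolicMA (h : IsLeafProjection κ π s) (hκ : IsInvariantCoframing κ P Q) :
    IsHyperbolicMA (h.leafEDS hκ) := by
  refine isHyperbolicMA_of_frame (h.desc_frame hκ) (P := fun y => P (s y)) (Q := fun y => Q (s y))
    (fun y => hκ.P_ne _) (fun y => hκ.Q_ne _) ?_ _ fun k α => Iff.rfl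
  intro y u v hu hv
  change desc κ s 0 y ![u] = 0 at hu
  change desc κ s 0 y ![v] = 0 at hv
  change d (desc κ s 0) y ![u, v] = P (s y) * wedge (desc κ s 1 y) (desc κ s 2 y) ![u, v] +
    Q (s y) * wedge (desc κ s 3 y) (desc κ s 4 y) ![u, v]
  unfold desc at *
  rw [pullback_apply_one] at hu hv
  rw [d_pullback h.smooth_section (hκ.frame.1 0), pullback_apply_two, hκ.d_θ _ _ _ hu hv,
    wedge_one_one_apply, wedge_one_one_apply, wedge_one_one_apply, wedge_one_one_apply]
  simp [pullback_apply_one]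

/-- The degree `1` elements of the system on the leaf space are multiples of the contact form. -/
lemma eq_smul_of_mem_leafEDS (h : IsLeafProjection κ π s) (hκ : IsInvariantCoframing κ P Q)
    {α : Form 5 1 M} (hα : α ∈ (h.leafEDS hκ).carrier 1) :
    ∃ f : M → ℝ, ContMDiff (𝓡 5) 𝓘(ℝ, ℝ) ∞ f ∧ α = fun y => f y • desc κ s 0 y := by
  have hfr := h.desc_frame hκ
  have hα' : AlgIdeal (system (desc κ s)) 1 α := hα
  refine ⟨_, contMDiff_frame_component hfr ((h.leafEDS hκ).smooth hα) fun _ => 0, ?_⟩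
  funext y
  have e := cov_one_eq_sum (hfr.2 y) (α y)
  rw [Finset.sum_eq_single 0] at e
  · simp only [const_eq_vecOne]
    exact e
  · intro j _ hj
    have h1 := hα'.apply_const_eq_zero (x := y)
      (u := dualVec (fun i : Fin 5 => desc κ s (Fin.castLE (by decide) i) y) j) (by
        rintro _ rfl
        exact (coframe_dualVec (hfr.2 y) 0 j).trans (if_neg (Ne.symm hj)))
    rw [const_eq_vecOne] at h1
    rw [h1, zero_smul]
  · simp

lemma lift_zero_eq_smul (h : IsLeafProjection κ π s) (hκ : IsInvariantCoframing κ P Q) (x : N) :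
    lift κ π s 0 x = lift κ π s 0 x ![dual κ x 0] • κ 0 x := by
  ext v
  obtain ⟨v, rfl⟩ : ∃ w, v = ![w] := ⟨v 0, by funext a; fin_cases a; rfl⟩
  exact h.lift_zero_apply hκ x v

lemma pullbackBundle_leafEDS (h : IsLeafProjection κ π s) (hκ : IsInvariantCoframing κ P Q)
    (x : N) : pullbackBundle (n := 7) π (h.leafEDS hκ).bundle x = Submodule.span ℝ {κ 0 x} := by
  refine le_antisymm (Submodule.span_le.2 ?_) (Submodule.span_le.2 ?_)
  · rintro _ ⟨a, ha, rfl⟩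
    have h1 : ∀ a ∈ (h.leafEDS hκ).bundle (π x), a ∈ Submodule.span ℝ {desc κ s 0 (π x)} := by
      intro a ha
      refine Submodule.span_le.2 ?_ ha
      rintro _ ⟨α, hα, rfl⟩
      obtain ⟨f, -, rfl⟩ := h.eq_smul_of_mem_leafEDS hκ hα
      exact Submodule.smul_mem _ _ (Submodule.mem_span_singleton_self _)
    obtain ⟨r, rfl⟩ := Submodule.mem_span_singleton.1 (h1 a ha)
    have h2 := h.lift_zero_eq_smul hκ x
    refine Submodule.mem_span_singleton.2 ⟨r * lift κ π s 0 x ![dual κ x 0], ?_⟩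
    rw [mul_smul, ← h2]
    rfl
  · rintro _ rfl
    have h2 := h.lift_zero_eq_smul hκ x
    have h3 : κ 0 x = (lift κ π s 0 x ![dual κ x 0])⁻¹ • lift κ π s 0 x := by
      refine (inv_smul_smul₀ (h.lift_zero_dual_ne_zero hκ x) (κ 0 x)).symm.trans ?_
      rw [← h2]
    rw [h3]
    refine Submodule.smul_mem _ _ (Submodule.subset_span ⟨desc κ s 0 (π x), ?_, rfl⟩)
    exact Submodule.subset_span ⟨desc κ s 0, .of (k := 1) rfl, rfl⟩

/-- The derivative of a section of the contact bundle of the leaf space, on the annihilator of the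
contact form. -/
lemma d_section_apply (h : IsLeafProjection κ π s) (hκ : IsInvariantCoframing κ P Q)
    {θ : Form 5 1 M} (hθ : θ ∈ (h.leafEDS hκ).carrier 1) (x : N) (hx : θ (π x) ≠ 0) :
    ∃ g : ℝ, g ≠ 0 ∧ ∀ u v, κ 0 x ![u] = 0 → κ 0 x ![v] = 0 →
      pullback (n := 7) π (d θ) x ![u, v] = g * (P x * wedge (κ 1 x) (κ 2 x) ![u, v] +
        Q x * wedge (κ 3 x) (κ 4 x) ![u, v]) := by
  obtain ⟨f, hf, rfl⟩ := h.eq_smul_of_mem_leafEDS hκ hθ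
  have hs := (h.leafEDS hκ).smooth hθ
  have hf' : ContMDiff (𝓡 7) 𝓘(ℝ, ℝ) ∞
      (fun x => f (π x) * lift κ π s 0 x ![dual κ x 0]) :=
    (hf.comp h.smooth).mul (h.contMDiff_lift_component hκ 0 0)
  -- The pulled back section is a function multiple of `θ`. In its derivative the term with the
  -- differential of the factor contains `θ` and disappears on the kernel.
  have e : pullback (n := 7) π (fun y => f y • desc κ s 0 y) =
      fun x => (f (π x) * lift κ π s 0 x ![dual κ x 0]) • κ 0 x := by
    funext x
    rw [mul_smul, ← h.lift_zero_eq_smul hκ x]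
    rfl
  refine ⟨f (π x) * lift κ π s 0 x ![dual κ x 0], mul_ne_zero (fun h0 => hx ?_)
    (h.lift_zero_dual_ne_zero hκ x), fun u v hu hv => ?_⟩
  · simp only [h0, zero_smul]
  · rw [← d_pullback h.smooth hs, e, d_smul_apply hf' (hκ.frame.1 0), hu, hv, hκ.d_θ x u v hu hv]
    ring

end IsLeafProjection

end LeafSystems

/-! ### From invariant bundles to values of exterior derivatives -/

section Invariance

variable {N : Type*} [TopologicalSpace N] [ChartedSpace (EuclideanSpace ℝ (Fin 7)) N]

/-- By Cartan's formula, a constant value of `σ(X)` leaves only the contraction of `dσ`. It applies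
to members of a coframing paired with the dual frame. -/
lemma lieDeriv_apply (X : N → EuclideanSpace ℝ (Fin 7)) (σ : Form 7 1 N) {r : ℝ}
    (h : ∀ y, σ y ![X y] = r) (x : N) (v : EuclideanSpace ℝ (Fin 7)) :
    lieDeriv X σ x ![v] = d σ x ![X x, v] := by
  have e : (fun y => σ y ![X y]) = fun _ => r := funext h
  unfold lieDeriv
  rw [e, mfderiv_const, ContinuousAlternatingMap.add_apply]
  exact add_zero _

lemma d_apply_of_isInvariant {r : ℕ} {K : Fin r → Form 7 1 N}
    {X : N → EuclideanSpace ℝ (Fin 7)} (h : IsInvariant K X) (i : Fin r) (hs : IsSmooth (K i))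
    {a : ℝ} (ha : ∀ y, K i y ![X y] = a) {x : N} {v : EuclideanSpace ℝ (Fin 7)}
    (hv : ∀ j, K j x ![v] = 0) : d (K i) x ![X x, v] = 0 := by
  rw [← lieDeriv_apply X (K i) ha]
  exact eval_spanAt_eq_zero hv _
    ((h (K i) hs fun y => Submodule.subset_span ⟨i, rfl⟩).2 x)

open IsInvariantCoframing (dual)

/-- Invariance is assumed only along the two dual fields. The values `dα(z, v)` are linear in `z` at
the point, and every vertical `z` is a combination of these two fields. -/
lemma IsInvariantCoframing.of_isInvariant {κ : Fin 7 → Form 7 1 N} {P Q : N → ℝ}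
    (hκ : IsFrame κ)
    (hd : ∀ x u v, κ 0 x ![u] = 0 → κ 0 x ![v] = 0 → d (κ 0) x ![u, v] =
      P x * wedge (κ 1 x) (κ 2 x) ![u, v] + Q x * wedge (κ 3 x) (κ 4 x) ![u, v])
    (hP : ∀ x, P x ≠ 0) (hQ : ∀ x, Q x ≠ 0)
    (hα : ∀ k : Fin 7, 5 ≤ k → IsInvariant ![κ 0, κ 1, κ 2] (fun x => dual κ x k))
    (hβ : ∀ k : Fin 7, 5 ≤ k → IsInvariant ![κ 0, κ 3, κ 4] (fun x => dual κ x k)) :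
    IsInvariantCoframing κ P Q := by
  have key : ∀ (x : N) (z v : EuclideanSpace ℝ (Fin 7)) (i : Fin 7),
      (∀ i : Fin 7, i < 5 → κ i x ![z] = 0) →
      (∀ k : Fin 7, 5 ≤ k → d (κ i) x ![dual κ x k, v] = 0) → d (κ i) x ![z, v] = 0 := by
    intro x z v i hz hk
    rw [← sum_coframe_dualVec (hκ.2 x) z, cov_two_sum_left]
    refine Finset.sum_eq_zero fun j _ => ?_
    rcases lt_or_ge j 5 with hj | hj
    · rw [hz j hj, zero_mul]
    · rw [hk j hj, mul_zero]
  have hconst : ∀ i k : Fin 7, ∀ y, κ i y ![dual κ y k] = if i = k then 1 else 0 :=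
    fun i k y => coframe_dualVec (hκ.2 y) i k
  refine ⟨hκ, hd, hP, hQ, fun x z v hz h0 h1 h2 => ?_, fun x z v hz h0 h1 h2 => ?_⟩
  · have hv : ∀ j, ![κ 0, κ 1, κ 2] j x ![v] = 0 := by intro j; fin_cases j <;> assumption
    exact ⟨key x z v 1 hz fun k hk => d_apply_of_isInvariant (hα k hk) 1 (hκ.1 1) (hconst 1 k) hv,
      key x z v 2 hz fun k hk => d_apply_of_isInvariant (hα k hk) 2 (hκ.1 2) (hconst 2 k) hv⟩
  · have hv : ∀ j, ![κ 0, κ 3, κ 4] j x ![v] = 0 := by intro j; fin_cases j <;> assumption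
    exact ⟨key x z v 3 hz fun k hk => d_apply_of_isInvariant (hβ k hk) 1 (hκ.1 3) (hconst 3 k) hv,
      key x z v 4 hz fun k hk => d_apply_of_isInvariant (hβ k hk) 2 (hκ.1 4) (hconst 4 k) hv⟩

end Invariance

/-! ### The coframings adapted to the two Pfaffian systems -/

section Coframings

variable {N : Type*} [TopologicalSpace N] [ChartedSpace (EuclideanSpace ℝ (Fin 7)) N]

/-- The coframing as a family. -/
def Forms7.frame (Ω : Forms7 N) : Fin 7 → Form 7 1 N :=
  ![Ω.w0, Ω.wb, Ω.γ, Ω.w1, Ω.w2, Ω.w3, Ω.w4]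

/-- The coframing adapted to the system `𝒦`. -/
def Forms7.leftFrame (Ω : Forms7 N) (c : Coeffs N) : Fin 7 → Form 7 1 N :=
  ![Ω.w0, Ω.w1, Ω.w2, Ω.w3' c, Ω.w4' c, Ω.wb, Ω.γ]

/-- The coframing adapted to the system `𝒦̄`. -/
def Forms7.rightFrame (Ω : Forms7 N) (c : Coeffs N) : Fin 7 → Form 7 1 N :=
  ![Ω.wb, Ω.w1' c, Ω.w2' c, Ω.w3, Ω.w4, Ω.w0, Ω.γ]

variable {Ω : Forms7 N} {ε : ℝ} {c : Coeffs N}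

omit [TopologicalSpace N] [ChartedSpace (EuclideanSpace ℝ (Fin 7)) N] in
lemma w1'_apply (x : N) (v : Fin 1 → EuclideanSpace ℝ (Fin 7)) :
    Ω.w1' c x v = Ω.w1 x v - c.B2 x * Ω.γ x v := rfl

omit [TopologicalSpace N] [ChartedSpace (EuclideanSpace ℝ (Fin 7)) N] in
lemma w2'_apply (x : N) (v : Fin 1 → EuclideanSpace ℝ (Fin 7)) :
    Ω.w2' c x v = Ω.w2 x v + c.B1 x * Ω.γ x v := rfl

omit [TopologicalSpace N] [ChartedSpace (EuclideanSpace ℝ (Fin 7)) N] in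
lemma w3'_apply (x : N) (v : Fin 1 → EuclideanSpace ℝ (Fin 7)) :
    Ω.w3' c x v = Ω.w3 x v - c.B4 x * Ω.γ x v := rfl

omit [TopologicalSpace N] [ChartedSpace (EuclideanSpace ℝ (Fin 7)) N] in
lemma w4'_apply (x : N) (v : Fin 1 → EuclideanSpace ℝ (Fin 7)) :
    Ω.w4' c x v = Ω.w4 x v + c.B3 x * Ω.γ x v := rfl

omit [TopologicalSpace N] [ChartedSpace (EuclideanSpace ℝ (Fin 7)) N] in
lemma w3'_eq : Ω.w3' c = fun x => Ω.w3 x + (-c.B4 x) • Ω.γ x := by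
  funext x
  ext v
  rw [w3'_apply]
  change _ = Ω.w3 x v + (-c.B4 x) * Ω.γ x v
  ring

omit [TopologicalSpace N] [ChartedSpace (EuclideanSpace ℝ (Fin 7)) N] in
lemma w1'_eq : Ω.w1' c = fun x => Ω.w1 x + (-c.B2 x) • Ω.γ x := by
  funext x
  ext v
  rw [w1'_apply]
  change _ = Ω.w1 x v + (-c.B2 x) * Ω.γ x v
  ring

variable [IsManifold (𝓡 7) ∞ N]

lemma isSmooth_shift {a γ : Form 7 1 N} {f : N → ℝ} (ha : IsSmooth a) (hγ : IsSmooth γ)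
    (hf : ContMDiff (𝓡 7) 𝓘(ℝ, ℝ) ∞ f) : IsSmooth (fun x => a x + f x • γ x) :=
  ha.add (hγ.smul hf)

namespace TypeACongruences

omit [IsManifold (𝓡 7) ∞ N] in
lemma B1_smooth (hc : TypeACongruences Ω ε c) : ContMDiff (𝓡 7) 𝓘(ℝ, ℝ) ∞ c.B1 := hc.smooth 1

omit [IsManifold (𝓡 7) ∞ N] in
lemma B2_smooth (hc : TypeACongruences Ω ε c) : ContMDiff (𝓡 7) 𝓘(ℝ, ℝ) ∞ c.B2 := hc.smooth 2

omit [IsManifold (𝓡 7) ∞ N] in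
lemma B3_smooth (hc : TypeACongruences Ω ε c) : ContMDiff (𝓡 7) 𝓘(ℝ, ℝ) ∞ c.B3 := hc.smooth 3

omit [IsManifold (𝓡 7) ∞ N] in
lemma B4_smooth (hc : TypeACongruences Ω ε c) : ContMDiff (𝓡 7) 𝓘(ℝ, ℝ) ∞ c.B4 := hc.smooth 4

omit [IsManifold (𝓡 7) ∞ N] in
lemma ε_ne (hc : TypeACongruences Ω ε c) : ε ≠ 0 := by
  rcases hc.sign with h | h <;> rw [h] <;> norm_num

lemma leftFrame_isFrame (hΩ : Ω.IsCoframing) (hc : TypeACongruences Ω ε c) :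
    IsFrame (Ω.leftFrame c) := by
  have s0 : IsSmooth Ω.w0 := hΩ.1 0
  have sb : IsSmooth Ω.wb := hΩ.1 1
  have sγ : IsSmooth Ω.γ := hΩ.1 2
  have s1 : IsSmooth Ω.w1 := hΩ.1 3
  have s2 : IsSmooth Ω.w2 := hΩ.1 4
  refine ⟨fun i => ?_, fun x => ?_⟩
  · fin_cases i
    · exact s0
    · exact s1
    · exact s2
    · change IsSmooth (Ω.w3' c)
      rw [w3'_eq]
      exact isSmooth_shift (hΩ.1 5) (hΩ.1 2) hc.B4_smooth.neg
    · exact isSmooth_shift (hΩ.1 6) (hΩ.1 2) hc.B3_smooth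
    · exact sb
    · exact sγ
  · refine linearIndependent_of_forall_coframe fun v hv => eq_zero_of_forall_coframe (hΩ.2 x) ?_
    have h0 : Ω.w0 x ![v] = 0 := hv 0
    have hb : Ω.wb x ![v] = 0 := hv 5
    have h1 : Ω.w1 x ![v] = 0 := hv 1
    have h2 : Ω.w2 x ![v] = 0 := hv 2
    have hγ : Ω.γ x ![v] = 0 := hv 6
    have h3 : Ω.w3 x ![v] - c.B4 x * Ω.γ x ![v] = 0 := hv 3
    have h4 : Ω.w4 x ![v] + c.B3 x * Ω.γ x ![v] = 0 := hv 4
    rw [hγ, mul_zero, sub_zero] at h3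
    rw [hγ, mul_zero, add_zero] at h4
    intro i
    fin_cases i
    exacts [h0, hb, hγ, h1, h2, h3, h4]

lemma rightFrame_isFrame (hΩ : Ω.IsCoframing) (hc : TypeACongruences Ω ε c) :
    IsFrame (Ω.rightFrame c) := by
  refine ⟨fun i => ?_, fun x => ?_⟩
  · fin_cases i
    · exact hΩ.1 1
    · change IsSmooth (Ω.w1' c)
      rw [w1'_eq]
      exact isSmooth_shift (hΩ.1 3) (hΩ.1 2) hc.B2_smooth.neg
    · exact isSmooth_shift (hΩ.1 4) (hΩ.1 2) hc.B1_smooth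
    · exact hΩ.1 5
    · exact hΩ.1 6
    · exact hΩ.1 0
    · exact hΩ.1 2
  · refine linearIndependent_of_forall_coframe fun v hv => eq_zero_of_forall_coframe (hΩ.2 x) ?_
    have hγ : Ω.γ x ![v] = 0 := hv 6
    have h1 : Ω.w1 x ![v] - c.B2 x * Ω.γ x ![v] = 0 := hv 1
    have h2 : Ω.w2 x ![v] + c.B1 x * Ω.γ x ![v] = 0 := hv 2
    rw [hγ, mul_zero, sub_zero] at h1
    rw [hγ, mul_zero, add_zero] at h2
    intro i
    fin_cases i
    exacts [hv 5, hv 0, hγ, h1, h2, hv 3, hv 4]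

-- The identity `ω³∧ω⁴ + (B₃ω³ + B₄ω⁴)∧γ = (ω³ - B₄γ)∧(ω⁴ + B₃γ)` brings the congruence to the form
-- required of an invariant coframing, with `P = A` and `Q = 1`.
omit [IsManifold (𝓡 7) ∞ N] in
lemma d_w0_apply (hc : TypeACongruences Ω ε c) (x : N) (u v : EuclideanSpace ℝ (Fin 7))
    (hu : Ω.w0 x ![u] = 0) (hv : Ω.w0 x ![v] = 0) : d Ω.w0 x ![u, v] =
      c.A x * wedge (Ω.w1 x) (Ω.w2 x) ![u, v] +
        1 * wedge (Ω.w3' c x) (Ω.w4' c x) ![u, v] := by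
  have h : d Ω.w0 x ![u, v] - (c.A x * wedge (Ω.w1 x) (Ω.w2 x) ![u, v] +
      wedge (Ω.w3 x) (Ω.w4 x) ![u, v] +
      wedge (c.B3 x • Ω.w3 x + c.B4 x • Ω.w4 x) (Ω.γ x) ![u, v]) = 0 :=
    eval_zeroMod_one (hc.d_w0 x) (eval_span_eq_zero (s := {Ω.w0 x}) (by
      rintro _ rfl; exact hu)) (eval_span_eq_zero (s := {Ω.w0 x}) (by rintro _ rfl; exact hv))
  have e : ∀ a b : Cov 7 1, wedge a b ![u, v] = a ![u] * b ![v] - a ![v] * b ![u] :=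
    fun a b => wedge_one_one_apply a b _
  have e' : ∀ (r t : ℝ) (a b : Cov 7 1) (v : Fin 1 → EuclideanSpace ℝ (Fin 7)),
    (r • a + t • b : Cov 7 1) v = r * a v + t * b v := fun _ _ _ _ _ => rfl
  rw [e, e, e, e', e'] at h
  rw [e, e, w3'_apply, w4'_apply, w3'_apply, w4'_apply]
  linear_combination h

omit [IsManifold (𝓡 7) ∞ N] in
lemma d_wb_apply (hc : TypeACongruences Ω ε c) (x : N) (u v : EuclideanSpace ℝ (Fin 7))
    (hu : Ω.wb x ![u] = 0) (hv : Ω.wb x ![v] = 0) : d Ω.wb x ![u, v] =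
      1 * wedge (Ω.w1' c x) (Ω.w2' c x) ![u, v] +
        (ε * c.A x) * wedge (Ω.w3 x) (Ω.w4 x) ![u, v] := by
  have h : d Ω.wb x ![u, v] - (wedge (Ω.w1 x) (Ω.w2 x) ![u, v] +
      (ε * c.A x) * wedge (Ω.w3 x) (Ω.w4 x) ![u, v] +
      wedge (c.B1 x • Ω.w1 x + c.B2 x • Ω.w2 x) (Ω.γ x) ![u, v]) = 0 :=
    eval_zeroMod_one (hc.d_wb x) (eval_span_eq_zero (s := {Ω.wb x}) (by
      rintro _ rfl; exact hu)) (eval_span_eq_zero (s := {Ω.wb x}) (by rintro _ rfl; exact hv))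
  have e : ∀ a b : Cov 7 1, wedge a b ![u, v] = a ![u] * b ![v] - a ![v] * b ![u] :=
    fun a b => wedge_one_one_apply a b _
  have e' : ∀ (r t : ℝ) (a b : Cov 7 1) (v : Fin 1 → EuclideanSpace ℝ (Fin 7)),
    (r • a + t • b : Cov 7 1) v = r * a v + t * b v := fun _ _ _ _ _ => rfl
  rw [e, e, e, e', e'] at h
  rw [e, e, w1'_apply, w2'_apply, w1'_apply, w2'_apply]
  linear_combination h

lemma leftFrame_isInvariantCoframing (hΩ : Ω.IsCoframing) (hc : TypeACongruences Ω ε c)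
    (hinv : InvarianceProperty Ω c) :
    IsInvariantCoframing (Ω.leftFrame c) c.A (fun _ => 1) := by
  have hfr := leftFrame_isFrame hΩ hc
  -- Matches the order in `InvarianceProperty` with that of `leftFrame`: the fields `X 1` and `X 2`
  -- become the dual vectors with indices 5 and 6.
  let p : Fin 7 → Fin 7 := ![0, 5, 6, 1, 2, 3, 4]
  have hp : Function.Injective p := by decide
  have h := hinv.1 (fun j x => IsInvariantCoframing.dual (Ω.leftFrame c) x (p j)) (by
    intro x i j
    have e : ![Ω.w0, Ω.wb, Ω.γ, Ω.w1, Ω.w2, Ω.w3' c, Ω.w4' c] i = Ω.leftFrame c (p i) := by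
      fin_cases i <;> simp [Forms7.leftFrame, p]
    rw [e]
    refine (coframe_dualVec (hfr.2 x) (p i) (p j)).trans ?_
    simp only [hp.eq_iff])
  refine .of_isInvariant hfr hc.d_w0_apply (fun x => (hc.A_pos x).ne') (fun x => one_ne_zero)
    (fun k hk => ?_) fun k hk => ?_
  · obtain rfl | rfl : k = 5 ∨ k = 6 := by omega
    exacts [h.1.1, h.1.2]
  · obtain rfl | rfl : k = 5 ∨ k = 6 := by omega
    exacts [h.2.1, h.2.2]

lemma rightFrame_isInvariantCoframing (hΩ : Ω.IsCoframing) (hc : TypeACongruences Ω ε c)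
    (hinv : InvarianceProperty Ω c) :
    IsInvariantCoframing (Ω.rightFrame c) (fun _ => 1) (fun x => ε * c.A x) := by
  have hfr := rightFrame_isFrame hΩ hc
  -- Here `ω⁰` moves to position 5, so that `Y 0` and `Y 2` are the dual vectors with indices 5 and
  -- 6.
  let p : Fin 7 → Fin 7 := ![5, 0, 6, 1, 2, 3, 4]
  have hp : Function.Injective p := by decide
  have h := hinv.2 (fun j x => IsInvariantCoframing.dual (Ω.rightFrame c) x (p j)) (by
    intro x i j
    have e : ![Ω.w0, Ω.wb, Ω.γ, Ω.w1' c, Ω.w2' c, Ω.w3, Ω.w4] i = Ω.rightFrame c (p i) := by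
      fin_cases i <;> simp [Forms7.rightFrame, p]
    rw [e]
    refine (coframe_dualVec (hfr.2 x) (p i) (p j)).trans ?_
    simp only [hp.eq_iff])
  refine .of_isInvariant hfr hc.d_wb_apply (fun x => one_ne_zero)
    (fun x => mul_ne_zero hc.ε_ne (hc.A_pos x).ne') (fun k hk => ?_) fun k hk => ?_
  · obtain rfl | rfl : k = 5 ∨ k = 6 := by omega
    exacts [h.2.1, h.2.2]
  · obtain rfl | rfl : k = 5 ∨ k = 6 := by omega
    exacts [h.1.1, h.1.2]

lemma restrict (hΩ : Ω.IsCoframing) (hc : TypeACongruences Ω ε c)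
    (V : TopologicalSpace.Opens N) : TypeACongruences (Ω.restrict V) ε (c.restrict V) := by
  have hv : ContMDiff (𝓡 7) (𝓡 7) ∞ (Subtype.val : V → N) := contMDiff_subtype_val
  have hz : ∀ (x : V) (w : Form 7 1 N) (β : Cov 7 2),
      β ∈ zeroMod (Submodule.span ℝ {w x}) 1 →
      β.compContinuousLinearMap (tang (n := 7) (m := 7) (Subtype.val : V → N) x) ∈
        zeroMod (Submodule.span ℝ {pullback (n := 7) (Subtype.val : V → N) w x}) 1 := by
    intro x w β hβ
    refine zeroMod_comp (k := 1) _ (fun a ha => ?_) hβ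
    obtain ⟨r, rfl⟩ := Submodule.mem_span_singleton.1 ha
    exact Submodule.mem_span_singleton.2 ⟨r, rfl⟩
  have hw : ∀ (x : V) (a b : Form 7 1 N), wedge (pullback (n := 7) (Subtype.val : V → N) a x)
      (pullback (n := 7) (Subtype.val : V → N) b x) = (wedge (a x) (b x)).compContinuousLinearMap
        (tang (n := 7) (m := 7) (Subtype.val : V → N) x) :=
    fun x a b => (wedge_comp (a x) (b x) (tang (n := 7) (m := 7) (Subtype.val : V → N) x)).symm
  refine ⟨hc.sign, fun i => ?_, fun x => hc.A_pos x, fun x => hc.A_sq x, fun x => ?_, fun x => ?_,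
    fun x => ?_⟩
  · have := (hc.smooth i).comp hv
    fin_cases i <;> exact this
  · have e := hw x (fun x => c.B3 x • Ω.w3 x + c.B4 x • Ω.w4 x) Ω.γ
    have e0 := congrFun (d_pullback (β := Ω.w0) hv (hΩ.1 0)) x
    have h := hz x _ _ (hc.d_w0 x)
    have h' : pullback (n := 7) (Subtype.val : V → N) (d Ω.w0) x -
      (c.A x • (wedge (Ω.w1 x) (Ω.w2 x)).compContinuousLinearMap
        (tang (n := 7) (m := 7) (Subtype.val : V → N) x) +
      (wedge (Ω.w3 x) (Ω.w4 x)).compContinuousLinearMap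
        (tang (n := 7) (m := 7) (Subtype.val : V → N) x) +
      (wedge (c.B3 x • Ω.w3 x + c.B4 x • Ω.w4 x) (Ω.γ x)).compContinuousLinearMap
        (tang (n := 7) (m := 7) (Subtype.val : V → N) x)) ∈
      zeroMod (Submodule.span ℝ {pullback (n := 7) (Subtype.val : V → N) Ω.w0 x}) 1 := h
    rw [← hw, ← hw, ← e, ← e0] at h'
    exact h'
  · have e := hw x (fun x => c.B1 x • Ω.w1 x + c.B2 x • Ω.w2 x) Ω.γ
    have e0 := congrFun (d_pullback (β := Ω.wb) hv (hΩ.1 1)) x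
    have h := hz x _ _ (hc.d_wb x)
    have h' : pullback (n := 7) (Subtype.val : V → N) (d Ω.wb) x -
      ((wedge (Ω.w1 x) (Ω.w2 x)).compContinuousLinearMap
        (tang (n := 7) (m := 7) (Subtype.val : V → N) x) +
      (ε * c.A x) • (wedge (Ω.w3 x) (Ω.w4 x)).compContinuousLinearMap
        (tang (n := 7) (m := 7) (Subtype.val : V → N) x) +
      (wedge (c.B1 x • Ω.w1 x + c.B2 x • Ω.w2 x) (Ω.γ x)).compContinuousLinearMap
        (tang (n := 7) (m := 7) (Subtype.val : V → N) x)) ∈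
      zeroMod (Submodule.span ℝ {pullback (n := 7) (Subtype.val : V → N) Ω.wb x}) 1 := h
    rw [← hw, ← hw, ← e, ← e0] at h'
    exact h'
  · have e0 := congrFun (d_pullback (β := Ω.γ) hv (hΩ.1 2)) x
    have h := hz x _ _ (hc.d_γ x)
    let T : Cov 7 (1 + 1) → Cov 7 (1 + 1) := fun β => β.compContinuousLinearMap
      (tang (n := 7) (m := 7) (Subtype.val : V → N) x)
    have h' : pullback (n := 7) (Subtype.val : V → N) (d Ω.γ) x -
      (c.C0 x • T (wedge (Ω.w0 x) (Ω.wb x)) +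
        (c.C1 x • T (wedge (Ω.w1 x) (Ω.w0 x)) + c.C2 x • T (wedge (Ω.w2 x) (Ω.w0 x)) +
          c.C3 x • T (wedge (Ω.w3 x) (Ω.w0 x)) + c.C4 x • T (wedge (Ω.w4 x) (Ω.w0 x))) +
        (c.D1 x • T (wedge (Ω.w1 x) (Ω.wb x)) + c.D2 x • T (wedge (Ω.w2 x) (Ω.wb x)) +
          c.D3 x • T (wedge (Ω.w3 x) (Ω.wb x)) + c.D4 x • T (wedge (Ω.w4 x) (Ω.wb x)))) ∈
      zeroMod (Submodule.span ℝ {pullback (n := 7) (Subtype.val : V → N) Ω.γ x}) 1 := h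
    have hT : ∀ a b : Form 7 1 N, T (wedge (a x) (b x)) =
      wedge (pullback (n := 7) (Subtype.val : V → N) a x)
        (pullback (n := 7) (Subtype.val : V → N) b x) := fun a b => (hw x a b).symm
    rw [hT, hT, hT, hT, hT, hT, hT, hT, hT, ← e0] at h'
    exact h'

end TypeACongruences

lemma Forms7.IsCoframing.restrict (hΩ : Ω.IsCoframing) (V : TopologicalSpace.Opens N) :
    (Ω.restrict V).IsCoframing := by
  have := IsFrame.pullback hΩ (contMDiff_subtype_val (n := ∞) (I := 𝓡 7) (U := V))
    fun x => (tang_subtype_val_bijective V x).2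
  have e : (fun i => pullback (n := 7) (Subtype.val : V → N)
      (![Ω.w0, Ω.wb, Ω.γ, Ω.w1, Ω.w2, Ω.w3, Ω.w4] i)) =
      ![(Ω.restrict V).w0, (Ω.restrict V).wb, (Ω.restrict V).γ, (Ω.restrict V).w1,
        (Ω.restrict V).w2, (Ω.restrict V).w3, (Ω.restrict V).w4] := by
    funext i; fin_cases i <;> rfl
  rw [e] at this
  exact this

end Coframings

/-! ### Pullback of bundles and modification of products -/

section Bundles

variable {n m k : ℕ}
  {M : Type*} [TopologicalSpace M] [ChartedSpace (EuclideanSpace ℝ (Fin n)) M]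
  {N : Type*} [TopologicalSpace N] [ChartedSpace (EuclideanSpace ℝ (Fin m)) N]

lemma pullbackBundle_spanAt {ι : Type*} (f : M → N) (κ : ι → Form m 1 N) (x : M) :
    pullbackBundle (n := n) f (spanAt κ) x = spanAt (fun i => pullback (n := n) f (κ i)) x := by
  refine le_antisymm (Submodule.span_le.2 ?_) (Submodule.span_le.2 ?_)
  · rintro _ ⟨a, ha, rfl⟩
    unfold spanAt at ha
    induction ha using Submodule.span_induction with
    | mem a ha => obtain ⟨i, rfl⟩ := ha; exact Submodule.subset_span ⟨i, rfl⟩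
    | zero => exact Submodule.zero_mem _
    | add a b _ _ ha hb => exact Submodule.add_mem _ ha hb
    | smul r a _ ha => exact Submodule.smul_mem _ r ha
  · rintro _ ⟨i, rfl⟩
    exact Submodule.subset_span ⟨κ i (f x), Submodule.subset_span ⟨i, rfl⟩, rfl⟩

variable [IsManifold (𝓡 n) ∞ M] [IsManifold (𝓡 m) ∞ N]

lemma algIdeal_pullSet_congr {f : M → N} (hf : ContMDiff (𝓡 n) (𝓡 m) ∞ f) {S T : GradedSet m N}
    (h : ∀ k (α : Form m k N), AlgIdeal S k α ↔ AlgIdeal T k α) (k : ℕ) (α : Form n k M) :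
    AlgIdeal (pullSet f S) k α ↔ AlgIdeal (pullSet f T) k α :=
  ⟨fun H => H.pullSet_mono hf fun k α hα => (h k α).1 (.of hα),
    fun H => H.pullSet_mono hf fun k α hα => (h k α).2 (.of hα)⟩

lemma fwedge_mem_of_left {S : GradedSet n M} {a b : Form n 1 M} (ha : AlgIdeal S 1 a)
    (hb : IsSmooth b) : AlgIdeal S 2 (fwedge a b) := ha.wedge hb

lemma fwedge_mem_of_right {S : GradedSet n M} {a b : Form n 1 M} (ha : IsSmooth a)
    (hb : AlgIdeal S 1 b) : AlgIdeal S 2 (fwedge a b) := hb.wedge_left ha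

/-- Products may be modified by multiples of an element of the ideal. -/
lemma fwedge_shift_mem {S : GradedSet n M} {a b γ : Form n 1 M} {f g : M → ℝ}
    (hf : ContMDiff (𝓡 n) 𝓘(ℝ, ℝ) ∞ f) (hg : ContMDiff (𝓡 n) 𝓘(ℝ, ℝ) ∞ g)
    (ha : IsSmooth a) (hb : IsSmooth b) (hγ : AlgIdeal S 1 γ) (hγs : IsSmooth γ)
    (h : AlgIdeal S 2 (fwedge a b)) :
    AlgIdeal S 2 (fwedge (fun x => a x + f x • γ x) (fun x => b x + g x • γ x)) := by
  have e : fwedge (fun x => a x + f x • γ x) (fun x => b x + g x • γ x) =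
      fwedge a b + (fwedge (fun x => f x • γ x) (fun x => b x + g x • γ x) +
        fwedge a (fun x => g x • γ x)) := by
    funext x
    simp only [fwedge, Pi.add_apply, wedge_add_left, wedge_add_right]
    abel
  rw [e]
  exact h.add ((fwedge_mem_of_left (hγ.smul hf) (hb.add (hγs.smul hg))).add
    (fwedge_mem_of_right ha (hγ.smul hg)))

end Bundles

/-! ### Integrable extensions over leaf spaces -/

section Extensions

variable {N : Type*} [TopologicalSpace N] [ChartedSpace (EuclideanSpace ℝ (Fin 7)) N]
  {M : Type*} [TopologicalSpace M] [ChartedSpace (EuclideanSpace ℝ (Fin 5)) M]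
  [IsManifold (𝓡 7) ∞ N] [IsManifold (𝓡 5) ∞ M]

open IsInvariantCoframing (system)

/-- The bundle `Θ` is spanned by the last two forms. A vertical vector annihilated by them is
annihilated by the whole coframing, which gives transversality; generation holds because the pulled
back system generates the ideal of `system κ`. -/
lemma IsLeafProjection.isIntegrableExtension {κ : Fin 7 → Form 7 1 N} {P Q : N → ℝ} {π : N → M}
    {s : M → N} (h : IsLeafProjection κ π s) (hκ : IsInvariantCoframing κ P Q) (𝓑 : EDS 7 N)
    {T : GradedSet 7 N} (hT : ∀ k (α : Form 7 k N), α ∈ 𝓑.carrier k ↔ AlgIdeal T k α)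
    (hT' : ∀ k (α : Form 7 k N), AlgIdeal T k α ↔
      AlgIdeal (fun k => system κ k ∪ gens {κ 5, κ 6} ∅ k) k α) :
    IsIntegrableExtension 2 𝓑 (h.leafEDS hκ) π := by
  refine ⟨rfl, h.smooth, h.surjective_tang hκ, fun p => ⟨⊤, trivial, ?_⟩⟩
  have hv : ContMDiff (𝓡 7) (𝓡 7) ∞ (Subtype.val : (⊤ : TopologicalSpace.Opens N) → N) :=
    contMDiff_subtype_val
  have hv' := fun x => tang_subtype_val_bijective (n := 7) (⊤ : TopologicalSpace.Opens N) x
  let p : Fin 2 → Fin 7 := ![5, 6]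
  have hp : Function.Injective p := by decide
  refine ⟨fun i => pullback (n := 7) Subtype.val (κ (p i)), ?_, ?_, ?_⟩
  · have := hκ.frame.pullback hv fun x => (hv' x).2
    exact ⟨fun i => this.1 _, fun x => (this.2 x).comp p hp⟩
  · intro k α
    set S : GradedSet 7 N := fun k => (h.leafEDS hκ).pull π k ∪ gens {κ 5, κ 6} ∅ k with hS
    have e : (fun k => (h.leafEDS hκ).pull
        (fun x : (⊤ : TopologicalSpace.Opens N) => π x) k ∪ gens (Set.range fun i =>
          pullback (n := 7) (Subtype.val : (⊤ : TopologicalSpace.Opens N) → N) (κ (p i))) ∅ k) =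
        pullSet (n := 7) (Subtype.val : (⊤ : TopologicalSpace.Opens N) → N) S := by
      have e1 : gens (Set.range fun i => pullback (n := 7)
          (Subtype.val : (⊤ : TopologicalSpace.Opens N) → N) (κ (p i))) ∅ =
          pullSet (n := 7) (Subtype.val : (⊤ : TopologicalSpace.Opens N) → N)
            (gens {κ 5, κ 6} ∅) := by
        rw [pullSet_gens, Set.image_empty, Set.image_pair]
        congr 1
        ext β
        simp [p, Fin.exists_fin_two, eq_comm]
      funext k
      ext β
      rw [e1]
      constructor
      · rintro (⟨γ, hγ, rfl⟩ | ⟨γ, hγ, rfl⟩)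
        · exact ⟨_, .inl ⟨γ, hγ, rfl⟩, (pullback_comp h.smooth hv γ).symm⟩
        · exact ⟨γ, .inr hγ, rfl⟩
      · rintro ⟨γ, ⟨δ, hδ, rfl⟩ | hγ, rfl⟩
        · exact .inl ⟨δ, hδ, pullback_comp h.smooth hv δ⟩
        · exact .inr ⟨γ, hγ, rfl⟩
    rw [e]
    have hS' : ∀ k (α : Form 7 k N), AlgIdeal T k α ↔ AlgIdeal S k α := by
      intro k α
      rw [hT']
      constructor
      · refine fun H => H.trans ?_
        rintro k β (hβ | hβ)
        · exact ((h.algIdeal_pull_leafEDS_iff hκ k β).2 (.of hβ)).trans fun k γ hγ => .of (.inl hγ)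
        · exact .of (.inr hβ)
      · refine fun H => H.trans ?_
        rintro k β (hβ | hβ)
        · exact ((h.algIdeal_pull_leafEDS_iff hκ k β).1 (.of hβ)).trans fun k γ hγ => .of (.inl hγ)
        · exact .of (.inr hβ)
    rw [← algIdeal_pullSet_congr hv hS']
    exact ⟨fun H => H.pullSet_mono hv (S := 𝓑.carrier) fun k β hβ => (hT k β).1 hβ,
      fun H => H.trans (by rintro k _ ⟨β, hβ, rfl⟩; exact .of ⟨β, (hT k β).2 (.of hβ), rfl⟩)⟩
  · intro x v hx hπ
    have h1 := tang_comp (n := 7) (m := 7) (p := 5) x (h.smooth x) (hv x)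
    have h2 : tang (n := 7) (m := 5) π x
        (tang (n := 7) (m := 7) (Subtype.val : (⊤ : TopologicalSpace.Opens N) → N) x v) = 0 :=
      (DFunLike.congr_fun h1 v).symm.trans hπ
    have h3 : tang (n := 7) (m := 7) (Subtype.val : (⊤ : TopologicalSpace.Opens N) → N) x v = 0 := by
      refine eq_zero_of_forall_coframe (hκ.frame.2 x) fun i => ?_
      by_cases hi : i < 5
      · exact (h.ker x _).1 h2 i hi
      · obtain rfl | rfl : i = 5 ∨ i = 6 := by omega
        · exact (pullback_apply_one (n := 7) (m := 7) Subtype.val (κ 5) x v).symm.trans (hx 0)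
        · exact (pullback_apply_one (n := 7) (m := 7) Subtype.val (κ 6) x v).symm.trans (hx 1)
    exact (hv' x).1 (h3.trans (map_zero _).symm)

end Extensions

/-! ### The system on the total space -/

section Assembly

variable {N : Type*} [TopologicalSpace N] [ChartedSpace (EuclideanSpace ℝ (Fin 7)) N]
  {M : Type*} [TopologicalSpace M] [ChartedSpace (EuclideanSpace ℝ (Fin 5)) M]
  {Mb : Type*} [TopologicalSpace Mb] [ChartedSpace (EuclideanSpace ℝ (Fin 5)) Mb]
  [IsManifold (𝓡 7) ∞ N] [IsManifold (𝓡 5) ∞ M] [IsManifold (𝓡 5) ∞ Mb]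
  {Ω : Forms7 N} {ε : ℝ} {c : Coeffs N}

open IsInvariantCoframing (system mem_θ mem_αα mem_ββ)

/-- The generators of the system `𝓑`. -/
def Forms7.generators (Ω : Forms7 N) : GradedSet 7 N :=
  gens {Ω.w0, Ω.wb, Ω.γ} {fwedge Ω.w1 Ω.w2, fwedge Ω.w3 Ω.w4}

namespace Forms7

omit [IsManifold (𝓡 7) ∞ N]

lemma w0_mem : AlgIdeal Ω.generators 1 Ω.w0 := .of (k := 1) (.inl rfl)

lemma wb_mem : AlgIdeal Ω.generators 1 Ω.wb := .of (k := 1) (.inr (.inl rfl))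

lemma γ_mem : AlgIdeal Ω.generators 1 Ω.γ := .of (k := 1) (.inr (.inr rfl))

lemma w12_mem : AlgIdeal Ω.generators 2 (fwedge Ω.w1 Ω.w2) := .of (k := 2) (.inl rfl)

lemma w34_mem : AlgIdeal Ω.generators 2 (fwedge Ω.w3 Ω.w4) := .of (k := 2) (.inr rfl)

end Forms7

namespace TypeACongruences

omit [IsManifold (𝓡 7) ∞ N] in
lemma isSmooth_generators (hΩ : Ω.IsCoframing) :
    ∀ k, ∀ α ∈ Ω.generators k, IsSmooth α := by
  have s1 : IsSmooth Ω.w1 := hΩ.1 3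
  have s2 : IsSmooth Ω.w2 := hΩ.1 4
  have s3 : IsSmooth Ω.w3 := hΩ.1 5
  have s4 : IsSmooth Ω.w4 := hΩ.1 6
  refine forall_gens_iff (P := fun k α => IsSmooth α).2 ⟨?_, ?_⟩
  · rintro _ (rfl | rfl | rfl)
    exacts [hΩ.1 0, hΩ.1 1, hΩ.1 2]
  · rintro _ (rfl | rfl)
    exacts [s1.fwedge s2, s3.fwedge s4]

/-- The two products differ by multiples of `γ`. In an ideal containing `γ`, the left and right
generators can thus be exchanged for those of `𝓑`. -/
lemma w34'_mem (hΩ : Ω.IsCoframing) (hc : TypeACongruences Ω ε c) {S : GradedSet 7 N}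
    (hγ : AlgIdeal S 1 Ω.γ) : AlgIdeal S 2 (fwedge Ω.w3 Ω.w4) ↔
      AlgIdeal S 2 (fwedge (Ω.w3' c) (Ω.w4' c)) := by
  have s3 : IsSmooth Ω.w3 := hΩ.1 5
  have s4 : IsSmooth Ω.w4 := hΩ.1 6
  have sγ : IsSmooth Ω.γ := hΩ.1 2
  constructor
  · intro h
    rw [w3'_eq]
    exact fwedge_shift_mem hc.B4_smooth.neg hc.B3_smooth s3 s4 hγ sγ h
  · intro h
    have s3' : IsSmooth (Ω.w3' c) := by rw [w3'_eq]; exact isSmooth_shift s3 sγ hc.B4_smooth.neg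
    have s4' : IsSmooth (Ω.w4' c) := isSmooth_shift s4 sγ hc.B3_smooth
    have h' := fwedge_shift_mem (g := fun x => -c.B3 x) hc.B4_smooth hc.B3_smooth.neg s3' s4' hγ sγ h
    have e3 : (fun x => Ω.w3' c x + c.B4 x • Ω.γ x) = Ω.w3 := by
      funext x; ext v
      change Ω.w3 x v - c.B4 x * Ω.γ x v + c.B4 x * Ω.γ x v = Ω.w3 x v
      ring
    have e4 : (fun x => Ω.w4' c x + -c.B3 x • Ω.γ x) = Ω.w4 := by
      funext x; ext v
      change Ω.w4 x v + c.B3 x * Ω.γ x v + (-c.B3 x) * Ω.γ x v = Ω.w4 x v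
      ring
    rw [e3, e4] at h'
    exact h'

lemma w12'_mem (hΩ : Ω.IsCoframing) (hc : TypeACongruences Ω ε c) {S : GradedSet 7 N}
    (hγ : AlgIdeal S 1 Ω.γ) : AlgIdeal S 2 (fwedge Ω.w1 Ω.w2) ↔
      AlgIdeal S 2 (fwedge (Ω.w1' c) (Ω.w2' c)) := by
  have s3 : IsSmooth Ω.w1 := hΩ.1 3
  have s4 : IsSmooth Ω.w2 := hΩ.1 4
  have sγ : IsSmooth Ω.γ := hΩ.1 2
  constructor
  · intro h
    rw [w1'_eq]
    exact fwedge_shift_mem hc.B2_smooth.neg hc.B1_smooth s3 s4 hγ sγ h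
  · intro h
    have s3' : IsSmooth (Ω.w1' c) := by rw [w1'_eq]; exact isSmooth_shift s3 sγ hc.B2_smooth.neg
    have s4' : IsSmooth (Ω.w2' c) := isSmooth_shift s4 sγ hc.B1_smooth
    have h' := fwedge_shift_mem (g := fun x => -c.B1 x) hc.B2_smooth hc.B1_smooth.neg s3' s4' hγ sγ h
    have e3 : (fun x => Ω.w1' c x + c.B2 x • Ω.γ x) = Ω.w1 := by
      funext x; ext v
      change Ω.w1 x v - c.B2 x * Ω.γ x v + c.B2 x * Ω.γ x v = Ω.w1 x v
      ring
    have e4 : (fun x => Ω.w2' c x + -c.B1 x • Ω.γ x) = Ω.w2 := by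
      funext x; ext v
      change Ω.w2 x v + c.B1 x * Ω.γ x v + (-c.B1 x) * Ω.γ x v = Ω.w2 x v
      ring
    rw [e3, e4] at h'
    exact h'

omit [IsManifold (𝓡 7) ∞ N] in
lemma system_leftFrame : system (Ω.leftFrame c) =
    gens {Ω.w0} {fwedge Ω.w1 Ω.w2, fwedge (Ω.w3' c) (Ω.w4' c)} := rfl

omit [IsManifold (𝓡 7) ∞ N] in
lemma system_rightFrame : system (Ω.rightFrame c) =
    gens {Ω.wb} {fwedge (Ω.w1' c) (Ω.w2' c), fwedge Ω.w3 Ω.w4} := rfl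

lemma system_leftFrame_le (hΩ : Ω.IsCoframing) (hc : TypeACongruences Ω ε c) :
    ∀ k, ∀ α ∈ system (Ω.leftFrame c) k, AlgIdeal Ω.generators k α := by
  rw [system_leftFrame]
  refine forall_gens_iff (P := fun k α => AlgIdeal Ω.generators k α).2 ⟨?_, ?_⟩
  · rintro _ rfl; exact Forms7.w0_mem
  · rintro _ (rfl | rfl)
    · exact Forms7.w12_mem
    · exact (w34'_mem hΩ hc Forms7.γ_mem).1 Forms7.w34_mem

lemma system_rightFrame_le (hΩ : Ω.IsCoframing) (hc : TypeACongruences Ω ε c) :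
    ∀ k, ∀ α ∈ system (Ω.rightFrame c) k, AlgIdeal Ω.generators k α := by
  rw [system_rightFrame]
  refine forall_gens_iff (P := fun k α => AlgIdeal Ω.generators k α).2 ⟨?_, ?_⟩
  · rintro _ rfl; exact Forms7.wb_mem
  · rintro _ (rfl | rfl)
    · exact (w12'_mem hΩ hc Forms7.γ_mem).1 Forms7.w12_mem
    · exact Forms7.w34_mem

lemma generators_iff_left (hΩ : Ω.IsCoframing) (hc : TypeACongruences Ω ε c) (k : ℕ)
    (α : Form 7 k N) : AlgIdeal Ω.generators k α ↔
      AlgIdeal (fun k => system (Ω.leftFrame c) k ∪ gens {Ω.wb, Ω.γ} ∅ k) k α := by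
  set S : GradedSet 7 N := fun k => system (Ω.leftFrame c) k ∪ gens {Ω.wb, Ω.γ} ∅ k with hS
  have hγ : AlgIdeal S 1 Ω.γ := .of (k := 1) (.inr (.inr rfl))
  have hb : AlgIdeal S 1 Ω.wb := .of (k := 1) (.inr (.inl rfl))
  constructor
  · refine fun H => H.trans (forall_gens_iff (P := fun k α => AlgIdeal S k α).2 ⟨?_, ?_⟩)
    · rintro _ (rfl | rfl | rfl)
      · exact .of (k := 1) (.inl (Set.mem_singleton Ω.w0))
      · exact hb
      · exact hγ
    · rintro _ (rfl | rfl)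
      · exact .of (k := 2) (.inl (Set.mem_insert (fwedge Ω.w1 Ω.w2) _))
      · refine (w34'_mem hΩ hc hγ).2 (.of (k := 2) (.inl ?_))
        exact Set.mem_insert_of_mem _ (Set.mem_singleton (fwedge (Ω.w3' c) (Ω.w4' c)))
  · refine fun H => H.trans ?_
    rintro k β (hβ | hβ)
    · exact system_leftFrame_le hΩ hc k β hβ
    · refine forall_gens_iff (P := fun k α => AlgIdeal Ω.generators k α).2 ⟨?_, by simp⟩ k β hβ
      rintro _ (rfl | rfl)
      exacts [Forms7.wb_mem, Forms7.γ_mem]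

lemma generators_iff_right (hΩ : Ω.IsCoframing) (hc : TypeACongruences Ω ε c) (k : ℕ)
    (α : Form 7 k N) : AlgIdeal Ω.generators k α ↔
      AlgIdeal (fun k => system (Ω.rightFrame c) k ∪ gens {Ω.w0, Ω.γ} ∅ k) k α := by
  set S : GradedSet 7 N := fun k => system (Ω.rightFrame c) k ∪ gens {Ω.w0, Ω.γ} ∅ k with hS
  have hγ : AlgIdeal S 1 Ω.γ := .of (k := 1) (.inr (.inr rfl))
  have hb : AlgIdeal S 1 Ω.w0 := .of (k := 1) (.inr (.inl rfl))
  constructor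
  · refine fun H => H.trans (forall_gens_iff (P := fun k α => AlgIdeal S k α).2 ⟨?_, ?_⟩)
    · rintro _ (rfl | rfl | rfl)
      · exact hb
      · exact .of (k := 1) (.inl (Set.mem_singleton Ω.wb))
      · exact hγ
    · rintro _ (rfl | rfl)
      · refine (w12'_mem hΩ hc hγ).2 (.of (k := 2) (.inl ?_))
        exact Set.mem_insert (fwedge (Ω.w1' c) (Ω.w2' c)) _
      · exact .of (k := 2) (.inl (Set.mem_insert_of_mem _ (Set.mem_singleton (fwedge Ω.w3 Ω.w4))))
  · refine fun H => H.trans ?_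
    rintro k β (hβ | hβ)
    · exact system_rightFrame_le hΩ hc k β hβ
    · refine forall_gens_iff (P := fun k α => AlgIdeal Ω.generators k α).2 ⟨?_, by simp⟩ k β hβ
      rintro _ (rfl | rfl)
      exacts [Forms7.w0_mem, Forms7.γ_mem]

/-- Modulo `γ`, every product in the congruence contains `ω⁰` or `ω̄⁰`, so `dγ` vanishes on pairs of
vectors annihilated by all three forms. -/
lemma d_γ_mem (hΩ : Ω.IsCoframing) (hc : TypeACongruences Ω ε c) :
    AlgIdeal Ω.generators 2 (d Ω.γ) := by
  have hΩ' : IsFrame Ω.frame := hΩ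
  have sγ : IsSmooth Ω.γ := hΩ.1 2
  refine AlgIdeal.of_components_two hΩ' sγ.d fun i j hij => ?_
  by_cases hi : i = 0 ∨ i = 1 ∨ i = 2
  · refine .inl (AlgIdeal.wedge ?_ (hΩ'.1 j))
    rcases hi with rfl | rfl | rfl
    exacts [Forms7.w0_mem, Forms7.wb_mem, Forms7.γ_mem]
  by_cases h1 : i = 3 ∧ j = 4
  · obtain ⟨rfl, rfl⟩ := h1; exact .inl Forms7.w12_mem
  by_cases h2 : i = 5 ∧ j = 6
  · obtain ⟨rfl, rfl⟩ := h2; exact .inl Forms7.w34_mem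
  refine .inr fun x => ?_
  set u := dualVec (fun a => Ω.frame a x) i with hu
  set v := dualVec (fun a => Ω.frame a x) j with hv
  have hz : ∀ a : Fin 7, (a = 0 ∨ a = 1 ∨ a = 2) →
      Ω.frame a x ![u] = 0 ∧ Ω.frame a x ![v] = 0 := by
    intro a ha
    rw [hu, hv, coframe_dualVec (hΩ'.2 x), coframe_dualVec (hΩ'.2 x), if_neg (by omega),
      if_neg (by omega)]
    exact ⟨rfl, rfl⟩
  obtain ⟨h0u, h0v⟩ : Ω.w0 x ![u] = 0 ∧ Ω.w0 x ![v] = 0 := hz 0 (by simp)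
  obtain ⟨hbu, hbv⟩ : Ω.wb x ![u] = 0 ∧ Ω.wb x ![v] = 0 := hz 1 (by simp)
  obtain ⟨hγu, hγv⟩ : Ω.γ x ![u] = 0 ∧ Ω.γ x ![v] = 0 := hz 2 (by simp)
  have h : d Ω.γ x ![u, v] -
      (c.C0 x * wedge (Ω.w0 x) (Ω.wb x) ![u, v] +
        (c.C1 x * wedge (Ω.w1 x) (Ω.w0 x) ![u, v] + c.C2 x * wedge (Ω.w2 x) (Ω.w0 x) ![u, v] +
          c.C3 x * wedge (Ω.w3 x) (Ω.w0 x) ![u, v] + c.C4 x * wedge (Ω.w4 x) (Ω.w0 x) ![u, v]) +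
        (c.D1 x * wedge (Ω.w1 x) (Ω.wb x) ![u, v] + c.D2 x * wedge (Ω.w2 x) (Ω.wb x) ![u, v] +
          c.D3 x * wedge (Ω.w3 x) (Ω.wb x) ![u, v] + c.D4 x * wedge (Ω.w4 x) (Ω.wb x) ![u, v])) =
      0 :=
    eval_zeroMod_one (hc.d_γ x) (eval_span_eq_zero (s := {Ω.γ x}) (by
      rintro _ rfl; exact hγu)) (eval_span_eq_zero (s := {Ω.γ x}) (by rintro _ rfl; exact hγv))
  have e : ∀ a b : Cov 7 1, b ![u] = 0 → b ![v] = 0 → wedge a b ![u, v] = 0 := by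
    intro a b hbu hbv
    refine (wedge_one_one_apply a b _).trans ?_
    simp [hbu, hbv]
  rw [e _ _ hbu hbv, e _ _ h0u h0v, e _ _ h0u h0v, e _ _ h0u h0v, e _ _ h0u h0v, e _ _ hbu hbv,
    e _ _ hbu hbv, e _ _ hbu hbv, e _ _ hbu hbv] at h
  simpa using h

/-- Neither half suffices alone. The left ideal accounts for `ω⁰` and `ω¹∧ω²`, which carry no
correction there; the right one accounts for `ω̄⁰` and `ω³∧ω⁴`; only `γ` needs its own congruence.
-/
lemma d_generators_mem (hΩ : Ω.IsCoframing) (hc : TypeACongruences Ω ε c)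
    (hL : IsInvariantCoframing (Ω.leftFrame c) c.A (fun _ => 1))
    (hR : IsInvariantCoframing (Ω.rightFrame c) (fun _ => 1) (fun x => ε * c.A x)) :
    ∀ k, ∀ α ∈ Ω.generators k, AlgIdeal Ω.generators (k + 1) (d α) := by
  have h1 := fun k α (hα : α ∈ system (Ω.leftFrame c) k) =>
    (hL.d_system_mem k α hα).trans (system_leftFrame_le hΩ hc)
  have h2 := fun k α (hα : α ∈ system (Ω.rightFrame c) k) =>
    (hR.d_system_mem k α hα).trans (system_rightFrame_le hΩ hc)
  refine forall_gens_iff (P := fun k α => AlgIdeal Ω.generators (k + 1) (d α)).2 ⟨?_, ?_⟩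
  · rintro _ (rfl | rfl | rfl)
    · exact h1 1 _ (Set.mem_singleton Ω.w0)
    · exact h2 1 _ (Set.mem_singleton Ω.wb)
    · exact d_γ_mem hΩ hc
  · rintro _ (rfl | rfl)
    · exact h1 2 _ (Set.mem_insert (fwedge Ω.w1 Ω.w2) _)
    · exact h2 2 _ (Set.mem_insert_of_mem _ (Set.mem_singleton (fwedge Ω.w3 Ω.w4)))

/-- The system `𝓑`. -/
def backlundEDS (hΩ : Ω.IsCoframing) (hc : TypeACongruences Ω ε c)
    (hL : IsInvariantCoframing (Ω.leftFrame c) c.A (fun _ => 1))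
    (hR : IsInvariantCoframing (Ω.rightFrame c) (fun _ => 1) (fun x => ε * c.A x)) : EDS 7 N :=
  EDS.ofGens Ω.generators (isSmooth_generators hΩ) (d_generators_mem hΩ hc hL hR)

end TypeACongruences

end Assembly

/-! ### Fibres as leaves -/

section LeafSpace

variable {N : Type*} [TopologicalSpace N] [ChartedSpace (EuclideanSpace ℝ (Fin 7)) N]
  {M : Type*} [TopologicalSpace M] [ChartedSpace (EuclideanSpace ℝ (Fin 5)) M]
  [IsManifold (𝓡 7) ∞ N] [IsManifold (𝓡 5) ∞ M]

/-- Every point of a fibre is joined inside it to the point of the section, so fibres are connected.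
-/
lemma IsLeafProjection.isLeafSpace {κ : Fin 7 → Form 7 1 N} {P Q : N → ℝ} {π : N → M}
    {s : M → N} (h : IsLeafProjection κ π s) (hκ : IsInvariantCoframing κ P Q) :
    IsLeafSpace (n := 7) (m := 5) ![κ 0, κ 1, κ 2, κ 3, κ 4] π := by
  refine ⟨h.smooth, fun y => ⟨s y, h.proj_section y⟩, h.surjective_tang hκ, fun y => ⟨⟨s y,
    h.proj_section y⟩, isPreconnected_of_forall (s y) ?_⟩, fun x v => (h.ker x v).trans ⟨?_, ?_⟩⟩
  · rintro x rfl
    obtain ⟨c, hc, h0, h1, hπ⟩ := h.path x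
    refine ⟨Set.range c, ?_, ⟨0, h0⟩, ⟨_, h1⟩, isPreconnected_range hc.continuous⟩
    rintro _ ⟨t, rfl⟩
    exact hπ t
  · intro H i
    fin_cases i
    exacts [H 0 (by decide), H 1 (by decide), H 2 (by decide), H 3 (by decide), H 4 (by decide)]
  · intro H i hi
    obtain rfl | rfl | rfl | rfl | rfl : i = 0 ∨ i = 1 ∨ i = 2 ∨ i = 3 ∨ i = 4 := by omega
    exacts [H 0, H 1, H 2, H 3, H 4]

end LeafSpace

/-! ### Genericity, characteristic bundles and adaptedness -/

section Assembly

variable {N : Type*} [TopologicalSpace N] [ChartedSpace (EuclideanSpace ℝ (Fin 7)) N]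
  {M : Type*} [TopologicalSpace M] [ChartedSpace (EuclideanSpace ℝ (Fin 5)) M]
  {Mb : Type*} [TopologicalSpace Mb] [ChartedSpace (EuclideanSpace ℝ (Fin 5)) Mb]
  [IsManifold (𝓡 7) ∞ N] [IsManifold (𝓡 5) ∞ M] [IsManifold (𝓡 5) ∞ Mb]
  {Ω : Forms7 N} {ε : ℝ} {c : Coeffs N} {π : N → M} {s : M → N} {πb : N → Mb} {sb : Mb → N}

namespace TypeACongruences

lemma bundle_backlundEDS (hΩ : Ω.IsCoframing) (hc : TypeACongruences Ω ε c)
    (hL : IsInvariantCoframing (Ω.leftFrame c) c.A (fun _ => 1))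
    (hR : IsInvariantCoframing (Ω.rightFrame c) (fun _ => 1) (fun x => ε * c.A x)) (x : N) :
    (backlundEDS hΩ hc hL hR).bundle x = spanAt ![Ω.w0, Ω.wb, Ω.γ] x := by
  have hΩ' : IsFrame Ω.frame := hΩ
  refine le_antisymm (Submodule.span_le.2 ?_) (Submodule.span_le.2 ?_)
  · rintro _ ⟨α, hα, rfl⟩
    have hα' : AlgIdeal Ω.generators 1 α := hα
    have h0 : ∀ j : Fin 7, 3 ≤ j → α x ![dualVec (fun a => Ω.frame a x) j] = 0 := by
      intro j hj
      rw [← const_eq_vecOne]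
      refine hα'.apply_const_eq_zero ?_
      have e : ∀ i : Fin 7, i < 3 → Ω.frame i x ![dualVec (fun a => Ω.frame a x) j] = 0 := by
        intro i hi
        rw [coframe_dualVec (hΩ'.2 x), if_neg (by omega)]
      rintro _ (rfl | rfl | rfl)
      exacts [e 0 (by decide), e 1 (by decide), e 2 (by decide)]
    change α x ∈ spanAt ![Ω.w0, Ω.wb, Ω.γ] x
    rw [cov_one_eq_sum (hΩ'.2 x) (α x)]
    refine Submodule.sum_mem _ fun j _ => ?_
    rcases lt_or_ge j 3 with hj | hj
    · refine Submodule.smul_mem _ _ (Submodule.subset_span ?_)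
      obtain rfl | rfl | rfl : j = 0 ∨ j = 1 ∨ j = 2 := by omega
      exacts [⟨0, rfl⟩, ⟨1, rfl⟩, ⟨2, rfl⟩]
    · rw [h0 j hj, zero_smul]
      exact Submodule.zero_mem _
  · rintro _ ⟨i, rfl⟩
    refine Submodule.subset_span ?_
    fin_cases i
    exacts [⟨Ω.w0, Forms7.w0_mem, rfl⟩, ⟨Ω.wb, Forms7.wb_mem, rfl⟩, ⟨Ω.γ, Forms7.γ_mem, rfl⟩]

lemma firstGenericity (hΩ : Ω.IsCoframing)
    (hL : IsInvariantCoframing (Ω.leftFrame c) c.A (fun _ => 1))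
    (hR : IsInvariantCoframing (Ω.rightFrame c) (fun _ => 1) (fun x => ε * c.A x))
    (hl : IsLeafProjection (Ω.leftFrame c) π s) (hr : IsLeafProjection (Ω.rightFrame c) πb sb) :
    FirstGenericity (hl.leafEDS hL) (hr.leafEDS hR) π πb := by
  have hΩ' : IsFrame Ω.frame := hΩ
  intro x
  rw [hl.pullbackBundle_leafEDS, hr.pullbackBundle_leafEDS, Submodule.eq_bot_iff]
  rintro a ⟨h0, hb⟩
  obtain ⟨r, hr0⟩ := Submodule.mem_span_singleton.1 h0
  obtain ⟨t, ht⟩ := Submodule.mem_span_singleton.1 hb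
  have hr1 : r • Ω.w0 x = a := hr0
  have ht1 : t • Ω.wb x = a := ht
  have e1 : Ω.w0 x ![dualVec (fun a => Ω.frame a x) 0] = 1 :=
    (coframe_dualVec (hΩ'.2 x) 0 0).trans (if_pos rfl)
  have e2 : Ω.wb x ![dualVec (fun a => Ω.frame a x) 0] = 0 :=
    (coframe_dualVec (hΩ'.2 x) 1 0).trans (if_neg (by decide))
  have e3 : r * Ω.w0 x ![dualVec (fun a => Ω.frame a x) 0] =
      t * Ω.wb x ![dualVec (fun a => Ω.frame a x) 0] :=
    DFunLike.congr_fun (hr1.trans ht1.symm) ![dualVec (fun a => Ω.frame a x) 0]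
  rw [e1, e2, mul_one, mul_zero] at e3
  rw [← hr1, e3, zero_smul]

/-- Modulo `𝓑¹`, nonvanishing sections of the contact bundles have derivatives proportional to `A
ω¹∧ω² + ω³∧ω⁴` and `ω¹∧ω² + εA ω³∧ω⁴`. These are independent because `εA² - 1 ≠ 0`. -/
lemma secondGenericity (hΩ : Ω.IsCoframing) (hc : TypeACongruences Ω ε c)
    (hL : IsInvariantCoframing (Ω.leftFrame c) c.A (fun _ => 1))
    (hR : IsInvariantCoframing (Ω.rightFrame c) (fun _ => 1) (fun x => ε * c.A x))
    (hl : IsLeafProjection (Ω.leftFrame c) π s) (hr : IsLeafProjection (Ω.rightFrame c) πb sb) :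
    SecondGenericity (backlundEDS hΩ hc hL hR) (hl.leafEDS hL) (hr.leafEDS hR) π πb := by
  have hΩ' : IsFrame Ω.frame := hΩ
  intro x θ hθ hθx θb hθb hθbx a b
  constructor
  swap
  · rintro ⟨rfl, rfl⟩
    rw [zero_smul, zero_smul, add_zero]
    exact Submodule.zero_mem _
  intro H
  rw [bundle_backlundEDS] at H
  obtain ⟨g, hg, h1⟩ := hl.d_section_apply hL hθ x hθx
  obtain ⟨gb, hgb, h2⟩ := hr.d_section_apply hR hθb x hθbx
  have h1' : ∀ u v, Ω.w0 x ![u] = 0 → Ω.w0 x ![v] = 0 → pullback (n := 7) π (d θ) x ![u, v] =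
      g * (c.A x * wedge (Ω.w1 x) (Ω.w2 x) ![u, v] +
        1 * wedge (Ω.w3' c x) (Ω.w4' c x) ![u, v]) := h1
  have h2' : ∀ u v, Ω.wb x ![u] = 0 → Ω.wb x ![v] = 0 → pullback (n := 7) πb (d θb) x ![u, v] =
      gb * (1 * wedge (Ω.w1' c x) (Ω.w2' c x) ![u, v] +
        (ε * c.A x) * wedge (Ω.w3 x) (Ω.w4 x) ![u, v]) := h2
  have e : ∀ a b : Cov 7 1, ∀ u v, wedge a b ![u, v] = a ![u] * b ![v] - a ![v] * b ![u] :=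
    fun a b u v => wedge_one_one_apply a b _
  have hd : ∀ i j : Fin 7, Ω.frame i x ![dualVec (fun a => Ω.frame a x) j] =
      if i = j then 1 else 0 := coframe_dualVec (hΩ'.2 x)
  have hw0 : ∀ j, Ω.w0 x ![dualVec (fun a => Ω.frame a x) j] = if 0 = j then 1 else 0 := hd 0
  have hwb : ∀ j, Ω.wb x ![dualVec (fun a => Ω.frame a x) j] = if 1 = j then 1 else 0 := hd 1
  have hγ : ∀ j, Ω.γ x ![dualVec (fun a => Ω.frame a x) j] = if 2 = j then 1 else 0 := hd 2
  have hw1 : ∀ j, Ω.w1 x ![dualVec (fun a => Ω.frame a x) j] = if 3 = j then 1 else 0 := hd 3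
  have hw2 : ∀ j, Ω.w2 x ![dualVec (fun a => Ω.frame a x) j] = if 4 = j then 1 else 0 := hd 4
  have hw3 : ∀ j, Ω.w3 x ![dualVec (fun a => Ω.frame a x) j] = if 5 = j then 1 else 0 := hd 5
  have hw4 : ∀ j, Ω.w4 x ![dualVec (fun a => Ω.frame a x) j] = if 6 = j then 1 else 0 := hd 6
  have key : ∀ i j : Fin 7, 3 ≤ i → 3 ≤ j →
      a * pullback (n := 7) π (d θ) x
        ![dualVec (fun a => Ω.frame a x) i, dualVec (fun a => Ω.frame a x) j] +
      b * pullback (n := 7) πb (d θb) x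
        ![dualVec (fun a => Ω.frame a x) i, dualVec (fun a => Ω.frame a x) j] = 0 := by
    intro i j hi hj
    have hz : ∀ i : Fin 7, 3 ≤ i → ∀ a' ∈ spanAt ![Ω.w0, Ω.wb, Ω.γ] x,
        a' ![dualVec (fun a => Ω.frame a x) i] = 0 := by
      intro i hi
      refine eval_spanAt_eq_zero fun k => ?_
      fin_cases k
      · exact (hw0 i).trans (if_neg (by omega))
      · exact (hwb i).trans (if_neg (by omega))
      · exact (hγ i).trans (if_neg (by omega))
    exact eval_zeroMod_one H (hz i hi) (hz j hj)
  -- The values on the vectors dual to `ω¹, ω²` and to `ω³, ω⁴` are the two linear equations `A (ag)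
  -- + (b gb) = 0` and `(ag) + εA (b gb) = 0`.
  have k1 := key 3 4 (by decide) (by decide)
  have k2 := key 5 6 (by decide) (by decide)
  rw [h1' _ _ (by rw [hw0]; simp) (by rw [hw0]; simp),
    h2' _ _ (by rw [hwb]; simp) (by rw [hwb]; simp)] at k1 k2
  simp only [e, w1'_apply, w2'_apply, w3'_apply, w4'_apply, hγ, hw1, hw2, hw3, hw4] at k1 k2
  simp only [Fin.reduceEq, reduceIte] at k1 k2
  have hA := hc.A_sq x
  -- As `ε² = 1`, the assumption `A² ≠ ε` is equivalent to `εA² ≠ 1`.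
  have hε : ε * ε = 1 := by rcases hc.sign with h | h <;> rw [h] <;> norm_num
  have hA' : ε * c.A x ^ 2 - 1 ≠ 0 := by
    intro h0
    apply hA
    linear_combination ε * h0 - c.A x ^ 2 * hε
  have ha : (a * g) * (ε * c.A x ^ 2 - 1) = 0 := by
    linear_combination ε * c.A x * k1 - k2
  have hag : a * g = 0 := (mul_eq_zero.1 ha).resolve_right hA'
  have hbg : b * gb = 0 := by linear_combination k1 - c.A x * hag
  exact ⟨(mul_eq_zero.1 hag).resolve_right hg, (mul_eq_zero.1 hbg).resolve_right hgb⟩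

lemma isTypeA (hΩ : Ω.IsCoframing) (hc : TypeACongruences Ω ε c)
    (hL : IsInvariantCoframing (Ω.leftFrame c) c.A (fun _ => 1))
    (hR : IsInvariantCoframing (Ω.rightFrame c) (fun _ => 1) (fun x => ε * c.A x))
    (hl : IsLeafProjection (Ω.leftFrame c) π s) (hr : IsLeafProjection (Ω.rightFrame c) πb sb) :
    IsTypeA (backlundEDS hΩ hc hL hR) (hl.leafEDS hL) (hr.leafEDS hR) π πb where
  backlund :=
    { left_MA := hl.isHyperbolicMA hL
      right_MA := hr.isHyperbolicMA hR
      left_ext := hl.isIntegrableExtension hL _ (fun _ _ => Iff.rfl) (generators_iff_left hΩ hc)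
      right_ext :=
        hr.isIntegrableExtension hR _ (fun _ _ => Iff.rfl) (generators_iff_right hΩ hc) }
  first := firstGenericity hΩ hL hR hl hr
  second := secondGenericity hΩ hc hL hR hl hr

lemma isCharacteristicPair (hΩ : Ω.IsCoframing) (hc : TypeACongruences Ω ε c)
    (hL : IsInvariantCoframing (Ω.leftFrame c) c.A (fun _ => 1))
    (hR : IsInvariantCoframing (Ω.rightFrame c) (fun _ => 1) (fun x => ε * c.A x)) :
    IsCharacteristicPair (backlundEDS hΩ hc hL hR)
      (spanAt ![Ω.w0, Ω.wb, Ω.γ, Ω.w1, Ω.w2]) (spanAt ![Ω.w0, Ω.wb, Ω.γ, Ω.w3, Ω.w4]) := by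
  intro x
  let V : TopologicalSpace.Opens N := ⊤
  have hv : ContMDiff (𝓡 7) (𝓡 7) ∞ (Subtype.val : V → N) := contMDiff_subtype_val
  let r : Form 7 1 N → Form 7 1 V := pullback (n := 7) (Subtype.val : V → N)
  refine ⟨V, trivial, ![r Ω.w0, r Ω.wb, r Ω.γ], r Ω.w1, r Ω.w2, r Ω.w3, r Ω.w4,
    Forms7.IsCoframing.restrict hΩ V, fun k α => ?_, fun x => ⟨?_, ?_⟩⟩
  · have e : gens (Set.range ![r Ω.w0, r Ω.wb, r Ω.γ])
        {fwedge (r Ω.w1) (r Ω.w2), fwedge (r Ω.w3) (r Ω.w4)} =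
        pullSet (n := 7) (Subtype.val : V → N) Ω.generators := by
      rw [Forms7.generators, pullSet_gens]
      congr 1
      · simp only [Set.image_insert_eq, Set.image_singleton, Matrix.range_cons,
          Matrix.range_empty, Set.union_empty, Set.singleton_union]
        rfl
      · rw [Set.image_pair, pullback_fwedge, pullback_fwedge]
    rw [e]
    exact ⟨fun H => H.pullSet_mono hv (S := (backlundEDS hΩ hc hL hR).carrier) fun k β hβ => hβ,
      fun H => H.trans (by rintro k _ ⟨β, hβ, rfl⟩; exact .of ⟨β, .of hβ, rfl⟩)⟩
  · rw [pullbackBundle_spanAt]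
    congr 1
    funext i; fin_cases i <;> rfl
  · rw [pullbackBundle_spanAt]
    congr 1
    funext i; fin_cases i <;> rfl

lemma isZeroAdapted (hΩ : Ω.IsCoframing) (hc : TypeACongruences Ω ε c)
    (hL : IsInvariantCoframing (Ω.leftFrame c) c.A (fun _ => 1))
    (hR : IsInvariantCoframing (Ω.rightFrame c) (fun _ => 1) (fun x => ε * c.A x))
    (hl : IsLeafProjection (Ω.leftFrame c) π s) (hr : IsLeafProjection (Ω.rightFrame c) πb sb) :
    IsZeroAdapted Ω (backlundEDS hΩ hc hL hR) (hl.leafEDS hL) (hr.leafEDS hR) π πb where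
  coframing := hΩ
  span_w0 x := (hl.pullbackBundle_leafEDS hL x).symm
  span_wb x := (hr.pullbackBundle_leafEDS hR x).symm
  span_B x := (bundle_backlundEDS hΩ hc hL hR x).symm
  characteristic := isCharacteristicPair hΩ hc hL hR
  congruences := ⟨ε, c, hc⟩

end TypeACongruences

end Assembly

section

open Filter Topology

/-! ### Composition operators on spaces of continuous maps -/

section Superposition

variable {K : Type} [TopologicalSpace K] [CompactSpace K] {E F : Type}
  [NormedAddCommGroup E] [NormedSpace ℝ E] [NormedAddCommGroup F] [NormedSpace ℝ F]

/-- Pointwise application of a continuous family of operators to a continuous family of vectors. -/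
def applyCLM : C(K, E →L[ℝ] F) →L[ℝ] C(K, E) →L[ℝ] C(K, F) :=
  LinearMap.mkContinuous₂ (LinearMap.mk₂ ℝ
      (fun (L : C(K, E →L[ℝ] F)) (u : C(K, E)) => (⟨fun s => L s (u s), by fun_prop⟩ : C(K, F)))
      (fun _ _ _ => rfl) (fun _ _ _ => rfl) (fun L u v => ContinuousMap.ext fun s => (L s).map_add (u s) (v s))
      (fun r L u => ContinuousMap.ext fun s => (L s).map_smul r (u s))) 1 (by
    intro L u
    rw [one_mul]
    refine (ContinuousMap.norm_le _ (by positivity)).2 fun s => ?_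
    exact ((L s).le_opNorm _).trans (mul_le_mul (L.norm_coe_le_norm s) (u.norm_coe_le_norm s)
      (norm_nonneg _) (by positivity)))

lemma contDiff_applyCLM {n : WithTop ℕ∞} : ContDiff ℝ n
    (applyCLM : C(K, E →L[ℝ] F) →L[ℝ] C(K, E) →L[ℝ] C(K, F)) :=
  ContinuousLinearMap.contDiff _

lemma hasFDerivAt_applyCLM (L : C(K, E →L[ℝ] F)) : HasFDerivAt
    (applyCLM : C(K, E →L[ℝ] F) →L[ℝ] C(K, E) →L[ℝ] C(K, F)) applyCLM L :=
  ContinuousLinearMap.hasFDerivAt _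

/-- The remainder has to be small uniformly over `K`. Strict differentiability of `f` at `u s`,
together with continuity of `f'` and `u`, gives the estimate near each `s`; compactness makes it
uniform. -/
lemma hasFDerivAt_postcomp {f : C(E, F)} {f' : C(E, E →L[ℝ] F)}
    (hf : ∀ x, HasStrictFDerivAt f (f' x) x) (u : C(K, E)) :
    HasFDerivAt (fun u : C(K, E) => f.comp u) (applyCLM (f'.comp u)) u := by
  rw [hasFDerivAt_iff_isLittleO_nhds_zero, Asymptotics.isLittleO_iff]
  intro ε hε
  have h1 : ∀ s ∈ (Set.univ : Set K), ∀ᶠ z : E × K in 𝓝 ((0 : E), s),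
      ‖f (u z.2 + z.1) - f (u z.2) - f' (u z.2) z.1‖ ≤ ε * ‖z.1‖ := by
    intro s _
    have a1 : Tendsto (fun z : E × K => (u z.2 + z.1, u z.2)) (𝓝 ((0 : E), s))
        (𝓝 (u s, u s)) := by
      have : Continuous fun z : E × K => (u z.2 + z.1, u z.2) := by fun_prop
      simpa using this.tendsto ((0 : E), s)
    have a2 := a1.eventually
      (Asymptotics.isLittleO_iff.1 (hf (u s)).isLittleO (half_pos hε))
    have a3 : ∀ᶠ z : E × K in 𝓝 ((0 : E), s), ‖f' (u z.2) - f' (u s)‖ < ε / 2 := by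
      have : Continuous fun z : E × K => ‖f' (u z.2) - f' (u s)‖ := by fun_prop
      exact this.tendsto ((0 : E), s) |>.eventually_lt_const (by simpa using half_pos hε)
    filter_upwards [a2, a3] with z h2 h3
    simp only [add_sub_cancel_left] at h2
    have e : f (u z.2 + z.1) - f (u z.2) - f' (u z.2) z.1 =
        (f (u z.2 + z.1) - f (u z.2) - f' (u s) z.1) - (f' (u z.2) - f' (u s)) z.1 := by
      rw [sub_apply]; abel
    rw [e]
    refine (norm_sub_le _ _).trans ?_
    have h4 := (f' (u z.2) - f' (u s)).le_opNorm z.1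
    have h5 := mul_le_mul_of_nonneg_right h3.le (norm_nonneg z.1)
    linarith
  have h2 := isCompact_univ.eventually_forall_of_forall_eventually
    (P := fun (h : E) (s : K) => ‖f (u s + h) - f (u s) - f' (u s) h‖ ≤ ε * ‖h‖) h1
  obtain ⟨δ, hδ, h3⟩ := Metric.eventually_nhds_iff_ball.1 h2
  filter_upwards [Metric.ball_mem_nhds (0 : C(K, E)) hδ] with h hh
  refine (ContinuousMap.norm_le _ (by positivity)).2 fun s => ?_
  have h4 : ‖h s‖ < δ := (h.norm_coe_le_norm s).trans_lt (mem_ball_zero_iff.1 hh)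
  exact (h3 (h s) (mem_ball_zero_iff.2 h4) s trivial).trans
    (mul_le_mul_of_nonneg_left (h.norm_coe_le_norm s) hε.le)

/-- The derivative of `u ↦ f ∘ u` is built from the composition operator of `f'`, which has the same
form with another target. This is why `F` is quantified inside the induction. -/
lemma contDiff_postcomp_nat (n : ℕ) : ∀ {F : Type} [NormedAddCommGroup F] [NormedSpace ℝ F]
    {f : C(E, F)}, ContDiff ℝ ∞ f → ContDiff ℝ n (fun u : C(K, E) => f.comp u) := by
  induction n with
  | zero => intro F _ _ f _; exact contDiff_zero.2 f.continuous_postcomp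
  | succ n ih =>
    intro F _ _ f hf
    have h1 : ContDiff ℝ ∞ (fderiv ℝ f) := hf.fderiv_right (by simp)
    let f' : C(E, E →L[ℝ] F) := ⟨fderiv ℝ f, h1.continuous⟩
    refine contDiff_succ_iff_hasFDerivAt.2 ⟨fun u => applyCLM (f'.comp u), ?_, fun u =>
      hasFDerivAt_postcomp (fun x => hf.contDiffAt.hasStrictFDerivAt (by simp)) u⟩
    exact (contDiff_applyCLM (K := K) (E := E) (F := F)).comp (ih (f := f') h1)

lemma contDiff_postcomp {f : C(E, F)} (hf : ContDiff ℝ ∞ f) :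
    ContDiff ℝ ∞ (fun u : C(K, E) => f.comp u) :=
  contDiff_infty.2 fun n => contDiff_postcomp_nat n hf

end Superposition

/-! ### Integral curves depending smoothly on parameters -/

section Flow

variable {E : Type} [NormedAddCommGroup E] [NormedSpace ℝ E] [CompleteSpace E]

/-- Extension of a path by constants. -/
def extendPath (f : C(unitInterval, E)) (t : ℝ) : E := f (Set.projIcc 0 1 zero_le_one t)

omit [NormedSpace ℝ E] [CompleteSpace E] in
lemma continuous_extendPath (f : C(unitInterval, E)) : Continuous (extendPath f) :=
  f.continuous.comp continuous_projIcc

omit [NormedSpace ℝ E] [CompleteSpace E] in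
lemma extendPath_coe (f : C(unitInterval, E)) (t : unitInterval) : extendPath f t = f t := by
  rw [extendPath, Set.projIcc_val]

/-- Integration of paths. -/
def integralCLM : C(unitInterval, E) →L[ℝ] C(unitInterval, E) :=
  LinearMap.mkContinuous
    { toFun := fun f => ⟨fun t => ∫ s in (0 : ℝ)..t, extendPath f s,
        (intervalIntegral.continuous_primitive (fun a b =>
          (continuous_extendPath f).intervalIntegrable a b) 0).comp continuous_subtype_val⟩
      map_add' := fun f g => ContinuousMap.ext fun t =>
        intervalIntegral.integral_add ((continuous_extendPath f).intervalIntegrable _ _)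
          ((continuous_extendPath g).intervalIntegrable _ _)
      map_smul' := fun r f => ContinuousMap.ext fun t =>
        intervalIntegral.integral_smul r _ } 1 (by
    intro f
    rw [one_mul]
    refine (ContinuousMap.norm_le _ (norm_nonneg _)).2 fun t => ?_
    refine (intervalIntegral.norm_integral_le_of_norm_le_const (C := ‖f‖)
      fun s _ => f.norm_coe_le_norm _).trans ?_
    rw [sub_zero, abs_of_nonneg t.2.1]
    exact mul_le_of_le_one_right (norm_nonneg _) t.2.2)

omit [CompleteSpace E] in
lemma contDiff_integralCLM {n : WithTop ℕ∞} : ContDiff ℝ n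
    (integralCLM : C(unitInterval, E) →L[ℝ] C(unitInterval, E)) :=
  ContinuousLinearMap.contDiff _

/-- The solution operator of a linear family of differential equations depends smoothly on the
parameters. -/
lemma exists_smooth_flow {Z : C(E, E →L[ℝ] E)} (hZ : ContDiff ℝ ∞ Z) (A B : E →L[ℝ] E) (p : E) :
    ∃ u : E → C(unitInterval, E), u 0 = .const _ p ∧ ∀ᶠ z in 𝓝 0, ContDiffAt ℝ ∞ u z ∧
      u z = .const _ p + ContinuousLinearMap.const ℝ _ (A z) +
        integralCLM (applyCLM (Z.comp (u z)) (ContinuousLinearMap.const ℝ _ (B z))) := by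
  -- Zeros are solutions of the integral equation for `u' = Z(u)(B z)`, `u(0) = p + A z`. The
  -- parameter scales the velocity, so unit existence time is available for small `z`.
  let F : E × C(unitInterval, E) → C(unitInterval, E) := fun q =>
    q.2 - (.const _ p + ContinuousLinearMap.const ℝ _ (A q.1) +
      integralCLM (applyCLM (Z.comp q.2) (ContinuousLinearMap.const ℝ _ (B q.1))))
  let q₀ : E × C(unitInterval, E) := (0, .const _ p)
  have hN : ContDiff ℝ ∞ fun q : E × C(unitInterval, E) => applyCLM (Z.comp q.2) :=
    ContDiff.comp (g := fun L : C(unitInterval, E →L[ℝ] E) => applyCLM L)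
      (f := fun q : E × C(unitInterval, E) => Z.comp q.2) contDiff_applyCLM
      ((contDiff_postcomp hZ).comp contDiff_snd)
  have hc : ∀ T : E →L[ℝ] E, ContDiff ℝ ∞ fun q : E × C(unitInterval, E) =>
      (ContinuousLinearMap.const ℝ unitInterval (T q.1) : C(unitInterval, E)) := fun T =>
    (ContinuousLinearMap.const ℝ unitInterval).contDiff.comp (T.contDiff.comp contDiff_fst)
  have hF : ContDiff ℝ ∞ F :=
    contDiff_snd.sub ((contDiff_const.add (hc A)).add
      (contDiff_integralCLM.comp (hN.clm_apply (hc B))))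
  have hF0 : F q₀ = 0 := by
    simp [F, q₀]
  -- At `z = 0` the integral vanishes for every `u`, so that `F (0, u) = u - p` and the partial
  -- derivative in `u` is the identity.
  have h2 : fderiv ℝ F q₀ ∘L .inr ℝ E C(unitInterval, E) = .id ℝ _ := by
    have a1 : HasFDerivAt (fun u : C(unitInterval, E) => ((0 : E), u)) (.inr ℝ E _)
        (ContinuousMap.const _ p : C(unitInterval, E)) := hasFDerivAt_prodMk_right 0 _
    have a2 := (hF.differentiable (by simp) q₀).hasFDerivAt.comp
      (ContinuousMap.const _ p : C(unitInterval, E)) a1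
    have a3 : (F ∘ fun u : C(unitInterval, E) => ((0 : E), u)) = fun u => u - .const _ p := by
      funext u
      simp [F]
    rw [a3] at a2
    exact a2.unique ((hasFDerivAt_id _).sub_const _)
  -- The implicit function is a component of the local inverse of `(z, u) ↦ (z, F (z, u))`.
  let Φ : E × C(unitInterval, E) → E × C(unitInterval, E) := fun q => (q.1, F q)
  have hΦ : ContDiff ℝ ∞ Φ := contDiff_fst.prodMk hF
  let T : (E × C(unitInterval, E)) ≃L[ℝ] E × C(unitInterval, E) :=
    (ContinuousLinearEquiv.refl ℝ E).skewProd (.refl ℝ _) (fderiv ℝ F q₀ ∘L .inl ℝ E _)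
  have hT' : (T : E × C(unitInterval, E) →L[ℝ] E × C(unitInterval, E)) =
      (ContinuousLinearMap.fst ℝ E C(unitInterval, E)).prod (fderiv ℝ F q₀) := by
    refine ContinuousLinearMap.ext fun v => Prod.ext rfl ?_
    have e : fderiv ℝ F q₀ (0, v.2) = v.2 := DFunLike.congr_fun h2 v.2
    change v.2 + fderiv ℝ F q₀ (v.1, 0) = fderiv ℝ F q₀ v
    conv_lhs => rw [← e, ← map_add]
    simp
  have hT : HasFDerivAt Φ (T : E × C(unitInterval, E) →L[ℝ] E × C(unitInterval, E)) q₀ := by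
    rw [hT']
    exact (hasFDerivAt_fst (p := q₀) (𝕜 := ℝ)).prodMk (hF.differentiable (by simp) q₀).hasFDerivAt
  let e := hΦ.contDiffAt.toOpenPartialHomeomorph Φ hT (by simp)
  have heq : ∀ q, e q = Φ q := fun q => rfl
  have hsrc : q₀ ∈ e.source := hΦ.contDiffAt.mem_toOpenPartialHomeomorph_source hT (by simp)
  have he0 : e q₀ = (0, 0) := by rw [heq]; exact Prod.ext rfl hF0
  have htgt : ((0 : E), (0 : C(unitInterval, E))) ∈ e.target := he0 ▸ e.map_source hsrc
  have hsymm0 : e.symm (0, 0) = q₀ := by rw [← he0, e.left_inv hsrc]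
  have hlim : Tendsto (fun z : E => (z, (0 : C(unitInterval, E)))) (𝓝 0) (𝓝 (0, 0)) :=
    (Continuous.prodMk_left 0).tendsto 0
  have hlim' : Tendsto (fun z : E => e.symm (z, 0)) (𝓝 0) (𝓝 q₀) := by
    have := (e.continuousAt_symm htgt).tendsto.comp hlim
    rwa [hsymm0] at this
  -- Smoothness of the inverse is wanted at all nearby points, not only at the centre; invertibility
  -- of the derivative is an open condition.
  have hinv : ∀ᶠ q in 𝓝 q₀, ∃ T' : (E × C(unitInterval, E)) ≃L[ℝ] E × C(unitInterval, E),
      (T' : E × C(unitInterval, E) →L[ℝ] E × C(unitInterval, E)) = fderiv ℝ Φ q := by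
    have c1 : ContinuousAt (fderiv ℝ Φ) q₀ := (hΦ.continuous_fderiv (by simp)).continuousAt
    have hn := T.nhds
    rw [← hT.fderiv] at hn
    exact c1 hn
  refine ⟨fun z => (e.symm (z, 0)).2, congrArg Prod.snd hsymm0, ?_⟩
  filter_upwards [hlim'.eventually hinv, hlim.eventually (e.open_target.mem_nhds htgt)] with z hz hzt
  obtain ⟨T', hT'⟩ := hz
  have hr : Φ (e.symm (z, 0)) = (z, 0) := e.right_inv hzt
  have hr1 : (e.symm (z, 0)).1 = z := congrArg Prod.fst hr
  have hr2 : F (e.symm (z, 0)) = 0 := congrArg Prod.snd hr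
  constructor
  · have h3 : ContDiffAt ℝ ∞ e.symm (z, 0) := e.contDiffAt_symm (f₀' := T') hzt
      (by rw [hT']; exact (hΦ.differentiable (by simp) _).hasFDerivAt) hΦ.contDiffAt
    exact contDiff_snd.contDiffAt.comp z (h3.comp z (contDiff_prodMk_left 0).contDiffAt)
  · have h3 := sub_eq_zero.1 hr2
    rw [hr1] at h3
    exact h3

end Flow

end

section

open Filter Topology

/-! ### The Frobenius theorem in a vector space -/

section Flat

variable {E : Type} [NormedAddCommGroup E] [NormedSpace ℝ E] [CompleteSpace E]

lemma extendPath_of_eq {f g : C(unitInterval, E)} {y : E}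
    (h : f = .const _ y + integralCLM g) {t : ℝ} (ht : t ∈ Set.Icc (0 : ℝ) 1) :
    extendPath f t = y + ∫ s in (0 : ℝ)..t, extendPath g s := by
  rw [extendPath_coe f ⟨t, ht⟩]
  conv_lhs => rw [h]
  rfl

/-- Variations of integral curves of a Frobenius system stay tangent to the system. -/
lemma tangent_of_linearized {K : E → E →L[ℝ] E} {Z : C(E, E →L[ℝ] E)}
    {Z' : C(E, E →L[ℝ] E →L[ℝ] E)} (hK : ContDiff ℝ ∞ K) (hZ : ∀ x, HasFDerivAt Z (Z' x) x)
    {U : Set E} (hU : IsOpen U) (hKZ : ∀ x ∈ U, ∀ v, K x (Z x v) = v)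
    {P : E →L[ℝ] E} (hP : ∀ v, P (P v) = P v)
    (hF : ∀ x ∈ U, ∀ z w, P (K x z) = 0 → P (K x w) = 0 →
      P (fderiv ℝ K x z w) = P (fderiv ℝ K x w z))
    {u J : C(unitInterval, E)} {y b w : E} (hb : P b = 0) (hw : P w = 0)
    (hu : u = .const _ y + integralCLM (applyCLM (Z.comp u) (.const _ b)))
    (hJ : J = .const _ 0 + integralCLM (applyCLM (Z.comp u) (.const _ w) +
      applyCLM (applyCLM (Z'.comp u) J) (.const _ b)))
    (huU : ∀ s, u s ∈ U) : P (K (u 1) (J 1)) = 0 := by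
  set f := applyCLM (Z.comp u) (.const _ b) with hf
  set g := applyCLM (Z.comp u) (.const _ w) + applyCLM (applyCLM (Z'.comp u) J) (.const _ b) with hg
  set x : ℝ → E := fun t => y + ∫ s in (0 : ℝ)..t, extendPath f s with hx
  set j : ℝ → E := fun t => 0 + ∫ s in (0 : ℝ)..t, extendPath g s with hj
  have dx : ∀ t, HasDerivAt x (extendPath f t) t := fun t =>
    ((continuous_extendPath f).integral_hasStrictDerivAt 0 t).hasDerivAt.const_add y
  have dj : ∀ t, HasDerivAt j (extendPath g t) t := fun t =>
    ((continuous_extendPath g).integral_hasStrictDerivAt 0 t).hasDerivAt.const_add 0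
  have ex : ∀ t ∈ Set.Icc (0 : ℝ) 1, extendPath u t = x t := fun t ht => extendPath_of_eq hu ht
  have ej : ∀ t ∈ Set.Icc (0 : ℝ) 1, extendPath J t = j t := fun t ht => extendPath_of_eq hJ ht
  have hxU : ∀ t ∈ Set.Icc (0 : ℝ) 1, x t ∈ U := fun t ht => ex t ht ▸ huU _
  have cx : Continuous x := continuous_iff_continuousAt.2 fun t => (dx t).continuousAt
  have hKd : Differentiable ℝ K := hK.differentiable (by simp)
  have hK' : Continuous (fderiv ℝ K) := hK.continuous_fderiv (by simp)
  -- The component of the variation transverse to the system. It starts at zero, and the aim is a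
  -- linear differential inequality for it.
  set h : ℝ → E := fun t => P (K (x t) (j t)) with hh
  have dh : ∀ t, HasDerivAt h
      (P (fderiv ℝ K (x t) (extendPath f t) (j t) + K (x t) (extendPath g t))) t := fun t =>
    P.hasFDerivAt.comp_hasDerivAt t
      (((hKd (x t)).hasFDerivAt.comp_hasDerivAt t (dx t)).clm_apply (dj t))
  have key : ∀ t ∈ Set.Icc (0 : ℝ) 1,
      P (fderiv ℝ K (x t) (extendPath f t) (j t) + K (x t) (extendPath g t)) =
        P (fderiv ℝ K (x t) (Z (x t) b) (Z (x t) (h t))) -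
          P (fderiv ℝ K (x t) (Z (x t) (h t)) (Z (x t) b)) := by
    intro t ht
    have ef : extendPath f t = Z (x t) b := by rw [← ex t ht]; rfl
    have eg : extendPath g t = Z (x t) w + Z' (x t) (j t) b := by
      rw [← ex t ht, ← ej t ht]; rfl
    rw [ef, eg]
    have hxt := hxU t ht
    -- Obtained by differentiating the constant map `q ↦ K q (Z q b)`.
    have d1 : K (x t) (Z' (x t) (j t) b) = -fderiv ℝ K (x t) (j t) (Z (x t) b) := by
      have a1 : HasFDerivAt (fun q => K q (Z q b))
          ((K (x t)).comp ((Z' (x t)).flip b) + (fderiv ℝ K (x t)).flip (Z (x t) b)) (x t) := by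
        have := (hKd (x t)).hasFDerivAt.clm_apply ((hZ (x t)).clm_apply (hasFDerivAt_const b (x t)))
        simpa using this
      have a2 : HasFDerivAt (fun q => K q (Z q b)) (0 : E →L[ℝ] E) (x t) := by
        refine (hasFDerivAt_const b (x t)).congr_of_eventuallyEq ?_
        filter_upwards [hU.mem_nhds hxt] with q hq
        exact hKZ q hq b
      have a3 := DFunLike.congr_fun (a1.unique a2) (j t)
      exact eq_neg_of_add_eq_zero_left a3
    -- Subtracting `Z h` removes the transverse part of `j`. The integrability condition applies to
    -- this vector and to the velocity `Z b`, leaving in the derivative of `h` only terms linear in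
    -- `h`.
    have hY : P (K (x t) (j t - Z (x t) (h t))) = 0 := by
      rw [map_sub, hKZ _ hxt, map_sub, hh]
      simp [hP]
    have hX : P (K (x t) (Z (x t) b)) = 0 := by rw [hKZ _ hxt, hb]
    have h1 := hF _ hxt _ _ hX hY
    simp only [map_sub, sub_apply] at h1
    have e1 : K (x t) (Z (x t) w + Z' (x t) (j t) b) = w - fderiv ℝ K (x t) (j t) (Z (x t) b) := by
      rw [(K (x t)).map_add, hKZ _ hxt, d1, sub_eq_add_neg]
    rw [e1, P.map_add, P.map_sub, hw]
    rw [sub_eq_sub_iff_add_eq_add] at h1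
    rw [zero_sub, ← sub_eq_add_neg, sub_eq_sub_iff_add_eq_add, h1, add_comm]
  let c : ℝ → ℝ := fun t => ‖P‖ * (2 * (‖fderiv ℝ K (x t)‖ * ‖Z (x t) b‖ * ‖Z (x t)‖))
  have hc : Continuous c := by
    have c1 : Continuous fun t => Z (x t) := Z.continuous.comp cx
    have c2 : Continuous fun t => fderiv ℝ K (x t) := hK'.comp cx
    have c3 : Continuous fun t => ‖fderiv ℝ K (x t)‖ :=
      (continuous_norm (E := E →L[ℝ] E →L[ℝ] E)).comp c2
    exact continuous_const.mul (continuous_const.mul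
      ((c3.mul (c1.clm_apply continuous_const).norm).mul c1.norm))
  obtain ⟨C, hC⟩ := (isCompact_Icc (a := (0 : ℝ)) (b := 1)).exists_bound_of_continuousOn
    hc.continuousOn
  have hz := eq_zero_of_abs_deriv_le_mul_abs_self_of_eq_zero_right (K := C) (f := h) (a := 0) (b := 1)
    (continuous_iff_continuousAt.2 fun t => (dh t).continuousAt).continuousOn
    (fun t _ => (dh t).hasDerivWithinAt) (by simp [hh, hj]) (by
      intro t ht
      have ht' := Set.Ico_subset_Icc_self ht
      rw [key t ht']
      have b1 : ‖fderiv ℝ K (x t) (Z (x t) b) (Z (x t) (h t))‖ ≤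
          ‖fderiv ℝ K (x t)‖ * ‖Z (x t) b‖ * (‖Z (x t)‖ * ‖h t‖) :=
        ((fderiv ℝ K (x t)).le_opNorm₂ _ _).trans
          (mul_le_mul_of_nonneg_left ((Z (x t)).le_opNorm _) (by positivity))
      have b2 : ‖fderiv ℝ K (x t) (Z (x t) (h t)) (Z (x t) b)‖ ≤
          ‖fderiv ℝ K (x t)‖ * (‖Z (x t)‖ * ‖h t‖) * ‖Z (x t) b‖ :=
        ((fderiv ℝ K (x t)).le_opNorm₂ _ _).trans
          (mul_le_mul_of_nonneg_right
            (mul_le_mul_of_nonneg_left ((Z (x t)).le_opNorm _) (by positivity)) (by positivity))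
      rw [← map_sub]
      have hCt : c t ≤ C := (le_abs_self _).trans (hC t ht')
      calc _ ≤ ‖P‖ * ‖_‖ := P.le_opNorm _
        _ ≤ ‖P‖ * (‖fderiv ℝ K (x t)‖ * ‖Z (x t) b‖ * (‖Z (x t)‖ * ‖h t‖) +
            ‖fderiv ℝ K (x t)‖ * (‖Z (x t)‖ * ‖h t‖) * ‖Z (x t) b‖) :=
          mul_le_mul_of_nonneg_left ((norm_sub_le _ _).trans (add_le_add b1 b2)) (norm_nonneg _)
        _ = c t * ‖h t‖ := by simp only [c]; ring
        _ ≤ C * ‖h t‖ := mul_le_mul_of_nonneg_right hCt (norm_nonneg _)) 1 (by simp)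
  have e1 : u 1 = x 1 := by rw [← ex 1 (by simp)]; exact (extendPath_coe u 1).symm
  have e2 : J 1 = j 1 := by rw [← ej 1 (by simp)]; exact (extendPath_coe J 1).symm
  rw [e1, e2]
  exact hz

/-- The analytic part of the Frobenius theorem: a map that straightens the system. -/
lemma exists_straightening {K Z : E → E →L[ℝ] E} (hK : ContDiff ℝ ∞ K) (hZ : ContDiff ℝ ∞ Z)
    {U : Set E} (hU : IsOpen U) {p : E} (hp : p ∈ U) (hKZ : ∀ x ∈ U, ∀ v, K x (Z x v) = v)
    {P : E →L[ℝ] E} (hP : ∀ v, P (P v) = P v)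
    (hF : ∀ x ∈ U, ∀ z w, P (K x z) = 0 → P (K x w) = 0 →
      P (fderiv ℝ K x z w) = P (fderiv ℝ K x w z)) :
    ∃ G : E → E, G 0 = p ∧ HasFDerivAt G (Z p) 0 ∧
      ∀ᶠ z in 𝓝 0, ContDiffAt ℝ ∞ G z ∧ ∀ w, P w = 0 → P (K (G z) (fderiv ℝ G z w)) = 0 := by
  let Zc : C(E, E →L[ℝ] E) := ⟨Z, hZ.continuous⟩
  let Z' : C(E, E →L[ℝ] E →L[ℝ] E) := ⟨fderiv ℝ Z, hZ.continuous_fderiv (by simp)⟩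
  have hZ' : ∀ x, HasStrictFDerivAt Zc (Z' x) x := fun x =>
    hZ.contDiffAt.hasStrictFDerivAt (by simp)
  -- The `P` part of the parameter displaces the initial point and the complementary part is the
  -- velocity along the system. Thus `G z` is reached from `p + Z p (P z)` at unit time by the frame
  -- field with components `B z`.
  set A : E →L[ℝ] E := (Z p).comp P with hA
  set B : E →L[ℝ] E := ContinuousLinearMap.id ℝ E - P with hB
  have hPB : ∀ v, P (B v) = 0 := fun v => by simp [hB, hP]
  obtain ⟨u, hu0, hu⟩ := exists_smooth_flow (Z := Zc) hZ A B p
  have hus : ∀ᶠ z in 𝓝 (0 : E), ContDiffAt ℝ ∞ u z := hu.mono fun z hz => hz.1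
  have hue := hu.mono fun z hz => hz.2
  have hd : ∀ᶠ z in 𝓝 (0 : E), DifferentiableAt ℝ u z :=
    hus.mono fun z hz => hz.differentiableAt (by simp)
  -- Differentiation of the integral equation in `z`; the derivative in a direction `w` satisfies
  -- the linearized equation.
  have hder : ∀ᶠ z in 𝓝 (0 : E), ∀ w, fderiv ℝ u z w = .const _ (A w) + integralCLM
      (applyCLM (Zc.comp (u z)) (.const _ (B w)) +
        applyCLM (applyCLM (Z'.comp (u z)) (fderiv ℝ u z w)) (.const _ (B z))) := by
    filter_upwards [hd, hue.eventually_nhds] with z hz hze w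
    have a1 : HasFDerivAt (fun z => applyCLM (Zc.comp (u z)))
        ((applyCLM : C(unitInterval, E →L[ℝ] E) →L[ℝ] _).comp
          ((applyCLM (Z'.comp (u z))).comp (fderiv ℝ u z))) z :=
      HasFDerivAt.comp (g := fun L : C(unitInterval, E →L[ℝ] E) => applyCLM L)
        (f := fun z => Zc.comp (u z)) z (hasFDerivAt_applyCLM _)
          ((hasFDerivAt_postcomp hZ' (u z)).comp z hz.hasFDerivAt)
    have cc : ∀ T : E →L[ℝ] E, HasFDerivAt (fun z =>
        (ContinuousLinearMap.const ℝ unitInterval (T z) : C(unitInterval, E)))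
        ((ContinuousLinearMap.const ℝ unitInterval).comp T) z := fun T => by
      have : HasFDerivAt ((ContinuousLinearMap.const ℝ unitInterval).comp T)
        ((ContinuousLinearMap.const ℝ unitInterval).comp T) z := ContinuousLinearMap.hasFDerivAt _
      exact this
    have a2 := (ContinuousLinearMap.hasFDerivAt (integralCLM : C(unitInterval, E) →L[ℝ] _)).comp z
      (a1.clm_apply (cc B))
    have a3 := (((cc A).const_add (ContinuousMap.const _ p)).add a2).congr_of_eventuallyEq hze
    have a4 := DFunLike.congr_fun (hz.hasFDerivAt.unique a3) w
    exact a4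
  let ev : C(unitInterval, E) →L[ℝ] E := ContinuousMap.evalCLM ℝ 1
  have hev : ∀ z, DifferentiableAt ℝ u z →
      HasFDerivAt (fun z => u z 1) (ev.comp (fderiv ℝ u z)) z := fun z hz =>
    (ContinuousLinearMap.hasFDerivAt ev).comp z hz.hasFDerivAt
  have hev' : ContDiff ℝ ∞ ev := ContinuousLinearMap.contDiff _
  refine ⟨fun z => u z 1, by simp [hu0], ?_, ?_⟩
  · convert hev 0 hd.self_of_nhds using 1
    ext w
    change Z p w = fderiv ℝ u 0 w 1
    rw [hder.self_of_nhds w]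
    -- At `z = 0` the velocity `B 0` is zero and the curve is constant, so the integral is `Z p (B
    -- w)` and the two parts add up to `Z p w`.
    change Z p w = Z p (P w) + ∫ s in (0 : ℝ)..(1 : unitInterval), (Z (u 0 _) (B w) +
      fderiv ℝ Z (u 0 _) (fderiv ℝ u 0 w _) (B 0))
    simp only [map_zero, add_zero, hu0, ContinuousMap.const_apply]
    simp [hB]
  · obtain ⟨δ, hδ, hball⟩ := Metric.isOpen_iff.1 hU p hp
    have hnear : ∀ᶠ z in 𝓝 (0 : E), u z ∈ Metric.ball (ContinuousMap.const _ p) δ := by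
      refine hus.self_of_nhds.continuousAt.eventually_mem ?_
      rw [hu0]
      exact Metric.ball_mem_nhds _ hδ
    filter_upwards [hd, hder, hue, hnear, hus] with z hz hzd hze hzn hzs
    refine ⟨hev'.contDiffAt.comp z hzs, fun w hw => ?_⟩
    rw [(hev z hz).fderiv]
    -- A direction in the kernel of `P` leaves the initial point fixed and varies only the velocity,
    -- as `tangent_of_linearized` requires.
    have hBw : B w = w := by simp [hB, hw]
    have hAw : A w = 0 := by simp [hA, hw]
    refine tangent_of_linearized (K := K) (Z := Zc) (Z' := Z') (u := u z) (J := fderiv ℝ u z w)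
      (y := p + A z) (b := B z) (w := w) hK (fun x => (hZ' x).hasFDerivAt) hU hKZ hP hF (hPB z)
      hw hze ?_ fun s => hball ?_
    · conv_lhs => rw [hzd w]
      rw [hBw, hAw]
    · exact Metric.mem_ball.2 ((ContinuousMap.dist_apply_le_dist s).trans_lt hzn)

/-- The Frobenius theorem in a vector space: a system with a flat chart. -/
lemma exists_flat_chart [FiniteDimensional ℝ E] {K Z : E → E →L[ℝ] E} (hK : ContDiff ℝ ∞ K)
    (hZ : ContDiff ℝ ∞ Z) {U : Set E} (hU : IsOpen U) {p : E} (hp : p ∈ U)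
    (hKZ : ∀ x ∈ U, ∀ v, K x (Z x v) = v) (hZK : ∀ x ∈ U, ∀ v, Z x (K x v) = v) {P : E →L[ℝ] E}
    (hP : ∀ v, P (P v) = P v)
    (hF : ∀ x ∈ U, ∀ z w, P (K x z) = 0 → P (K x w) = 0 →
      P (fderiv ℝ K x z w) = P (fderiv ℝ K x w z)) :
    ∃ ψ : OpenPartialHomeomorph E E, p ∈ ψ.source ∧ ψ.source ⊆ U ∧
      (∀ x ∈ ψ.source, ContDiffAt ℝ ∞ ψ x) ∧ (∀ y ∈ ψ.target, ContDiffAt ℝ ∞ ψ.symm y) ∧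
      ∀ x ∈ ψ.source, ∀ v, P (fderiv ℝ ψ x v) = 0 ↔ P (K x v) = 0 := by
  obtain ⟨G, hG0, hGd, hG⟩ := exists_straightening hK hZ hU hp hKZ hP hF
  let T : E ≃L[ℝ] E := ContinuousLinearEquiv.equivOfInverse (Z p) (K p) (hKZ p hp) (hZK p hp)
  have hT : HasFDerivAt G (T : E →L[ℝ] E) 0 := hGd
  have hs := hG.self_of_nhds.1
  let g₀ := hs.toOpenPartialHomeomorph G hT (by simp)
  have hinv : ∀ᶠ z in 𝓝 (0 : E), ∃ T' : E ≃L[ℝ] E, (T' : E →L[ℝ] E) = fderiv ℝ G z := by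
    have c1 : ContinuousAt (fderiv ℝ G) 0 :=
      (hs.fderiv_right (m := 0) (by simp)).continuousAt
    have hn := T.nhds
    rw [← hT.fderiv] at hn
    exact c1 hn
  have hGU : ∀ᶠ z in 𝓝 (0 : E), G z ∈ U :=
    hs.continuousAt.eventually_mem (by rw [hG0]; exact hU.mem_nhds hp)
  obtain ⟨O, hO, hOo, h0O⟩ := eventually_nhds_iff.1 (hG.and (hinv.and hGU))
  let g := g₀.restrOpen O hOo
  have hgs : ∀ z ∈ g.source, z ∈ O := fun z hz => hz.2
  have hgc : ∀ z, g z = G z := fun z => rfl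
  have h0 : (0 : E) ∈ g.source :=
    ⟨hs.mem_toOpenPartialHomeomorph_source hT (by simp), h0O⟩
  have hd : ∀ z ∈ g.source, ∃ T' : E ≃L[ℝ] E, (T' : E →L[ℝ] E) = fderiv ℝ G z ∧
      HasFDerivAt g (T' : E →L[ℝ] E) z := by
    intro z hz
    obtain ⟨h1, ⟨T', hT'⟩, -⟩ := hO z (hgs z hz)
    exact ⟨T', hT', by rw [hT']; exact (h1.1.differentiableAt (by simp)).hasFDerivAt⟩
  refine ⟨g.symm, ?_, ?_, ?_, ?_, ?_⟩
  · rw [← hG0]; exact g.map_source h0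
  · intro x hx
    have h1 := (hO _ (hgs _ (g.map_target hx))).2.2
    rw [← hgc, g.right_inv hx] at h1
    exact h1
  · intro x hx
    obtain ⟨T', -, hT'⟩ := hd _ (g.map_target hx)
    exact g.contDiffAt_symm hx hT' (hO _ (hgs _ (g.map_target hx))).1.1
  · intro z hz
    exact (hO z (hgs z hz)).1.1
  · intro x hx v
    have hz := g.map_target hx
    obtain ⟨T', hT1, hT2⟩ := hd _ hz
    have hxU : x ∈ U := by
      have h1 := (hO _ (hgs _ hz)).2.2
      rwa [← hgc, g.right_inv hx] at h1
    have htan := (hO _ (hgs _ hz)).1.2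
    rw [← hgc, g.right_inv hx] at htan
    have e1 : fderiv ℝ g.symm x = (T'.symm : E →L[ℝ] E) := (g.hasFDerivAt_symm hx hT2).fderiv
    rw [e1]
    -- the kernel of `P` is mapped onto itself, by a dimension count
    let D : E →ₗ[ℝ] E := (K x).toLinearMap ∘ₗ (T' : E →L[ℝ] E).toLinearMap
    have hD : Function.Injective D := by
      intro a b hab
      apply T'.injective
      have := congrArg (Z x) hab
      change Z x (K x (T' a)) = Z x (K x (T' b)) at this
      rwa [hZK x hxU, hZK x hxU] at this
    have hle : (LinearMap.ker P.toLinearMap).map D ≤ LinearMap.ker P.toLinearMap := by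
      rintro _ ⟨w, hw, rfl⟩
      have := htan w hw
      rw [← hT1] at this
      exact this
    have heq := Submodule.eq_of_le_of_finrank_eq hle
      (Submodule.equivMapOfInjective D hD _).finrank_eq.symm
    obtain ⟨w, rfl⟩ := T'.surjective v
    have e2 : (T'.symm : E →L[ℝ] E) (T' w) = w := T'.symm_apply_apply w
    rw [e2]
    constructor
    · intro hw
      have := htan w hw
      rw [← hT1] at this
      exact this
    · intro hw
      have h1 : D w ∈ LinearMap.ker P.toLinearMap := hw
      rw [← heq] at h1
      obtain ⟨w', hw', e⟩ := h1
      rw [← hD e]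
      exact hw'

end Flat

end

section

open Filter Topology

/-! ### Convexity of images of small balls -/

section ConvexBalls

variable {E : Type} [NormedAddCommGroup E] [InnerProductSpace ℝ E]

/-- A smooth change of coordinates maps small balls to convex sets. -/
lemma eventually_convex_image_ball [CompleteSpace E] (ψ : OpenPartialHomeomorph E E) {p : E}
    (hp : p ∈ ψ.source)
    (h1 : ContDiffAt ℝ ∞ ψ p) (h2 : ∀ y ∈ ψ.target, ContDiffAt ℝ ∞ ψ.symm y) :
    ∀ᶠ r in 𝓝[>] (0 : ℝ), Metric.ball p r ⊆ ψ.source ∧ Convex ℝ (ψ '' Metric.ball p r) := by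
  have hq := ψ.map_source hp
  have hGq : ψ.symm (ψ p) = p := ψ.left_inv hp
  obtain ⟨K, t₁, ht₁, hK⟩ := (h1.of_le (m := 1) (by exact_mod_cast le_top)).exists_lipschitzOnWith
  obtain ⟨L, t₂, ht₂, hL⟩ :=
    ((h2 _ hq).fderiv_right (m := 1) (by exact WithTop.coe_le_coe.2 le_top)).exists_lipschitzOnWith
  have hcont : ContinuousAt ψ.symm (ψ p) := (h2 _ hq).continuousAt
  have c1 : ∀ᶠ y in 𝓝 (ψ p), ψ.symm y ∈ t₁ := hcont.eventually_mem (by rwa [hGq])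
  -- Near the centre the factor `‖ψ.symm y - p‖` outweighs the product of the Lipschitz constants of
  -- `fderiv ψ.symm` and, twice, of `ψ`.
  have c2 : ∀ᶠ y in 𝓝 (ψ p), 2 * (‖ψ.symm y - p‖ * (L * (K * K))) < 1 := by
    have c : ContinuousAt (fun y => 2 * (‖ψ.symm y - p‖ * (L * (K * K) : ℝ))) (ψ p) :=
      ((hcont.sub continuousAt_const).norm.mul continuousAt_const).const_mul 2
    refine c.eventually_lt continuousAt_const ?_
    simp [hGq]
  obtain ⟨δ, hδ, hB⟩ := Metric.eventually_nhds_iff_ball.1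
    ((ψ.open_target.eventually_mem hq).and ((eventually_mem_set.2 ht₂).and (c1.and c2)))
  -- First-order convexity of `y ↦ ‖ψ.symm y - p‖²`: with `h = ψ.symm y - ψ.symm z`, the term `‖h‖²`
  -- of the expanded square dominates the Taylor error, which is at most a small constant times
  -- `‖h‖²`.
  have key : ∀ z ∈ Metric.ball (ψ p) δ, ∀ y ∈ Metric.ball (ψ p) δ,
      ‖ψ.symm z - p‖ ^ 2 + 2 * inner ℝ (ψ.symm z - p) (fderiv ℝ ψ.symm z (y - z)) ≤
        ‖ψ.symm y - p‖ ^ 2 := by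
    intro z hz y hy
    obtain ⟨hzt, -, hz1, hzs⟩ := hB z hz
    obtain ⟨hyt, -, hy1, -⟩ := hB y hy
    have hseg : segment ℝ z y ⊆ Metric.ball (ψ p) δ := (convex_ball _ _).segment_subset hz hy
    have b1 : ‖ψ.symm y - ψ.symm z - fderiv ℝ ψ.symm z (y - z)‖ ≤ L * ‖y - z‖ * ‖y - z‖ := by
      refine Convex.norm_image_sub_le_of_norm_hasFDerivWithin_le' (s := segment ℝ z y)
        (f' := fderiv ℝ ψ.symm) (fun x hx => ?_) (fun x hx => ?_) (convex_segment z y)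
        (left_mem_segment ℝ z y) (right_mem_segment ℝ z y)
      · exact ((h2 x (hB x (hseg hx)).1).differentiableAt (by simp)).hasFDerivAt.hasFDerivWithinAt
      · have := hL.dist_le_mul x (hB x (hseg hx)).2.1 z (hB z hz).2.1
        rw [dist_eq_norm, dist_eq_norm] at this
        exact this.trans (mul_le_mul_of_nonneg_left
          (by simpa [norm_sub_rev] using norm_sub_le_of_mem_segment hx) L.2)
    have b2 : ‖y - z‖ ≤ K * ‖ψ.symm y - ψ.symm z‖ := by
      have := hK.dist_le_mul _ hy1 _ hz1
      rwa [ψ.right_inv hyt, ψ.right_inv hzt, dist_eq_norm, dist_eq_norm] at this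
    set h := ψ.symm y - ψ.symm z with hh
    set D := fderiv ℝ ψ.symm z (y - z) with hD
    have e : ψ.symm y - p = (ψ.symm z - p) + h := by rw [hh]; abel
    rw [e, norm_add_sq_real]
    have b3 : inner ℝ (ψ.symm z - p) (D - h) ≤ ‖ψ.symm z - p‖ * (L * (K * K)) * ‖h‖ ^ 2 := by
      refine (real_inner_le_norm _ _).trans ?_
      rw [mul_assoc]
      refine mul_le_mul_of_nonneg_left ?_ (norm_nonneg _)
      rw [norm_sub_rev]
      refine b1.trans ?_
      calc (L : ℝ) * ‖y - z‖ * ‖y - z‖ ≤ L * (K * ‖h‖) * (K * ‖h‖) := by gcongr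
        _ = _ := by ring
    rw [inner_sub_right] at b3
    have b4 : 2 * (‖ψ.symm z - p‖ * (L * (K * K))) * ‖h‖ ^ 2 ≤ 1 * ‖h‖ ^ 2 :=
      mul_le_mul_of_nonneg_right hzs.le (sq_nonneg _)
    linarith
  have hnear : ∀ᶠ x in 𝓝 p, x ∈ ψ.source ∧ ψ x ∈ Metric.ball (ψ p) δ :=
    (ψ.open_source.eventually_mem hp).and
      (h1.continuousAt.eventually_mem (Metric.ball_mem_nhds _ hδ))
  obtain ⟨r₀, hr₀, hr⟩ := Metric.eventually_nhds_iff_ball.1 hnear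
  filter_upwards [Ioo_mem_nhdsGT hr₀] with r hr1
  have hsub : Metric.ball p r ⊆ Metric.ball p r₀ := Metric.ball_subset_ball hr1.2.le
  refine ⟨fun x hx => (hr x (hsub hx)).1, ?_⟩
  -- The image is a sublevel set of this convex function inside a ball.
  have himg : ψ '' Metric.ball p r =
      {y | y ∈ Metric.ball (ψ p) δ ∧ ‖ψ.symm y - p‖ ^ 2 < r ^ 2} := by
    ext y
    constructor
    · rintro ⟨x, hx, rfl⟩
      obtain ⟨hxs, hxb⟩ := hr x (hsub hx)
      refine ⟨hxb, ?_⟩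
      rw [ψ.left_inv hxs]
      rw [Metric.mem_ball, dist_eq_norm] at hx
      exact pow_lt_pow_left₀ hx (norm_nonneg _) two_ne_zero
    · rintro ⟨hy, hy'⟩
      refine ⟨ψ.symm y, ?_, ψ.right_inv (hB y hy).1⟩
      rw [Metric.mem_ball, dist_eq_norm]
      exact lt_of_pow_lt_pow_left₀ 2 hr1.1.le hy'
  rw [himg]
  rintro y₁ ⟨hy₁, h₁⟩ y₂ ⟨hy₂, h₂⟩ a b ha hb hab
  have hz := (convex_ball (ψ p) δ) hy₁ hy₂ ha hb hab
  refine ⟨hz, ?_⟩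
  set z := a • y₁ + b • y₂ with hzdef
  have k₁ := mul_le_mul_of_nonneg_left (key z hz y₁ hy₁) ha
  have k₂ := mul_le_mul_of_nonneg_left (key z hz y₂ hy₂) hb
  have e : a * inner ℝ (ψ.symm z - p) (fderiv ℝ ψ.symm z (y₁ - z)) +
      b * inner ℝ (ψ.symm z - p) (fderiv ℝ ψ.symm z (y₂ - z)) = 0 := by
    rw [← real_inner_smul_right, ← real_inner_smul_right, ← inner_add_right, ← map_smul,
      ← map_smul, ← map_add]
    have : a • (y₁ - z) + b • (y₂ - z) = 0 := by
      have e1 : a • (y₁ - z) + b • (y₂ - z) = a • y₁ + b • y₂ - (a + b) • z := by module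
      rw [e1, hab, one_smul, ← hzdef, sub_self]
    rw [this, map_zero, inner_zero_right]
  have e2 : (a + b) * ‖ψ.symm z - p‖ ^ 2 ≤
      a * ‖ψ.symm y₁ - p‖ ^ 2 + b * ‖ψ.symm y₂ - p‖ ^ 2 := by linarith
  rw [hab, one_mul] at e2
  have e3 : a * ‖ψ.symm y₁ - p‖ ^ 2 + b * ‖ψ.symm y₂ - p‖ ^ 2 < r ^ 2 := by
    rcases ha.lt_or_eq with ha' | rfl
    · have := mul_lt_mul_of_pos_left h₁ ha'
      have := mul_le_mul_of_nonneg_left h₂.le hb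
      have : a * r ^ 2 + b * r ^ 2 = r ^ 2 := by rw [← add_mul, hab, one_mul]
      linarith
    · rw [zero_add] at hab
      subst hab
      linarith
  exact e2.trans_lt e3

end ConvexBalls

/-! ### Leaf projections from flat charts with convex image -/

section Projection

/-- The projection to the first five coordinates. -/
def projFive : EuclideanSpace ℝ (Fin 7) →L[ℝ] EuclideanSpace ℝ (Fin 5) :=
  ((EuclideanSpace.equiv (Fin 5) ℝ).symm : (Fin 5 → ℝ) →L[ℝ] EuclideanSpace ℝ (Fin 5)).comp
    (ContinuousLinearMap.pi fun i => EuclideanSpace.proj (Fin.castLE (by decide) i))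

/-- The inclusion with last two coordinates zero. -/
def inclFive : EuclideanSpace ℝ (Fin 5) →L[ℝ] EuclideanSpace ℝ (Fin 7) :=
  ((EuclideanSpace.equiv (Fin 7) ℝ).symm : (Fin 7 → ℝ) →L[ℝ] EuclideanSpace ℝ (Fin 7)).comp
    (ContinuousLinearMap.pi fun i => if h : (i : ℕ) < 5 then EuclideanSpace.proj (⟨i, h⟩ : Fin 5)
      else 0)

lemma projFive_inclFive (v : EuclideanSpace ℝ (Fin 5)) : projFive (inclFive v) = v := by
  ext i
  simp [projFive, inclFive]

lemma projFive_eq_zero_iff (v : EuclideanSpace ℝ (Fin 7)) :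
    projFive v = 0 ↔ ∀ i : Fin 7, i < 5 → v i = 0 := by
  constructor
  · intro h i hi
    have := congrArg (fun w : EuclideanSpace ℝ (Fin 5) => w ⟨i, hi⟩) h
    simpa [projFive] using this
  · intro h
    ext i
    have h1 := h (Fin.castLE (by decide) i) (by
      rw [Fin.lt_def]; exact i.2)
    simpa [projFive] using h1

variable {N : Type*} [TopologicalSpace N] [ChartedSpace (EuclideanSpace ℝ (Fin 7)) N]
  [IsManifold (𝓡 7) ∞ N]

/-- A flat chart with convex image has a leaf projection. -/
lemma exists_isLeafProjection {κ : Fin 7 → Form 7 1 N}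
    (W : TopologicalSpace.Opens (EuclideanSpace ℝ (Fin 7)))
    (hW : Convex ℝ (W : Set (EuclideanSpace ℝ (Fin 7)))) {τ : N → EuclideanSpace ℝ (Fin 7)}
    (hτ : ContMDiff (𝓡 7) (𝓡 7) ∞ τ) (hτW : ∀ x, τ x ∈ W) {ρ : W → N}
    (hρ : ContMDiff (𝓡 7) (𝓡 7) ∞ ρ) (hτρ : ∀ w, τ (ρ w) = w) (hρτ : ∀ x, ρ ⟨τ x, hτW x⟩ = x)
    (hker : ∀ x v, (∀ i : Fin 7, i < 5 → tang (n := 7) (m := 7) τ x v i = 0) ↔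
      ∀ i : Fin 7, i < 5 → κ i x ![v] = 0) :
    ∃ (M : TopologicalSpace.Opens (EuclideanSpace ℝ (Fin 5))) (π : N → M) (s : M → N),
      IsLeafProjection κ π s := by
  have hopen : IsOpen (projFive '' (W : Set (EuclideanSpace ℝ (Fin 7)))) :=
    (projFive.isOpenMap fun v => ⟨inclFive v, projFive_inclFive v⟩) _ W.isOpen
  let M : TopologicalSpace.Opens (EuclideanSpace ℝ (Fin 5)) := ⟨_, hopen⟩
  -- Only the last two coordinates of `w` matter: the condition says that they, joined to `y`, give
  -- a point of `W`. Convexity of these sets permits gluing local constants by a partition of unity.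
  let t : M → Set (EuclideanSpace ℝ (Fin 7)) := fun y =>
    {w | w - inclFive (projFive w) + inclFive y ∈ W}
  have ht : ∀ y, Convex ℝ (t y) := by
    intro y w₁ hw₁ w₂ hw₂ a b ha hb hab
    have := hW hw₁ hw₂ ha hb hab
    have e : a • w₁ + b • w₂ - inclFive (projFive (a • w₁ + b • w₂)) + inclFive y =
        a • (w₁ - inclFive (projFive w₁) + inclFive y) +
          b • (w₂ - inclFive (projFive w₂) + inclFive y) := by
      have e1 : inclFive (y : EuclideanSpace ℝ (Fin 5)) = (a + b) • inclFive y := by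
        rw [hab, one_smul]
      conv_lhs => rw [e1]
      simp only [map_add, map_smul]
      module
    change _ ∈ W
    rw [e]
    exact this
  have : LocallyCompactSpace M := hopen.locallyCompactSpace
  obtain ⟨σ, hσ⟩ := exists_contMDiffMap_forall_mem_convex_of_local_const (n := ⊤) (𝓡 5) ht (by
    rintro ⟨_, w, hw, rfl⟩
    refine ⟨w, ?_⟩
    have c : Continuous fun y : M => w - inclFive (projFive w) + inclFive y := by fun_prop
    refine c.continuousAt.eventually_mem (W.isOpen.mem_nhds ?_)
    rw [sub_add_cancel]
    exact hw)
  let π : N → M := fun x => ⟨projFive (τ x), τ x, hτW x, rfl⟩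
  -- The first five coordinates of the glued map are replaced by `y`, which makes it a section of
  -- the projection.
  let s' : M → W := fun y => ⟨σ y - inclFive (projFive (σ y)) + inclFive y, hσ y⟩
  have hs' : ContMDiff (𝓡 5) (𝓡 7) ∞ s' := by
    rw [← ContMDiff.subtypeVal_comp_iff]
    have h1 : ContMDiff (𝓡 5) (𝓡 7) ∞ σ := σ.contMDiff
    have h2 : ContMDiff (𝓡 5) (𝓡 5) ∞ (Subtype.val : M → EuclideanSpace ℝ (Fin 5)) :=
      contMDiff_subtype_val
    exact (h1.sub (((inclFive.comp projFive).contDiff.contMDiff (n := ∞)).comp h1)).add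
      ((inclFive.contDiff.contMDiff (n := ∞)).comp h2)
  have hπ : ContMDiff (𝓡 7) (𝓡 5) ∞ π := by
    rw [← ContMDiff.subtypeVal_comp_iff]
    exact (projFive.contDiff.contMDiff (n := ∞)).comp hτ
  have hπs : ∀ y, π (ρ (s' y)) = y := by
    intro y
    apply Subtype.ext
    change projFive (τ (ρ (s' y))) = y
    rw [hτρ]
    change projFive (σ y - inclFive (projFive (σ y)) + inclFive y) = y
    rw [map_add, map_sub, projFive_inclFive, projFive_inclFive, sub_self, zero_add]
  refine ⟨M, π, fun y => ρ (s' y), hπ, hρ.comp hs', hπs, fun x v => ?_, fun x => ?_⟩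
  · rw [← hker, ← projFive_eq_zero_iff]
    have h1 := tang_comp (n := 7) (m := 5) (p := 5) (g := (Subtype.val : M → _)) x
      (contMDiff_subtype_val (n := ∞) (I := 𝓡 5) _) (hπ x)
    have h2 := tang_comp (n := 7) (m := 7) (p := 5) (g := projFive) x
      (projFive.contDiff.contMDiff (n := ∞) _) (hτ x)
    have h3 : tang (n := 7) (m := 5) projFive (τ x) = projFive := by
      rw [tang_eq_fderiv]; exact projFive.fderiv
    rw [h3] at h2
    have h4 : tang (n := 5) (m := 5) (Subtype.val : M → EuclideanSpace ℝ (Fin 5)) (π x)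
        (tang (n := 7) (m := 5) π x v) = projFive (tang (n := 7) (m := 7) τ x v) :=
      (DFunLike.congr_fun h1 v).symm.trans (DFunLike.congr_fun h2 v)
    rw [← h4]
    constructor
    · intro h; rw [h, map_zero]
    · intro h; exact (tang_subtype_val_bijective M (π x)).1 (h.trans (map_zero _).symm)
  · set a := τ (ρ (s' (π x))) with ha
    have haW : a ∈ W := hτW _
    have hχ : ∀ u : ℝ, Real.smoothTransition u ∈ Set.Icc (0 : ℝ) 1 := fun u =>
      ⟨Real.smoothTransition.nonneg u, Real.smoothTransition.le_one u⟩
    -- The segment lies in `W` and in one fibre. Reparametrization by a smooth step function keeps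
    -- the curve in the segment for all times, so it is defined on the whole line.
    let c : EuclideanSpace ℝ (Fin 1) → W := fun u =>
      ⟨a + Real.smoothTransition (u 0) • (τ x - a),
        hW.add_smul_sub_mem haW (hτW x) (hχ (u 0))⟩
    have hc : ContMDiff (𝓡 1) (𝓡 7) ∞ c := by
      rw [← ContMDiff.subtypeVal_comp_iff]
      have h1 : ContDiff ℝ ∞ fun u : EuclideanSpace ℝ (Fin 1) => Real.smoothTransition (u 0) :=
        Real.smoothTransition.contDiff.comp
          (contDiff_euclidean.1 contDiff_id 0)
      exact (contDiff_const.add (h1.smul contDiff_const)).contMDiff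
    have hπa : projFive a = projFive (τ x) := congrArg Subtype.val (hπs (π x))
    refine ⟨fun u => ρ (c u), hρ.comp hc, ?_, ?_, fun u => ?_⟩
    · have : c 0 = s' (π x) := by
        apply Subtype.ext
        change a + Real.smoothTransition 0 • (τ x - a) = _
        rw [Real.smoothTransition.zero, zero_smul, add_zero, ha, hτρ]
      exact congrArg ρ this
    · have : c (EuclideanSpace.single 0 1) = ⟨τ x, hτW x⟩ := by
        apply Subtype.ext
        change a + Real.smoothTransition (EuclideanSpace.single (0 : Fin 1) (1 : ℝ) 0) •
          (τ x - a) = _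
        simp
      exact (congrArg ρ this).trans (hρτ x)
    · apply Subtype.ext
      change projFive (τ (ρ (c u))) = projFive (τ x)
      rw [hτρ]
      change projFive (a + Real.smoothTransition (u 0) • (τ x - a)) = projFive (τ x)
      rw [map_add, map_smul, map_sub, hπa, sub_self, smul_zero, add_zero]

end Projection

end

/-! ### Flat charts and leaf projections on the manifold -/

section

open Filter Topology

/-- Multiplication with a bump function makes a locally defined map global. -/
lemma contDiff_bump_smul {E F : Type} [NormedAddCommGroup E] [InnerProductSpace ℝ E]
    [FiniteDimensional ℝ E] [NormedAddCommGroup F] [NormedSpace ℝ F] {p : E} (f : ContDiffBump p)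
    {g : E → F} (hg : ∀ x ∈ Metric.closedBall p f.rOut, ContDiffAt ℝ ∞ g x) :
    ContDiff ℝ ∞ fun x => f x • g x := by
  refine contDiff_iff_contDiffAt.2 fun x => ?_
  by_cases hx : x ∈ Metric.closedBall p f.rOut
  · exact f.contDiff.contDiffAt.smul (hg x hx)
  · refine contDiffAt_const (c := (0 : F)) |>.congr_of_eventuallyEq ?_
    filter_upwards [Metric.isClosed_closedBall.isOpen_compl.mem_nhds hx] with y hy
    rw [f.zero_of_le_dist (le_of_lt (by simpa using hy)), zero_smul]

lemma extDeriv_one_apply {n : ℕ} {α : EuclideanSpace ℝ (Fin n) → Cov n 1}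
    {x : EuclideanSpace ℝ (Fin n)} (h : DifferentiableAt ℝ α x) (u v : EuclideanSpace ℝ (Fin n)) :
    extDeriv α x ![u, v] =
      fderiv ℝ (fun y => α y ![v]) x u - fderiv ℝ (fun y => α y ![u]) x v := by
  rw [extDeriv_apply h, Fin.sum_univ_two]
  have e0 : (0 : Fin 2).removeNth ![u, v] = ![v] := by funext i; fin_cases i; rfl
  have e1 : (1 : Fin 2).removeNth ![u, v] = ![u] := by funext i; fin_cases i; rfl
  rw [e0, e1]
  simp [sub_eq_add_neg]

section Charts

variable {n : ℕ} {N : Type*} [TopologicalSpace N] [ChartedSpace (EuclideanSpace ℝ (Fin n)) N]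
  [IsManifold (𝓡 n) ∞ N]

omit [IsManifold (𝓡 n) ∞ N] in
lemma chartRep_one_apply (x₀ : N) (α : Form n 1 N) (y v : EuclideanSpace ℝ (Fin n)) :
    chartRep x₀ α y ![v] = α ((extChartAt (𝓡 n) x₀).symm y)
      ![tang (n := n) (m := n) (extChartAt (𝓡 n) x₀).symm y v] := by
  rw [chartRep_apply]
  congr 1
  funext i; fin_cases i; rfl

lemma chartRep_tang (x₀ : N) (α : Form n 1 N) {x : N} (hx : x ∈ (extChartAt (𝓡 n) x₀).source)
    (v : EuclideanSpace ℝ (Fin n)) :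
    chartRep x₀ α (extChartAt (𝓡 n) x₀ x)
      ![tang (n := n) (m := n) (extChartAt (𝓡 n) x₀) x v] = α x ![v] := by
  set φ := extChartAt (𝓡 n) x₀ with hφ
  have h1 := tang_comp x (contMDiffAt_extChartAt_symm x₀ (φ.map_source hx))
    (contMDiffAt_extChartAt_of_mem x₀ hx)
  have e : (fun z => φ.symm (φ z)) =ᶠ[nhds x] id := by
    filter_upwards [(isOpen_extChartAt_source x₀).mem_nhds hx] with z hz
    exact φ.left_inv hz
  rw [tang_congr e, tang_id] at h1
  have h2 : tang (n := n) (m := n) φ.symm (φ x) (tang (n := n) (m := n) φ x v) = v :=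
    (DFunLike.congr_fun h1 v).symm
  rw [chartRep_one_apply, ← hφ, h2, φ.left_inv hx]

end Charts

section FlatCharts

variable {N : Type*} [TopologicalSpace N] [ChartedSpace (EuclideanSpace ℝ (Fin 7)) N]
  [IsManifold (𝓡 7) ∞ N] {κ : Fin 7 → Form 7 1 N} {P Q : N → ℝ}

omit [IsManifold (𝓡 7) ∞ N] in
lemma IsInvariantCoframing.d_apply_eq_zero (h : IsInvariantCoframing κ P Q) {x : N}
    {u v : EuclideanSpace ℝ (Fin 7)} (hu : ∀ i : Fin 7, i < 5 → κ i x ![u] = 0)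
    (hv : ∀ i : Fin 7, i < 5 → κ i x ![v] = 0) {i : Fin 7} (hi : i < 5) :
    d (κ i) x ![u, v] = 0 := by
  have e : ∀ a b : Cov 7 1, a ![u] = 0 → a ![v] = 0 → wedge a b ![u, v] = 0 := by
    intro a b hau hav
    refine (wedge_one_one_apply a b _).trans ?_
    simp [hau, hav]
  obtain rfl | rfl | rfl | rfl | rfl : i = 0 ∨ i = 1 ∨ i = 2 ∨ i = 3 ∨ i = 4 := by omega
  · rw [h.d_θ x u v (hu 0 hi) (hv 0 hi), e _ _ (hu 1 (by decide)) (hv 1 (by decide)),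
      e _ _ (hu 3 (by decide)) (hv 3 (by decide))]
    simp
  · exact (h.d_α x u v hu (hv 0 (by decide)) (hv 1 hi) (hv 2 (by decide))).1
  · exact (h.d_α x u v hu (hv 0 (by decide)) (hv 1 (by decide)) (hv 2 hi)).2
  · exact (h.d_β x u v hu (hv 0 (by decide)) (hv 3 hi) (hv 4 (by decide))).1
  · exact (h.d_β x u v hu (hv 0 (by decide)) (hv 3 (by decide)) (hv 4 hi)).2

/-- In the preferred chart the coframing is an invertible operator family, and the antisymmetrized
derivative of its `i`-th component is `dκᵢ`. The integrability condition is therefore the vanishing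
of `dκᵢ` on vertical vectors for `i < 5`. -/
lemma IsInvariantCoframing.exists_flat_chart (h : IsInvariantCoframing κ P Q) (p : N) :
    ∃ ψ : OpenPartialHomeomorph (EuclideanSpace ℝ (Fin 7)) (EuclideanSpace ℝ (Fin 7)),
      extChartAt (𝓡 7) p p ∈ ψ.source ∧ ψ.source ⊆ (extChartAt (𝓡 7) p).target ∧
      (∀ x ∈ ψ.source, ContDiffAt ℝ ∞ ψ x) ∧ (∀ y ∈ ψ.target, ContDiffAt ℝ ∞ ψ.symm y) ∧
      ∀ y ∈ ψ.source, ∀ v, (∀ i : Fin 7, i < 5 → fderiv ℝ ψ y v i = 0) ↔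
        ∀ i : Fin 7, i < 5 → chartRep p (κ i) y ![v] = 0 := by
  set φ := extChartAt (𝓡 7) p with hφ
  have hp : φ p ∈ φ.target := φ.map_source (mem_extChartAt_source p)
  obtain ⟨δ, hδ, hball⟩ := Metric.isOpen_iff.1 (isOpen_extChartAt_target (I := 𝓡 7) p) _ hp
  -- The vector space theorem asks for families smooth on the whole space; the cutoff provides them,
  -- and the two families remain inverse to each other on the inner ball, where it equals 1.
  let f : ContDiffBump (φ p) := ⟨δ / 4, δ / 2, by positivity, by linarith⟩
  let k : Fin 7 → EuclideanSpace ℝ (Fin 7) → Cov 7 1 := fun i => chartRep p (κ i)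
  have hk : ∀ i, ∀ y ∈ φ.target, ContDiffAt ℝ ∞ (k i) y :=
    fun i => isSmooth_iff.1 (h.frame.1 i) p
  have hli : ∀ y ∈ φ.target, LinearIndependent ℝ fun i => k i y :=
    fun y hy => linearIndependent_chartRep h.frame p hy
  have hsub : Metric.closedBall (φ p) f.rOut ⊆ φ.target := fun y hy =>
    hball (Metric.closedBall_subset_ball (by change δ / 2 < δ; linarith) hy)
  let K₀ := fun y => coframeMap (fun i => k i y)
  let Z₀ := fun y => (coframeMap (fun i => k i y)).inverse
  have hK : ContDiff ℝ ∞ fun y => f y • K₀ y :=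
    contDiff_bump_smul f fun y hy => contDiffAt_coframeMap fun i => hk i y (hsub hy)
  have hZ : ContDiff ℝ ∞ fun y => f y • Z₀ y :=
    contDiff_bump_smul f fun y hy => contDiffAt_inverse_coframeMap (fun i => hk i y (hsub hy))
      (hli y (hsub hy))
  set U := Metric.ball (φ p) f.rIn with hU
  have hUt : U ⊆ φ.target := fun y hy =>
    hsub (Metric.ball_subset_closedBall (Metric.ball_subset_ball f.rIn_lt_rOut.le hy))
  have hf1 : ∀ y ∈ U, f y = 1 := fun y hy =>
    f.one_of_mem_closedBall (Metric.ball_subset_closedBall hy)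
  have hKU : ∀ y ∈ U, f y • K₀ y = K₀ y := fun y hy => by rw [hf1 y hy, one_smul]
  have hZU : ∀ y ∈ U, f y • Z₀ y = Z₀ y := fun y hy => by rw [hf1 y hy, one_smul]
  have hPz : ∀ v : EuclideanSpace ℝ (Fin 7), inclFive (projFive v) = 0 ↔
      ∀ i : Fin 7, i < 5 → v i = 0 := by
    intro v
    rw [← projFive_eq_zero_iff]
    refine ⟨fun hv => ?_, fun hv => by rw [hv, map_zero]⟩
    rw [← projFive_inclFive (projFive v), hv, map_zero]
  obtain ⟨ψ, h1, h2, h3, h4, h5⟩ := Backlund.exists_flat_chart hK hZ Metric.isOpen_ball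
    (Metric.mem_ball_self f.rIn_pos) (p := φ p) (P := inclFive.comp projFive)
    (fun y hy v => by
      obtain ⟨e, he⟩ := isInvertible_coframeMap (hli y (hUt hy))
      rw [hKU y hy, hZU y hy]
      change coframeMap _ ((coframeMap _).inverse v) = v
      rw [← he, ContinuousLinearMap.inverse_equiv]
      exact e.apply_symm_apply v)
    (fun y hy v => by
      obtain ⟨e, he⟩ := isInvertible_coframeMap (hli y (hUt hy))
      rw [hKU y hy, hZU y hy]
      change (coframeMap _).inverse (coframeMap _ v) = v
      rw [← he, ContinuousLinearMap.inverse_equiv]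
      exact e.symm_apply_apply v)
    (fun v => by
      change inclFive (projFive (inclFive (projFive v))) = _
      rw [projFive_inclFive]; rfl)
    (fun y hy z w hz hw => by
      have hyt := hUt hy
      have e : (fun y => f y • K₀ y) =ᶠ[𝓝 y] K₀ := by
        filter_upwards [Metric.isOpen_ball.mem_nhds hy] with q hq using hKU q hq
      rw [hKU y hy] at hz hw
      rw [e.fderiv_eq, ← sub_eq_zero, ← map_sub]
      refine (hPz _).2 fun i hi => ?_
      have hz' : ∀ j : Fin 7, j < 5 → k j y ![z] = 0 := fun j hj =>
        (coframeMap_apply _ _ _).symm.trans ((hPz _).1 hz j hj)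
      have hw' : ∀ j : Fin 7, j < 5 → k j y ![w] = 0 := fun j hj =>
        (coframeMap_apply _ _ _).symm.trans ((hPz _).1 hw j hj)
      have hdK : DifferentiableAt ℝ K₀ y :=
        (contDiffAt_coframeMap fun i => hk i y hyt).differentiableAt (by simp)
      have hd : ∀ z w, fderiv ℝ K₀ y z w i = fderiv ℝ (fun q => k i q ![w]) y z := by
        intro z w
        have a0 : HasFDerivAt (fun q => K₀ q w) ((fderiv ℝ K₀ y).flip w) y := by
          simpa using hdK.hasFDerivAt.clm_apply (hasFDerivAt_const w y)
        have a1 : HasFDerivAt (fun q => (K₀ q w) i)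
            ((EuclideanSpace.proj i : EuclideanSpace ℝ (Fin 7) →L[ℝ] ℝ).comp
              ((fderiv ℝ K₀ y).flip w)) y :=
          (EuclideanSpace.proj i : EuclideanSpace ℝ (Fin 7) →L[ℝ] ℝ).hasFDerivAt.comp y a0
        have a2 : (fun q => (K₀ q w) i) = fun q => k i q ![w] :=
          funext fun q => coframeMap_apply _ _ _
        rw [a2] at a1
        rw [a1.fderiv]
        rfl
      change fderiv ℝ K₀ y z w i - fderiv ℝ K₀ y w z i = 0
      rw [hd, hd, ← extDeriv_one_apply ((hk i y hyt).differentiableAt (by simp))]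
      have a3 := chartRep_d (h.frame.1 i) p hyt
      change extDeriv (chartRep p (κ i)) y ![z, w] = 0
      rw [← a3, chartRep_apply]
      have a4 : (fun j => tang (n := 7) (m := 7) (extChartAt (𝓡 7) p).symm y (![z, w] j)) =
          ![tang (n := 7) (m := 7) (extChartAt (𝓡 7) p).symm y z,
            tang (n := 7) (m := 7) (extChartAt (𝓡 7) p).symm y w] := by
        funext j; fin_cases j <;> rfl
      rw [a4]
      exact h.d_apply_eq_zero (fun j hj => (chartRep_one_apply p (κ j) y z).symm.trans (hz' j hj))
        (fun j hj => (chartRep_one_apply p (κ j) y w).symm.trans (hw' j hj)) hi)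
  refine ⟨ψ, h1, h2.trans hUt, h3, h4, fun y hy v => ?_⟩
  rw [← hPz]
  refine (h5 y hy v).trans ?_
  rw [hKU y (h2 hy)]
  refine (hPz _).trans (forall₂_congr fun i hi => ?_)
  rw [coframeMap_apply]

/-- The preimage of a ball under the preferred chart at a point. -/
def chartBall (p : N) (r : ℝ) : TopologicalSpace.Opens N :=
  ⟨(extChartAt (𝓡 7) p).source ∩ extChartAt (𝓡 7) p ⁻¹' Metric.ball (extChartAt (𝓡 7) p p) r,
    (continuousOn_extChartAt p).isOpen_inter_preimage (isOpen_extChartAt_source p)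
      Metric.isOpen_ball⟩

omit [IsManifold (𝓡 7) ∞ N] in
lemma mem_chartBall (p : N) {r : ℝ} (hr : 0 < r) : p ∈ chartBall p r :=
  ⟨mem_extChartAt_source p, Metric.mem_ball_self hr⟩

/-- The neighbourhoods are balls of the preferred chart, which do not depend on the coframing, and
the statement holds for all small radii. Two coframings can thus be treated on one neighbourhood. -/
lemma IsInvariantCoframing.eventually_exists_isLeafProjection (h : IsInvariantCoframing κ P Q)
    (p : N) : ∀ᶠ r in 𝓝[>] (0 : ℝ),
      ∃ (M : TopologicalSpace.Opens (EuclideanSpace ℝ (Fin 5))) (π : chartBall p r → M)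
        (s : M → chartBall p r), IsLeafProjection
          (fun i => Backlund.pullback (n := 7) (Subtype.val : chartBall p r → N) (κ i)) π s := by
  obtain ⟨ψ, h1, h2, h3, h4, h5⟩ := h.exists_flat_chart p
  set φ := extChartAt (𝓡 7) p with hφ
  filter_upwards [eventually_convex_image_ball ψ h1 (h3 _ h1) h4] with r hr
  set V := chartBall p r with hV
  let W : TopologicalSpace.Opens (EuclideanSpace ℝ (Fin 7)) :=
    ⟨ψ '' Metric.ball (φ p) r, ψ.isOpen_image_of_subset_source Metric.isOpen_ball hr.1⟩
  have hVs : ∀ x : V, (x : N) ∈ φ.source := fun x => x.2.1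
  have hVb : ∀ x : V, φ x ∈ Metric.ball (φ p) r := fun x => x.2.2
  have hW : ∀ w : W, (w : EuclideanSpace ℝ (Fin 7)) ∈ ψ.target ∧
      ψ.symm w ∈ Metric.ball (φ p) r := by
    rintro ⟨_, y, hy, rfl⟩
    refine ⟨ψ.map_source (hr.1 hy), ?_⟩
    change ψ.symm (ψ y) ∈ Metric.ball (φ p) r
    rwa [ψ.left_inv (hr.1 hy)]
  have hWt : ∀ w : W, ψ.symm w ∈ φ.target := fun w => h2 (hr.1 (hW w).2)
  let τ : V → EuclideanSpace ℝ (Fin 7) := fun x => ψ (φ x)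
  have hval : ContMDiff (𝓡 7) (𝓡 7) ∞ (Subtype.val : V → N) := contMDiff_subtype_val
  have hφV : ∀ x : V, ContMDiffAt (𝓡 7) (𝓡 7) ∞ (fun x : V => φ x) x := fun x =>
    ContMDiffAt.comp (g := φ) (f := (Subtype.val : V → N)) x
      (contMDiffAt_extChartAt_of_mem p (hVs x)) (hval x)
  have hψV : ∀ x : V, ContMDiffAt (𝓡 7) (𝓡 7) ∞ ψ (φ x) := fun x =>
    (h3 _ (hr.1 (hVb x))).contMDiffAt
  have hτ : ContMDiff (𝓡 7) (𝓡 7) ∞ τ := fun x =>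
    ContMDiffAt.comp (g := ψ) (f := fun x : V => φ x) x (hψV x) (hφV x)
  have hτW : ∀ x, τ x ∈ W := fun x => ⟨φ x, hVb x, rfl⟩
  let ρ : W → V := fun w => ⟨φ.symm (ψ.symm w), φ.map_target (hWt w), by
    change φ (φ.symm (ψ.symm w)) ∈ Metric.ball (φ p) r
    rw [φ.right_inv (hWt w)]
    exact (hW w).2⟩
  have hφρ : ∀ w, φ (ρ w) = ψ.symm w := fun w => φ.right_inv (hWt w)
  refine exists_isLeafProjection W hr.2 hτ hτW (ρ := ρ) ?_ (fun w => ?_) (fun x => ?_)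
    fun x v => ?_
  · rw [← ContMDiff.subtypeVal_comp_iff]
    intro w
    have a1 : ContMDiffAt (𝓡 7) (𝓡 7) ∞ (fun w : W => ψ.symm w) w :=
      ContMDiffAt.comp (g := ψ.symm) (f := (Subtype.val : W → EuclideanSpace ℝ (Fin 7))) w
        (h4 _ (hW w).1).contMDiffAt (contMDiff_subtype_val (I := 𝓡 7) w)
    exact ContMDiffAt.comp (g := φ.symm) (f := fun w : W => ψ.symm w) w
      (contMDiffAt_extChartAt_symm p (hWt w)) a1
  · change ψ (φ (ρ w)) = w
    rw [hφρ, ψ.right_inv (hW w).1]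
  · apply Subtype.ext
    change φ.symm (ψ.symm (ψ (φ x))) = x
    rw [ψ.left_inv (hr.1 (hVb x)), φ.left_inv (hVs x)]
  · have a1 := tang_comp (n := 7) (m := 7) (p := 7) x (hψV x) (hφV x)
    have a2 := tang_comp (n := 7) (m := 7) (p := 7) (g := φ) (f := (Subtype.val : V → N)) x
      (contMDiffAt_extChartAt_of_mem p (hVs x)) (hval x)
    have a3 : tang (n := 7) (m := 7) τ x v = fderiv ℝ ψ (φ x)
        (tang (n := 7) (m := 7) φ x (tang (n := 7) (m := 7) (Subtype.val : V → N) x v)) := by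
      refine (DFunLike.congr_fun a1 v).trans ?_
      rw [a2, tang_eq_fderiv]
      rfl
    rw [a3, h5 _ (hr.1 (hVb x))]
    refine forall₂_congr fun i hi => ?_
    rw [chartRep_tang p (κ i) (hVs x), pullback_apply_one]

end FlatCharts

section Restriction

variable {N : Type*} [TopologicalSpace N] [ChartedSpace (EuclideanSpace ℝ (Fin 7)) N]

lemma Forms7.leftFrame_restrict (Ω : Forms7 N) (c : Coeffs N) (V : TopologicalSpace.Opens N) :
    (Ω.restrict V).leftFrame (c.restrict V) =
      fun i => pullback (n := 7) (Subtype.val : V → N) (Ω.leftFrame c i) := by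
  funext i
  fin_cases i <;> rfl

lemma Forms7.rightFrame_restrict (Ω : Forms7 N) (c : Coeffs N) (V : TopologicalSpace.Opens N) :
    (Ω.restrict V).rightFrame (c.restrict V) =
      fun i => pullback (n := 7) (Subtype.val : V → N) (Ω.rightFrame c i) := by
  funext i
  fin_cases i <;> rfl

end Restriction

end

end Backlund

end

theorem proposition4p3 {U : Type*} [TopologicalSpace U]
    [ChartedSpace (EuclideanSpace ℝ (Fin 7)) U] [IsManifold (𝓡 7) ∞ U]
    (Ω : Backlund.Forms7 U) (ε : ℝ) (c : Backlund.Coeffs U)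
    (hΩ : Ω.IsCoframing) (hc : Backlund.TypeACongruences Ω ε c)
    (hinv : Backlund.InvarianceProperty Ω c) :
    Backlund.IsFrobenius (Ω.systemK c) ∧ Backlund.IsFrobenius (Ω.systemKb c) ∧
    ∀ p : U, ∃ V : TopologicalSpace.Opens U, p ∈ V ∧
      ∃ (M Mb : TopologicalSpace.Opens (EuclideanSpace ℝ (Fin 5)))
        (I : Backlund.EDS 5 M) (Ib : Backlund.EDS 5 Mb) (𝓑 : Backlund.EDS 7 V)
        (π : V → M) (πb : V → Mb),
        Backlund.IsTypeA 𝓑 I Ib π πb ∧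
        Backlund.IsZeroAdapted (Ω.restrict V) 𝓑 I Ib π πb ∧
        Backlund.IsLeafSpace (n := 7) (m := 5) ((Ω.restrict V).systemK (c.restrict V)) π ∧
        Backlund.IsLeafSpace (n := 7) (m := 5) ((Ω.restrict V).systemKb (c.restrict V)) πb ∧
        (∀ k (α : Backlund.Form 7 k V), Backlund.AlgIdeal (I.pull π) k α ↔
          Backlund.AlgIdeal (Backlund.gens {(Ω.restrict V).w0}
            {Backlund.fwedge (Ω.restrict V).w1 (Ω.restrict V).w2,
             Backlund.fwedge ((Ω.restrict V).w3' (c.restrict V))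
               ((Ω.restrict V).w4' (c.restrict V))}) k α) ∧
        (∀ k (α : Backlund.Form 7 k V), Backlund.AlgIdeal (Ib.pull πb) k α ↔
          Backlund.AlgIdeal (Backlund.gens {(Ω.restrict V).wb}
            {Backlund.fwedge ((Ω.restrict V).w1' (c.restrict V))
               ((Ω.restrict V).w2' (c.restrict V)),
             Backlund.fwedge (Ω.restrict V).w3 (Ω.restrict V).w4}) k α) ∧
        (∀ k (α : Backlund.Form 7 k V), α ∈ 𝓑.carrier k ↔
          Backlund.AlgIdeal (Backlund.gens
            {(Ω.restrict V).w0, (Ω.restrict V).wb, (Ω.restrict V).γ}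
            {Backlund.fwedge (Ω.restrict V).w1 (Ω.restrict V).w2,
             Backlund.fwedge (Ω.restrict V).w3 (Ω.restrict V).w4}) k α) := by
  have hL := hc.leftFrame_isInvariantCoframing hΩ hinv
  have hR := hc.rightFrame_isInvariantCoframing hΩ hinv
  refine ⟨hL.isFrobenius, hR.isFrobenius, fun p => ?_⟩
  -- One radius that is small enough for both foliations.
  obtain ⟨r, hr0, ⟨M, π, s, hl⟩, Mb, πb, sb, hr⟩ :=
    ((eventually_mem_nhdsWithin (a := (0 : ℝ)) (s := Set.Ioi 0)).and
      ((hL.eventually_exists_isLeafProjection p).and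
        (hR.eventually_exists_isLeafProjection p))).exists
  let V := Backlund.chartBall p r
  have hv : ContMDiff (𝓡 7) (𝓡 7) ∞ (Subtype.val : V → U) := contMDiff_subtype_val
  have hL' := hL.pullback hv (Backlund.tang_subtype_val_bijective V)
  have hR' := hR.pullback hv (Backlund.tang_subtype_val_bijective V)
  rw [← Backlund.Forms7.leftFrame_restrict Ω c V] at hL' hl
  rw [← Backlund.Forms7.rightFrame_restrict Ω c V] at hR' hr
  have hΩ' := hΩ.restrict V
  have hc' := hc.restrict hΩ V
  exact ⟨V, Backlund.mem_chartBall p hr0, M, Mb, hl.leafEDS hL', hr.leafEDS hR',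
    Backlund.TypeACongruences.backlundEDS hΩ' hc' hL' hR', π, πb,
    hc'.isTypeA hΩ' hL' hR' hl hr, hc'.isZeroAdapted hΩ' hL' hR' hl hr,
    hl.isLeafSpace hL', hr.isLeafSpace hR', hl.algIdeal_pull_leafEDS_iff hL',
    hr.algIdeal_pull_leafEDS_iff hR', fun _ _ => Iff.rfl⟩
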